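/- Let $E/F$ be a quadratic extension of number fields, $c\neq 0$ an ideal of $\mathcal O_F$, $\mathcal O_c=\mathcal O_F+c\,\mathcal O_E$, and let $T$ be the torus $T(R)=(\mathcal O_c\otimes_{\mathcal O_F} R)^\times/R^\times$; thus $T(F)=E^\times/F^\times$, $T(F_\infty)=(E\otimes_F F_\infty)^\times/F_\infty^\times$, $T(\mathbb A_F^\infty)=(E\otimes_F\mathbb A_F^\infty)^\times/(\mathbb A_F^\infty)^\times$ and $T(\mathbb A_F)=T(F_\infty)\times T(\mathbb A_F^\infty)$. Let $\Sigma_T=\{\sigma_1,\dots,\sigma_u\}$ be the set of archimedean places of $F$ which split in $E$, and for each of them fix an identification $T(F_\sigma)\simeq F_\sigma^\times$. Put $T(F_\sigma)_0=\mathbb R_{>0}\subset F_\sigma^\times$ for $\sigma\in\Sigma_T$ and $T(F_\sigma)_0=1$ for the other $\sigma\mid\infty$; let $T(F_\infty)_0=\prod_\sigma T(F_\sigma)_0$, let $T(F_\infty)_+$ be the identity component of $T(F_\infty)$ and $S$ its maximal compact subgroup, so that $T(F_\infty)_+=T(F_\infty)_0\times S$. **The map $\partial$.** For $\Sigma\subseteq\Sigma_T$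 let $C^\Sigma=C^\Sigma(T(\mathbb A_F),\mathbb C)$ be the space of continuous functions on $T(\mathbb A_F)$ which are $C^\infty$ in the variable in $T(F_\infty)$ and invariant under $T(F_\sigma)_0$ for all $\sigma\in\Sigma_T\setminus\Sigma$, with the action $(\gamma f)(t)=f(\gamma^{-1}t)$ of $T(F)$. For $\sigma\in\Sigma$ let $\delta_\sigma f(t)=\frac{d}{dx}f(te^x)|_{x=0}$, $e^x\in T(F_\sigma)_0$, and let $D_\sigma^\Sigma=\{f\in C^\Sigma:\delta_\sigma f\in C^\Sigma\}$. The sequence of $T(F)$-modules $$0\to C^{\Sigma\setminus\sigma}\to D_\sigma^\Sigma\xrightarrow{\ \delta_\sigma\ }C^\Sigma\to0$$ is exact. Let $\partial:H^0(T(F),C^{\Sigma_T})\to H^u(T(F),C^{\emptyset})$ be the composite of the connecting maps for $\sigma_1,\dots,\sigma_u$, in this order. **The class $\eta$.** Let $U=T(\hat{\mathcal O}_F)$ be the image of $\hat{\mathcal O}_c^\times$ in $T(\mathbb A_F^\infty)$, $T(F)_+=T(F)\cap T(F_\infty)_+$, $T(\mathcal O_F)_+=T(F)_+\cap U$, $\mathrm{Cl}(T)_+=T(\mathbb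 A_F^\infty)/UT(F)_+$, let $\bar t_i$ be representatives of the elements of $\mathrm{Cl}(T)_+$ and $\mathcal F=\bigcup_i\bar t_iU$. The image $\Lambda$ of $T(\mathcal O_F)_+$ under $t\mapsto(\log|t|_\sigma)_{\sigma\in\Sigma_T}$ is a lattice in $\mathbb R^u\simeq T(F_\infty)_0$. Let $\varepsilon_1,\dots,\varepsilon_u\in T(\mathcal O_F)_+$ lift a basis of $\Lambda$, and let $\xi\in H_u(T(\mathcal O_F)_+,\mathbb Z)$ be the image of the fundamental class of $T(F_\infty)_0/\Lambda$ under the splitting $\Lambda\to T(\mathcal O_F)_+$ so defined, i.e. the class of the inhomogeneous cycle $$(-1)^{u(u+1)/2}\,\mathrm{sgn}\det\big(\log|\varepsilon_i|_{\sigma_j}\big)_{i,j}\sum_{\pi\in S_u}\mathrm{sgn}(\pi)\,[\varepsilon_{\pi(1)}|\cdots|\varepsilon_{\pi(u)}]$$ (the sign is that of the normalization $e(\omega)\cap\xi=\int_{T(F_\infty)_0/\Lambda}\omega$ for $\Lambda$-invariant $u$-forms $\omega$, where $T(F_\infty)_0$ is oriented by $(\log|t|_{\sigma_j})_j$ and $e:H^0(\Lambda,\Omega^u)\to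 H^u(\Lambda,\mathbb R)$ is the composite of the connecting maps in the above order). Let $C_c^\emptyset(T(\mathbb A_F),\mathbb Z)$ be the $T(F)$-module of the $\mathbb Z$-valued functions in $C^\emptyset$ which are compactly supported in the variable in $T(\mathbb A_F^\infty)$, and let $\eta\in H_u(T(F),C_c^\emptyset(T(\mathbb A_F),\mathbb Z))$ be the image of $\xi$ under the map induced by $T(\mathcal O_F)_+\subseteq T(F)$ and by the map of $T(\mathcal O_F)_+$-modules $\mathbb Z\to C_c^\emptyset(T(\mathbb A_F),\mathbb Z)$ that sends $1$ to the function $(t_\infty,t_f)\mapsto1_{T(F_\infty)_+}(t_\infty)1_{\mathcal F}(t_f)$. **Measures and cap product.** Let $d^\times s$ and $d^\times t_f$ be Haar measures on $S$ and $T(\mathbb A_F^\infty)$, let $d^\times t_0=\prod_{\sigma\in\Sigma_T}dr_\sigma/r_\sigma$ on $T(F_\infty)_0$, and let $d^\times t$ be the Haar measure on $T(\mathbb A_F)$ which is $d^\times t_0\,d^\times s\,d^\times t_f$ on $T(F_\infty)_0\times S\times T(\mathbb A_F^\infty)$. Let $\cap:H^u(T(F),C^\emptyset)\times H_u(T(F),C_c^\emptyset(T(\mathbb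 A_F),\mathbb Z))\to\mathbb C$ be the cap product induced by the $T(F)$-invariant pairing $$\langle f,b\rangle=\sum_{z\in T(F_\infty)/T(F_\infty)_+}\int_S\int_{T(\mathbb A_F^\infty)}f(zs,t_f)\,b(zs,t_f)\,d^\times t_f\,d^\times s .$$ **Proposition.** The function $\iota(1_{\mathcal F}):(t_\infty,t_f)\mapsto1_{T(F_\infty)_+}(t_\infty)1_{\mathcal F}(t_f)$ lies in $C_c^\emptyset(T(\mathbb A_F),\mathbb Z)$ and a class $\eta$ as above exists; $T(F)$ has a fundamental domain in $T(\mathbb A_F)$; and for every $T(F)$-invariant $\phi\in C^{\Sigma_T}(T(\mathbb A_F),\mathbb C)$ and every such $\eta$, $\phi$ is integrable over $T(\mathbb A_F)/T(F)$ (that is, over any fundamental domain) and $$\partial\phi\cap\eta=h\int_{T(\mathbb A_F)/T(F)}\phi(t)\,d^\times t,\qquad h=\#T(\mathcal O_F)_{+,\mathrm{tors}}.$$ -/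

import Mathlib

open NumberField IsDedekindDomain MeasureTheory CategoryTheory
open scoped TensorProduct ContDiff NumberField.LiesOver

set_option linter.all false

noncomputable section

namespace RelTorus

/-! ### The torus `T = Eˣ / Fˣ` over a number field `F` -/

section Adelic

variable (F E : Type) [Field F] [NumberField F] [Field E] [NumberField E] [Algebra F E]

/-- Every infinite place of `E` lies over its restriction to `F`. -/
instance liesOver_comap (w : InfinitePlace E) : w.LiesOver (w.comap (algebraMap F E)) :=
  ⟨rfl⟩

/-- The canonical ring homomorphism `F_∞ → E_∞`: at a place `w` of `E` it is the inclusion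
`F_v → E_w`, where `v` is the place of `F` below `w`. -/
def infMap : InfiniteAdeleRing F →+* InfiniteAdeleRing E :=
  RingHom.mk'
    { toFun := fun a w =>
        LiesOver.completionMap (v := w.comap (algebraMap F E)) (w := w)
          (a (w.comap (algebraMap F E)))
      map_one' := funext fun _ => map_one _
      map_mul' := fun _ _ => funext fun _ => map_mul _ _ _ }
    (fun a b => funext fun w =>
      map_add (LiesOver.completionMap (v := w.comap (algebraMap F E)) (w := w))
        (a (w.comap (algebraMap F E))) (b (w.comap (algebraMap F E))))

/-- `Ê = E ⊗_F 𝔸_F^∞`, the finite adeles of `E`, as an algebra over the finite adeles of `F`. -/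
def FinAdeles : Type := FiniteAdeleRing (𝓞 F) F ⊗[F] E

instance : CommRing (FinAdeles F E) :=
  inferInstanceAs (CommRing (FiniteAdeleRing (𝓞 F) F ⊗[F] E))

instance : Algebra (FiniteAdeleRing (𝓞 F) F) (FinAdeles F E) :=
  inferInstanceAs (Algebra (FiniteAdeleRing (𝓞 F) F) (FiniteAdeleRing (𝓞 F) F ⊗[F] E))

instance : Module.Finite (FiniteAdeleRing (𝓞 F) F) (FinAdeles F E) :=
  haveI : Module.Finite F E := Module.Finite.of_restrictScalars_finite ℚ F E
  inferInstanceAs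
    (Module.Finite (FiniteAdeleRing (𝓞 F) F) (FiniteAdeleRing (𝓞 F) F ⊗[F] E))

/-- `Ê` is a free module of finite rank over `𝔸_F^∞`; it carries the corresponding product
topology. -/
instance : TopologicalSpace (FinAdeles F E) :=
  moduleTopology (FiniteAdeleRing (𝓞 F) F) (FinAdeles F E)

instance : IsModuleTopology (FiniteAdeleRing (𝓞 F) F) (FinAdeles F E) := ⟨rfl⟩

instance : IsTopologicalRing (FinAdeles F E) :=
  IsModuleTopology.isTopologicalRing (FiniteAdeleRing (𝓞 F) F) (FinAdeles F E)

/-- The diagonal embedding `E → Ê`. -/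
def finEmb : E →+* FinAdeles F E :=
  (Algebra.TensorProduct.includeRight : E →ₐ[F] FiniteAdeleRing (𝓞 F) F ⊗[F] E).toRingHom

theorem finEmb_algebraMap (x : F) :
    finEmb F E (algebraMap F E x) =
      algebraMap (FiniteAdeleRing (𝓞 F) F) (FinAdeles F E) (algebraMap F _ x) := by
  change (1 : FiniteAdeleRing (𝓞 F) F) ⊗ₜ[F] (algebraMap F E x) =
    (algebraMap F (FiniteAdeleRing (𝓞 F) F) x) ⊗ₜ[F] (1 : E)
  rw [Algebra.algebraMap_eq_smul_one, Algebra.algebraMap_eq_smul_one, TensorProduct.smul_tmul]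

theorem infMap_algebraMap (x : F) :
    algebraMap E (InfiniteAdeleRing E) (algebraMap F E x) =
      infMap F E (algebraMap F (InfiniteAdeleRing F) x) := by
  funext w
  exact IsScalarTower.algebraMap_apply F (w.comap (algebraMap F E)).Completion w.Completion x

/-- `T(F) = Eˣ / Fˣ`. -/
def TRat : Type := Eˣ ⧸ (Units.map (algebraMap F E : F →* E)).range

instance : CommGroup (TRat F E) := inferInstanceAs (CommGroup (Eˣ ⧸ (Units.map (algebraMap F E : F →* E)).range))

/-- `T(F_∞) = E_∞ˣ / F_∞ˣ`. -/
def TInf : Type :=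
  (InfiniteAdeleRing E)ˣ ⧸
    (Units.map (infMap F E : InfiniteAdeleRing F →* InfiniteAdeleRing E)).range

instance : CommGroup (TInf F E) := inferInstanceAs (CommGroup ((InfiniteAdeleRing E)ˣ ⧸
    (Units.map (infMap F E : InfiniteAdeleRing F →* InfiniteAdeleRing E)).range))

instance : TopologicalSpace (TInf F E) := inferInstanceAs (TopologicalSpace ((InfiniteAdeleRing E)ˣ ⧸
    (Units.map (infMap F E : InfiniteAdeleRing F →* InfiniteAdeleRing E)).range))

instance : IsTopologicalGroup (TInf F E) := inferInstanceAs (IsTopologicalGroup ((InfiniteAdeleRing E)ˣ ⧸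
    (Units.map (infMap F E : InfiniteAdeleRing F →* InfiniteAdeleRing E)).range))

/-- `T(𝔸_F^∞) = Êˣ / (𝔸_F^∞)ˣ`. -/
def TFin : Type :=
  (FinAdeles F E)ˣ ⧸
    (Units.map (algebraMap (FiniteAdeleRing (𝓞 F) F) (FinAdeles F E) :
      FiniteAdeleRing (𝓞 F) F →* FinAdeles F E)).range

instance : CommGroup (TFin F E) := inferInstanceAs (CommGroup ((FinAdeles F E)ˣ ⧸
    (Units.map (algebraMap (FiniteAdeleRing (𝓞 F) F) (FinAdeles F E) :
      FiniteAdeleRing (𝓞 F) F →* FinAdeles F E)).range))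

instance : TopologicalSpace (TFin F E) := inferInstanceAs (TopologicalSpace ((FinAdeles F E)ˣ ⧸
    (Units.map (algebraMap (FiniteAdeleRing (𝓞 F) F) (FinAdeles F E) :
      FiniteAdeleRing (𝓞 F) F →* FinAdeles F E)).range))

instance : IsTopologicalGroup (TFin F E) := inferInstanceAs (IsTopologicalGroup ((FinAdeles F E)ˣ ⧸
    (Units.map (algebraMap (FiniteAdeleRing (𝓞 F) F) (FinAdeles F E) :
      FiniteAdeleRing (𝓞 F) F →* FinAdeles F E)).range))

/-- `T(𝔸_F) = T(F_∞) × T(𝔸_F^∞)`. -/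
abbrev TAdele : Type := TInf F E × TFin F E

instance : MeasurableSpace (TInf F E) := borel _
instance : BorelSpace (TInf F E) := ⟨rfl⟩
instance : MeasurableSpace (TFin F E) := borel _
instance : BorelSpace (TFin F E) := ⟨rfl⟩

/-- The diagonal map `T(F) → T(F_∞)`. -/
def toInf : TRat F E →* TInf F E :=
  QuotientGroup.map _ _
    (Units.map (algebraMap E (InfiniteAdeleRing E) : E →* InfiniteAdeleRing E)) (by
      rintro _ ⟨x, rfl⟩
      exact ⟨Units.map (algebraMap F (InfiniteAdeleRing F) : F →* InfiniteAdeleRing F) x,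
        Units.ext (infMap_algebraMap F E x).symm⟩)

/-- The diagonal map `T(F) → T(𝔸_F^∞)`. -/
def toFin : TRat F E →* TFin F E :=
  QuotientGroup.map _ _ (Units.map (finEmb F E : E →* FinAdeles F E)) (by
      rintro _ ⟨x, rfl⟩
      exact ⟨Units.map (algebraMap F (FiniteAdeleRing (𝓞 F) F) :
        F →* FiniteAdeleRing (𝓞 F) F) x, Units.ext (finEmb_algebraMap F E x).symm⟩)

/-- The diagonal map `T(F) → T(𝔸_F)`. -/
def diag : TRat F E →* TAdele F E := (toInf F E).prod (toFin F E)

/-- `T(F_∞)_+`, the connected component of the identity of `T(F_∞)`. -/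
def infPos : Subgroup (TInf F E) := Subgroup.connectedComponentOfOne (TInf F E)

/-- `𝒪̂_F`, the ring of everywhere integral finite adeles of `F`. -/
def intAdeles : Subring (FiniteAdeleRing (𝓞 F) F) where
  carrier := {a | ∀ v, a v ∈ v.adicCompletionIntegers F}
  mul_mem' ha hb v := mul_mem (ha v) (hb v)
  one_mem' v := one_mem (v.adicCompletionIntegers F)
  add_mem' ha hb v := add_mem (ha v) (hb v)
  zero_mem' v := zero_mem (v.adicCompletionIntegers F)
  neg_mem' ha v := neg_mem (ha v)

variable {F}

/-- The order `𝒪_c = 𝒪_F + c 𝒪_E` of conductor `c` in `E`, where `c` is an ideal of `𝒪_F`. -/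
def order (c : Ideal (𝓞 F)) : Set (𝓞 E) :=
  {x | ∃ a : 𝓞 F, ∃ y ∈ c.map (algebraMap (𝓞 F) (𝓞 E)), x = algebraMap (𝓞 F) (𝓞 E) a + y}

/-- The ring `𝒪̂_c ⊆ Ê`, the image of `𝒪_c ⊗ 𝒪̂_F`, i.e. the `𝒪̂_F`-subalgebra generated by
`𝒪_c`. -/
def hatOrder (c : Ideal (𝓞 F)) : Subalgebra (intAdeles F) (FinAdeles F E) :=
  Algebra.adjoin (intAdeles F)
    ((fun x : 𝓞 E => finEmb F E (algebraMap (𝓞 E) E x)) '' order E c)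

/-- `U = T(𝒪̂_F)`, the image of `𝒪̂_cˣ` in `T(𝔸_F^∞)`. -/
def maxCompact (c : Ideal (𝓞 F)) : Subgroup (TFin F E) :=
  Subgroup.map (QuotientGroup.mk' _) (hatOrder E c).toSubmonoid.units

/-- `T(F)_+ = T(F) ∩ T(F_∞)_+`. -/
def ratPos : Subgroup (TRat F E) := (infPos F E).comap (toInf F E)

/-- `T(𝒪_F)_+ = T(F)_+ ∩ U`. -/
def unitsPos (c : Ideal (𝓞 F)) : Subgroup (TRat F E) :=
  ratPos E ⊓ (maxCompact E c).comap (toFin F E)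

/-- `Cl(T)_+ = T(𝔸_F^∞) / (U · T(F)_+)`. -/
abbrev ClPos (c : Ideal (𝓞 F)) : Type :=
  TFin F E ⧸ (maxCompact E c ⊔ (ratPos E).map (toFin F E))

/-- `h`, the number of torsion elements of `T(𝒪_F)_+`. -/
def torsionCard (c : Ideal (𝓞 F)) : ℕ := Nat.card (CommGroup.torsion (unitsPos E c))

/-- The compact set `𝓕 = ⋃ᵢ t̄ᵢ U ⊆ T(𝔸_F^∞)`, for a family `t̄` indexed by `Cl(T)_+`. -/
def finDomain (c : Ideal (𝓞 F)) (t : ClPos E c → TFin F E) : Set (TFin F E) :=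
  {x | ∃ i, ∃ y ∈ maxCompact E c, x = t i * y}

end Adelic

/-! ### Split infinite places -/

section Split

variable (F E : Type) [Field F] [NumberField F] [Field E] [NumberField E] [Algebra F E]

/-- An enumeration `σ 0, …, σ (u - 1)` of the set `Σ_T` of the infinite places of `F` that split
in `E` (those with two different places of `E` above them), together with, for each of them, an
ordering `(w i, w' i)` of the two places of `E` above `σ i`. This ordering is the same thing as
the choice of an identification `E_σ ≃ F_σ × F_σ`, hence of
`T(F_σ) ≃ F_σˣ`, `(a, b) ↦ a / b`. -/
structure SplitPlaces where
  u : ℕ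
  σ : Fin u → InfinitePlace F
  σ_injective : Function.Injective σ
  range_σ : Set.range σ =
    {v | ∃ w w' : InfinitePlace E, w ≠ w' ∧ w.comap (algebraMap F E) = v ∧
      w'.comap (algebraMap F E) = v}
  w : Fin u → InfinitePlace E
  w' : Fin u → InfinitePlace E
  w_ne : ∀ i, w i ≠ w' i
  comap_w : ∀ i, (w i).comap (algebraMap F E) = σ i
  comap_w' : ∀ i, (w' i).comap (algebraMap F E) = σ i

variable {F E}

theorem norm_infMap (a : InfiniteAdeleRing F) (w : InfinitePlace E) :
    ‖infMap F E a w‖ = ‖a (w.comap (algebraMap F E))‖ := by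
  have h : Isometry (LiesOver.completionMap (v := w.comap (algebraMap F E)) (w := w)) :=
    (isometry_iff_dist_eq.2 fun _ _ => rfl : Isometry
        (InfinitePlace.Completion.equiv w).symm).comp
      ((InfinitePlace.LiesOver.isometry_algebraMap w
          (w.comap (algebraMap F E))).completion_map.comp
      (isometry_iff_dist_eq.2 fun _ _ => rfl : Isometry
        (InfinitePlace.Completion.equiv (w.comap (algebraMap F E)))))
  exact (AddMonoidHomClass.isometry_iff_norm _).1 h (a (w.comap (algebraMap F E)))

/-- `x ↦ |x|_w` as a homomorphism `E_∞ˣ → ℝˣ`, followed by the logarithm. -/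
def logNorm (w : InfinitePlace E) : (InfiniteAdeleRing E)ˣ →* Multiplicative ℝ where
  toFun x := Multiplicative.ofAdd (Real.log ‖(x : InfiniteAdeleRing E) w‖)
  map_one' := by
    change Multiplicative.ofAdd (Real.log ‖(1 : w.Completion)‖) = 1
    simp
  map_mul' x y := by
    have hx : ∀ z : (InfiniteAdeleRing E)ˣ, ‖(z : InfiniteAdeleRing E) w‖ ≠ 0 := fun z => by
      have h : (z : InfiniteAdeleRing E) w * (z⁻¹ : (InfiniteAdeleRing E)ˣ).1 w = 1 :=
        congrFun z.mul_inv w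
      exact norm_ne_zero_iff.2 (left_ne_zero_of_mul_eq_one h)
    rw [← ofAdd_add, ← Real.log_mul (hx x) (hx y), ← norm_mul]
    rfl

namespace SplitPlaces

variable (L : SplitPlaces F E)

/-- `t ↦ log |t|_σ` on `T(F_∞)`, for `σ = σ i`; in terms of the identification
`T(F_σ) ≃ F_σˣ`, `(a, b) ↦ a / b`, of the labelling. -/
def logAbs (i : Fin L.u) : TInf F E →* Multiplicative ℝ :=
  QuotientGroup.lift _ (logNorm (L.w i) / logNorm (L.w' i)) (by
    rintro _ ⟨a, rfl⟩
    have h : ∀ (v v' : InfinitePlace F), v = v' →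
        ‖(a : InfiniteAdeleRing F) v‖ = ‖(a : InfiniteAdeleRing F) v'‖ := by
      rintro v _ rfl; rfl
    rw [MonoidHom.mem_ker, MonoidHom.div_apply, div_eq_one]
    change Multiplicative.ofAdd (Real.log ‖infMap F E a (L.w i)‖) =
      Multiplicative.ofAdd (Real.log ‖infMap F E a (L.w' i)‖)
    rw [norm_infMap, norm_infMap, h _ _ ((L.comap_w i).trans (L.comap_w' i).symm)])

/-- The homomorphism `T(F_∞) → ℝ^u`, `t ↦ (log |t|_σ)_σ`. -/
def logVec (t : TInf F E) : Fin L.u → ℝ := fun i => (L.logAbs i t).toAdd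

/-- The maximal compact subgroup `S` of `T(F_∞)_+`, so that `T(F_∞)_+ = T(F_∞)_0 × S`. -/
def compactPart : Subgroup (TInf F E) :=
  infPos F E ⊓ ⨅ i, (L.logAbs i).ker

end SplitPlaces

/-- The map `(E ⊗ ℝ)ˣ → T(F_∞)`, where `E ⊗ ℝ = ℝ^r × ℂ^s` is identified with `E_∞`. -/
def mixedToInf : (mixedEmbedding.mixedSpace E)ˣ →* TInf F E :=
  (QuotientGroup.mk' _).comp
    (Units.map (InfiniteAdeleRing.ringEquiv_mixedSpace E).symm.toMonoidHom)

open scoped Classical in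
/-- The element of `(E ⊗ ℝ)ˣ = E_∞ˣ` which is the real number `e^x` at the place `w` and `1` at
the other places. -/
def expAt (w : InfinitePlace E) (x : ℝ) : (mixedEmbedding.mixedSpace E)ˣ :=
    { val := (fun v => if v.1 = w then Real.exp x else 1,
        fun v => if v.1 = w then (Real.exp x : ℂ) else 1)
      inv := (fun v => if v.1 = w then Real.exp (-x) else 1,
        fun v => if v.1 = w then (Real.exp (-x) : ℂ) else 1)
      val_inv := by
        ext v
        · change (if v.1 = w then Real.exp x else 1) * (if v.1 = w then Real.exp (-x) else 1) = 1
          split_ifs <;> simp [← Real.exp_add]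
        · change (if v.1 = w then (Real.exp x : ℂ) else 1) *
            (if v.1 = w then (Real.exp (-x) : ℂ) else 1) = 1
          split_ifs <;> simp [← Complex.exp_add]
      inv_val := by
        ext v
        · change (if v.1 = w then Real.exp (-x) else 1) * (if v.1 = w then Real.exp x else 1) = 1
          split_ifs <;> simp [← Real.exp_add]
        · change (if v.1 = w then (Real.exp (-x) : ℂ) else 1) *
            (if v.1 = w then (Real.exp x : ℂ) else 1) = 1
          split_ifs <;> simp [← Complex.exp_add] }

namespace SplitPlaces

variable (L : SplitPlaces F E)

/-- The one-parameter subgroup `x ↦ e^x` of `T(F_σ)_0 = ℝ_{>0} ⊆ F_σˣ ≃ T(F_σ)`, `σ = σ i`,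
viewed in `T(F_∞)`. Its image is `T(F_σ)_0` and its derivative is the element `δ_σ = 1` of the
Lie algebra of `T(F_σ)`. -/
def oneParam (i : Fin L.u) (x : ℝ) : TInf F E := mixedToInf (expAt (L.w i) x)

/-- The parametrization `ℝ^u → T(F_∞)_0` by the exponential. -/
def expVec (x : Fin L.u → ℝ) : TInf F E := ∏ i, L.oneParam i (x i)

end SplitPlaces

end Split

/-! ### The modules `C^Σ(T(𝔸_F), ℂ)` and the maps `δ_σ` -/

section Functions

variable {F E : Type} [Field F] [NumberField F] [Field E] [NumberField E] [Algebra F E]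

open scoped Classical in
/-- Smooth functions on the Lie group `T(F_∞)`: those whose pullback to the open subset
`(E ⊗ ℝ)ˣ` of the real vector space `E ⊗ ℝ` is smooth. -/
def SmoothInf (f : TInf F E → ℂ) : Prop :=
  ∃ g : mixedEmbedding.mixedSpace E → ℂ,
    ContDiffOn ℝ ∞ g {x | IsUnit x} ∧ ∀ x : (mixedEmbedding.mixedSpace E)ˣ, g x = f (mixedToInf x)

/-- Left translation of functions: `(γ f)(t) = f (γ⁻¹ t)`. -/
def translate {A : Type} (γ : TRat F E) (f : TAdele F E → A) : TAdele F E → A :=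
  fun t => f ((diag F E γ)⁻¹ * t)

open scoped Classical in
theorem SmoothInf.add {f g : TInf F E → ℂ} (hf : SmoothInf f) (hg : SmoothInf g) :
    SmoothInf (fun t => f t + g t) := by
  obtain ⟨f', hf', hf⟩ := hf
  obtain ⟨g', hg', hg⟩ := hg
  exact ⟨fun x => f' x + g' x, hf'.add hg', fun x => congrArg₂ (· + ·) (hf x) (hg x)⟩

open scoped Classical in
theorem SmoothInf.smul {f : TInf F E → ℂ} (hf : SmoothInf f) (a : ℂ) :
    SmoothInf (fun t => a * f t) := by
  obtain ⟨f', hf', hf⟩ := hf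
  exact ⟨fun x => a * f' x, contDiffOn_const.mul hf', fun x => congrArg (a * ·) (hf x)⟩

theorem mixedToInf_surjective : Function.Surjective (mixedToInf : _ →* TInf F E) :=
  (QuotientGroup.mk'_surjective _).comp
    (Units.mapEquiv (InfiniteAdeleRing.ringEquiv_mixedSpace E).symm.toMulEquiv).surjective

open scoped Classical in
theorem SmoothInf.translate {f : TInf F E → ℂ} (hf : SmoothInf f) (t : TInf F E) :
    SmoothInf (fun s => f (t * s)) := by
  obtain ⟨g, hg, hgf⟩ := hf
  obtain ⟨y, rfl⟩ := mixedToInf_surjective t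
  refine ⟨fun x => g (y * x), hg.comp
    (contDiff_const.mul contDiff_id : ContDiff ℝ ∞ fun x : mixedEmbedding.mixedSpace E =>
      (y : mixedEmbedding.mixedSpace E) * x).contDiffOn
    (fun x hx => y.isUnit.mul hx), fun x => ?_⟩
  exact (hgf (y * x)).trans (by rw [map_mul])

theorem SmoothInf.zero : SmoothInf (0 : TInf F E → ℂ) := by
  classical
  exact ⟨0, contDiffOn_const, fun _ => rfl⟩

variable (L : SplitPlaces F E)

/-- `C^Σ(T(𝔸_F), ℂ)` for a set `Σ ⊆ Σ_T`, given by a set `J` of indices: the continuous functions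
`f` on `T(𝔸_F)` which are smooth in the variable in `T(F_∞)` and are invariant under `T(F_σ)_0`
for `σ ∉ Σ` (the groups `T(F_σ)_0` with `σ ∉ Σ_T` are trivial). -/
def smoothFun (J : Set (Fin L.u)) : Submodule ℂ (TAdele F E → ℂ) where
  carrier := {f | Continuous f ∧ (∀ s, SmoothInf fun t => f (t, s)) ∧
    ∀ i ∉ J, ∀ (x : ℝ) (t : TInf F E) (s : TFin F E), f (t * L.oneParam i x, s) = f (t, s)}
  add_mem' {f g} hf hg := ⟨hf.1.add hg.1, fun s => (hf.2.1 s).add (hg.2.1 s),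
    fun i hi x t s => congrArg₂ (· + ·) (hf.2.2 i hi x t s) (hg.2.2 i hi x t s)⟩
  zero_mem' := ⟨continuous_zero, fun _ => SmoothInf.zero, fun _ _ _ _ _ => rfl⟩
  smul_mem' a f hf := ⟨hf.1.const_smul a, fun s => (hf.2.1 s).smul a,
    fun i hi x t s => congrArg (a • ·) (hf.2.2 i hi x t s)⟩

/-- `δ_σ f (t) = d/dx f (t e^x) |_{x = 0}`, where `e^x ∈ T(F_σ)_0`, `σ = σ i`. -/
def lieDeriv (i : Fin L.u) (f : TAdele F E → ℂ) : TAdele F E → ℂ :=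
  fun t => deriv (fun x : ℝ => f (t.1 * L.oneParam i x, t.2)) 0

theorem smoothFun_mono {J J' : Set (Fin L.u)} (h : J ⊆ J') : smoothFun L J ≤ smoothFun L J' :=
  fun _ hf => ⟨hf.1, hf.2.1, fun i hi => hf.2.2 i fun h' => hi (h h')⟩

theorem translate_mem {J : Set (Fin L.u)} {f : TAdele F E → ℂ} (hf : f ∈ smoothFun L J)
    (γ : TRat F E) : translate γ f ∈ smoothFun L J := by
  refine ⟨hf.1.comp (continuous_const_mul _),
    fun s => (hf.2.1 ((diag F E γ)⁻¹.2 * s)).translate (diag F E γ)⁻¹.1, fun i hi x t s => ?_⟩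
  have := hf.2.2 i hi x ((diag F E γ)⁻¹.1 * t) ((diag F E γ)⁻¹.2 * s)
  rw [mul_assoc] at this
  exact this

theorem lieDeriv_translate (i : Fin L.u) (γ : TRat F E) (f : TAdele F E → ℂ) :
    lieDeriv L i (translate γ f) = translate γ (lieDeriv L i f) := by
  funext t
  change deriv (fun x : ℝ => f ((diag F E γ)⁻¹ * (t.1 * L.oneParam i x, t.2))) 0 =
    deriv (fun x : ℝ => f ((diag F E γ)⁻¹.1 * t.1 * L.oneParam i x, (diag F E γ)⁻¹.2 * t.2)) 0
  congr 1
  funext x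
  rw [mul_assoc]; rfl

open scoped Classical in
theorem contDiff_expAt (w : InfinitePlace E) :
    ContDiff ℝ ∞ (fun x : ℝ => (expAt w x : mixedEmbedding.mixedSpace E)) := by
  refine ContDiff.prodMk (contDiff_pi.2 fun v => ?_) (contDiff_pi.2 fun v => ?_)
  · by_cases h : v.1 = w
    · simpa [expAt, h] using Real.contDiff_exp
    · simpa [expAt, h] using contDiff_const
  · by_cases h : v.1 = w
    · have h' : (fun x : ℝ => (expAt w x : mixedEmbedding.mixedSpace E).2 v) =
          fun x : ℝ => Complex.ofRealCLM (Real.exp x) := by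
        funext x; simp only [expAt, h, if_true]; rfl
      exact h' ▸ Complex.ofRealCLM.contDiff.comp Real.contDiff_exp
    · simpa [expAt, h] using contDiff_const

open scoped Classical in
theorem differentiable_oneParam {J : Set (Fin L.u)} {f : TAdele F E → ℂ}
    (hf : f ∈ smoothFun L J) (i : Fin L.u) (t : TAdele F E) :
    DifferentiableAt ℝ (fun x : ℝ => f (t.1 * L.oneParam i x, t.2)) 0 := by
  obtain ⟨g, hg, hgf⟩ := hf.2.1 t.2
  obtain ⟨y, hy⟩ := mixedToInf_surjective t.1
  have hopen : IsOpen {x : mixedEmbedding.mixedSpace E | IsUnit x} := Units.isOpen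
  have hd : DifferentiableAt ℝ g (y * expAt (L.w i) 0 : (mixedEmbedding.mixedSpace E)ˣ) :=
    (hg.contDiffAt (hopen.mem_nhds (Units.isUnit _))).differentiableAt (by simp)
  have hm : DifferentiableAt ℝ
      (fun x : ℝ => ((y * expAt (L.w i) x : (mixedEmbedding.mixedSpace E)ˣ) :
        mixedEmbedding.mixedSpace E)) 0 :=
    (((contDiff_expAt (L.w i)).differentiable (by simp)) 0).const_mul
      (y : mixedEmbedding.mixedSpace E)
  have he : (fun x : ℝ => f (t.1 * L.oneParam i x, t.2)) = fun x : ℝ =>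
      g ((y * expAt (L.w i) x : (mixedEmbedding.mixedSpace E)ˣ)) := by
    funext x
    rw [hgf, map_mul, hy]; rfl
  rw [he]
  exact hd.comp 0 hm

/-- The domain of `δ_σ` in `C^Σ`: the `f ∈ C^Σ` with `δ_σ f ∈ C^Σ`. -/
def derivDomain (J : Set (Fin L.u)) (i : Fin L.u) : Submodule ℂ (TAdele F E → ℂ) where
  carrier := {f | f ∈ smoothFun L J ∧ lieDeriv L i f ∈ smoothFun L J}
  add_mem' {f g} hf hg := by
    refine ⟨add_mem hf.1 hg.1, ?_⟩
    have : lieDeriv L i (f + g) = lieDeriv L i f + lieDeriv L i g := funext fun t =>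
      deriv_add (differentiable_oneParam L hf.1 i t) (differentiable_oneParam L hg.1 i t)
    rw [this]; exact add_mem hf.2 hg.2
  zero_mem' := by
    refine ⟨zero_mem _, ?_⟩
    have : lieDeriv L i 0 = 0 := funext fun t => deriv_const 0 (0 : ℂ)
    rw [this]; exact zero_mem _
  smul_mem' a f hf := by
    refine ⟨Submodule.smul_mem _ a hf.1, ?_⟩
    have : lieDeriv L i (a • f) = a • lieDeriv L i f := funext fun t =>
      deriv_const_smul a (differentiable_oneParam L hf.1 i t)
    rw [this]; exact Submodule.smul_mem _ a hf.2

/-! ### Exactness of `0 → C^{Σ ∖ σ} → C^Σ → C^Σ → 0` -/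

theorem oneParam_add (i : Fin L.u) (x y : ℝ) :
    L.oneParam i (x + y) = L.oneParam i x * L.oneParam i y := by
  classical
  rw [SplitPlaces.oneParam, SplitPlaces.oneParam, SplitPlaces.oneParam, ← map_mul]
  congr 1
  ext v
  · by_cases h : v.1 = L.w i <;> simp [expAt, h, Real.exp_add]
  · by_cases h : v.1 = L.w i <;> simp [expAt, h, Complex.exp_add]

theorem oneParam_zero (i : Fin L.u) : L.oneParam i 0 = 1 := by
  classical
  have h : expAt (L.w i) 0 = 1 := by
    ext v
    · by_cases h : v.1 = L.w i <;> simp [expAt, h]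
    · by_cases h : v.1 = L.w i <;> simp [expAt, h]
  rw [SplitPlaces.oneParam, h]
  exact map_one mixedToInf

theorem mul_oneParam_zero (i : Fin L.u) (t : TInf F E) : t * L.oneParam i 0 = t := by
  rw [oneParam_zero]
  exact mul_one t

theorem norm_symm_of_isReal (y : mixedEmbedding.mixedSpace E) (v : InfinitePlace E)
    (hv : v.IsReal) :
    ‖(InfiniteAdeleRing.ringEquiv_mixedSpace E).symm y v‖ = ‖y.1 ⟨v, hv⟩‖ := by
  set a := (InfiniteAdeleRing.ringEquiv_mixedSpace E).symm y with ha
  have hy : y = InfiniteAdeleRing.ringEquiv_mixedSpace E a := by simp [ha]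
  rw [hy, InfiniteAdeleRing.ringEquiv_mixedSpace_apply]
  exact ((AddMonoidHomClass.isometry_iff_norm _).1
    (InfinitePlace.Completion.isometry_extensionEmbeddingOfIsReal hv) (a v)).symm

theorem norm_symm_of_isComplex (y : mixedEmbedding.mixedSpace E) (v : InfinitePlace E)
    (hv : v.IsComplex) :
    ‖(InfiniteAdeleRing.ringEquiv_mixedSpace E).symm y v‖ = ‖y.2 ⟨v, hv⟩‖ := by
  set a := (InfiniteAdeleRing.ringEquiv_mixedSpace E).symm y with ha
  have hy : y = InfiniteAdeleRing.ringEquiv_mixedSpace E a := by simp [ha]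
  rw [hy, InfiniteAdeleRing.ringEquiv_mixedSpace_apply]
  exact ((AddMonoidHomClass.isometry_iff_norm _).1
    (InfinitePlace.Completion.isometry_extensionEmbedding v) (a v)).symm

theorem logAbs_mixedToInf (i : Fin L.u) (y : (mixedEmbedding.mixedSpace E)ˣ) :
    (L.logAbs i (mixedToInf y)).toAdd =
      Real.log ‖(InfiniteAdeleRing.ringEquiv_mixedSpace E).symm y (L.w i)‖ -
        Real.log ‖(InfiniteAdeleRing.ringEquiv_mixedSpace E).symm y (L.w' i)‖ := rfl

open scoped Classical in
theorem norm_symm_expAt (w v : InfinitePlace E) (x : ℝ) :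
    Real.log ‖(InfiniteAdeleRing.ringEquiv_mixedSpace E).symm (expAt w x).1 v‖ =
      if v = w then x else 0 := by
  rcases v.isReal_or_isComplex with hv | hv
  · rw [norm_symm_of_isReal _ _ hv]
    by_cases h : v = w <;> simp [expAt, h]
  · rw [norm_symm_of_isComplex _ _ hv]
    by_cases h : v = w
    · simp only [expAt, h, if_true, Complex.norm_real, Real.norm_eq_abs, Real.abs_exp,
        Real.log_exp]
    · simp [expAt, h]

open scoped Classical in
theorem logAbs_oneParam (i j : Fin L.u) (x : ℝ) :
    (L.logAbs i (L.oneParam j x)).toAdd = if i = j then x else 0 := by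
  rw [SplitPlaces.oneParam, logAbs_mixedToInf, norm_symm_expAt, norm_symm_expAt]
  have h1 : L.w i = L.w j ↔ i = j := ⟨fun h => L.σ_injective (by
    rw [← L.comap_w, h, L.comap_w]), fun h => by rw [h]⟩
  have h2 : L.w' i ≠ L.w j := fun h => by
    have hij : i = j := L.σ_injective (by rw [← L.comap_w', h, L.comap_w])
    subst hij
    exact L.w_ne i h.symm
  simp [h1, h2]

theorem continuous_symm :
    Continuous (InfiniteAdeleRing.ringEquiv_mixedSpace E).symm := by
  refine continuous_pi fun v => ?_
  rw [(InfinitePlace.Completion.isometry_extensionEmbedding v).isEmbedding.continuous_iff]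
  rcases v.isReal_or_isComplex with hv | hv
  · have : (InfinitePlace.Completion.extensionEmbedding v) ∘
        (fun y => (InfiniteAdeleRing.ringEquiv_mixedSpace E).symm y v) =
        fun y => ((y.1 ⟨v, hv⟩ : ℝ) : ℂ) := by
      funext y
      have h := congrFun (congrArg Prod.fst
        ((InfiniteAdeleRing.ringEquiv_mixedSpace E).apply_symm_apply y)) ⟨v, hv⟩
      rw [← h]
      exact (InfinitePlace.Completion.extensionEmbeddingOfIsReal_apply hv _).symm
    rw [this]
    fun_prop
  · have : (InfinitePlace.Completion.extensionEmbedding v) ∘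
        (fun y => (InfiniteAdeleRing.ringEquiv_mixedSpace E).symm y v) =
        fun y => y.2 ⟨v, hv⟩ := by
      funext y
      exact congrFun (congrArg Prod.snd
        ((InfiniteAdeleRing.ringEquiv_mixedSpace E).apply_symm_apply y)) ⟨v, hv⟩
    rw [this]
    fun_prop

theorem continuous_oneParam (i : Fin L.u) : Continuous (L.oneParam i) := by
  classical
  have hinv : ∀ x : ℝ, ((expAt (L.w i) x)⁻¹ : (mixedEmbedding.mixedSpace E)ˣ) =
      expAt (L.w i) (-x) := fun x => by
    rw [inv_eq_iff_mul_eq_one]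
    ext v
    · by_cases h : v.1 = L.w i <;> simp [expAt, h, ← Real.exp_add]
    · by_cases h : v.1 = L.w i <;> simp [expAt, h, ← Complex.exp_add]
  have h1 : Continuous (expAt (L.w i)) := by
    refine Units.continuous_iff.2 ⟨(contDiff_expAt (L.w i)).continuous, ?_⟩
    have : (fun x => ((expAt (L.w i) x)⁻¹ : (mixedEmbedding.mixedSpace E)ˣ).1) =
        fun x => (expAt (L.w i) (-x)).1 := funext fun x => by rw [hinv]
    rw [this]
    exact (contDiff_expAt (L.w i)).continuous.comp continuous_neg
  let e : mixedEmbedding.mixedSpace E →* InfiniteAdeleRing E :=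
    (InfiniteAdeleRing.ringEquiv_mixedSpace E).symm.toMonoidHom
  have h2 : Continuous (Units.map e) :=
    Continuous.units_map (N := InfiniteAdeleRing E) e continuous_symm
  have h3 : Continuous fun x : ℝ =>
      (QuotientGroup.mk (Units.map e (expAt (L.w i) x)) : TInf F E) :=
    continuous_quotient_mk'.comp (h2.comp h1)
  exact h3

theorem continuous_logAbs (i : Fin L.u) :
    Continuous fun t : TInf F E => (L.logAbs i t).toAdd := by
  refine continuous_quot_lift _ ?_
  have h : ∀ w : InfinitePlace E, Continuous fun x : (InfiniteAdeleRing E)ˣ =>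
      Real.log ‖(x : InfiniteAdeleRing E) w‖ := fun w => by
    have hc : Continuous fun a : InfiniteAdeleRing E => a w := continuous_apply w
    refine Continuous.log (hc.comp Units.continuous_val).norm fun z => ?_
    have h : (z : InfiniteAdeleRing E) w * (z⁻¹ : (InfiniteAdeleRing E)ˣ).1 w = 1 :=
      congrFun z.mul_inv w
    exact norm_ne_zero_iff.2 (left_ne_zero_of_mul_eq_one h)
  exact (h _).sub (h _)

theorem contDiffOn_integral {P : Type} [NormedAddCommGroup P] [NormedSpace ℝ P] {U : Set P}
    (hU : IsOpen U) {h : P → ℝ → ℂ}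
    (hh : ContDiffOn ℝ ∞ (fun p : P × ℝ => h p.1 p.2) (U ×ˢ Set.univ)) :
    ContDiffOn ℝ ∞ (fun p => ∫ y in (0 : ℝ)..1, h p y) U := by
  let χ : ContDiffBump (0 : ℝ) := ⟨2, 3, by norm_num, by norm_num⟩
  have h1 : ContDiffOn ℝ ∞ (fun q : P × ℝ => χ (-q.2) • h q.1 (-q.2)) (U ×ˢ Set.univ) := by
    have ha : ContDiffOn ℝ ∞ (fun q : P × ℝ => χ (-q.2)) (U ×ˢ Set.univ) :=
      (χ.contDiff.comp contDiff_snd.neg).contDiffOn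
    have hb : ContDiffOn ℝ ∞ (fun q : P × ℝ => h q.1 (-q.2)) (U ×ˢ Set.univ) :=
      hh.comp (contDiff_fst.prodMk contDiff_snd.neg).contDiffOn
        (fun q hq => ⟨hq.1, Set.mem_univ _⟩)
    exact ha.smul hb
  have h2 := contDiffOn_convolution_right_with_param (n := (⊤ : ℕ∞)) (μ := (volume : Measure ℝ))
    (f := Set.indicator (Set.Ioc (0 : ℝ) 1) (1 : ℝ → ℝ)) (ContinuousLinearMap.lsmul ℝ ℝ)
    (g := fun p y => χ (-y) • h p (-y)) (k := Metric.closedBall (0 : ℝ) 3) hU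
    (isCompact_closedBall _ _) (fun p x _ hx => by
      have : χ (-x) = 0 := χ.zero_of_le_dist (by
        rw [Metric.mem_closedBall, not_le] at hx
        simpa using hx.le)
      simp [this])
    (((integrable_indicator_iff measurableSet_Ioc).2 
      (continuous_const.integrableOn_Ioc : IntegrableOn (fun _ : ℝ => (1 : ℝ)) _ _)).locallyIntegrable) h1
  have h3 : ContDiffOn ℝ ∞ (fun p : P => (p, (0 : ℝ))) U :=
    (contDiff_id.prodMk contDiff_const).contDiffOn
  refine (h2.comp h3 fun p hp => ⟨hp, Set.mem_univ _⟩).congr fun p _ => ?_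
  rw [intervalIntegral.integral_of_le zero_le_one, ← integral_indicator measurableSet_Ioc]
  simp only [Function.comp_apply, convolution]
  congr 1
  funext y
  by_cases hy : y ∈ Set.Ioc (0 : ℝ) 1
  · have : χ y = 1 := χ.one_of_mem_closedBall (by
      rw [Metric.mem_closedBall, dist_zero_right, Real.norm_eq_abs, abs_of_pos hy.1]
      exact hy.2.trans (by norm_num))
    simp [hy, this]
  · simp [hy]

open scoped Classical in
theorem contDiffOn_log (v : InfinitePlace E) :
    ContDiffOn ℝ ∞ (fun y : mixedEmbedding.mixedSpace E =>
      Real.log ‖(InfiniteAdeleRing.ringEquiv_mixedSpace E).symm y v‖) {x | IsUnit x} := by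
  rcases v.isReal_or_isComplex with hv | hv
  · simp_rw [norm_symm_of_isReal _ _ hv, Real.norm_eq_abs, Real.log_abs]
    refine ContDiffOn.log (by fun_prop) fun y hy => ?_
    exact ((Prod.isUnit_iff.1 hy).1.map (Pi.evalRingHom _ ⟨v, hv⟩)).ne_zero
  · have : ∀ y : mixedEmbedding.mixedSpace E,
        Real.log ‖(InfiniteAdeleRing.ringEquiv_mixedSpace E).symm y v‖ =
        2⁻¹ * Real.log (‖y.2 ⟨v, hv⟩‖ ^ 2) := fun y => by
      rw [norm_symm_of_isComplex _ _ hv, Real.log_pow]; push_cast; ring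
    simp_rw [this]
    refine contDiffOn_const.mul (ContDiffOn.log ?_ fun y hy => ?_)
    · exact (ContDiff.norm_sq ℝ (by fun_prop)).contDiffOn
    · exact pow_ne_zero _ (norm_ne_zero_iff.2
        ((Prod.isUnit_iff.1 hy).2.map (Pi.evalRingHom
          (fun _ : {w : InfinitePlace E // w.IsComplex} => ℂ) ⟨v, hv⟩)).ne_zero)

/-- The primitive of `g` in the direction `σ = σ i` which vanishes where `|t|_σ = 1`. -/
def primitive (i : Fin L.u) (g : TAdele F E → ℂ) : TAdele F E → ℂ := fun t =>
  ∫ y in (0 : ℝ)..1, ((L.logAbs i t.1).toAdd : ℂ) *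
    g (t.1 * L.oneParam i ((y - 1) * (L.logAbs i t.1).toAdd), t.2)

theorem primitive_mem {J : Set (Fin L.u)} {i : Fin L.u} (hi : i ∈ J) {g : TAdele F E → ℂ}
    (hg : g ∈ smoothFun L J) : primitive L i g ∈ smoothFun L J := by
  classical
  refine ⟨?_, fun s => ?_, fun j hj x t s => ?_⟩
  · have h1 : Continuous fun p : TAdele F E × ℝ => (L.logAbs i p.1.1).toAdd :=
      (continuous_logAbs L i).comp (continuous_fst.comp continuous_fst)
    refine intervalIntegral.continuous_parametric_intervalIntegral_of_continuous' ?_ 0 1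
    refine (Complex.continuous_ofReal.comp h1).mul (hg.1.comp (Continuous.prodMk
      ((continuous_fst.comp continuous_fst).mul ((continuous_oneParam L i).comp
        ((continuous_snd.sub continuous_const).mul h1))) (continuous_snd.comp continuous_fst)))
  · obtain ⟨g', hg', hgg⟩ := hg.2.1 s
    let ℓ : mixedEmbedding.mixedSpace E → ℝ := fun y =>
      Real.log ‖(InfiniteAdeleRing.ringEquiv_mixedSpace E).symm y (L.w i)‖ -
        Real.log ‖(InfiniteAdeleRing.ringEquiv_mixedSpace E).symm y (L.w' i)‖
    have hℓ : ContDiffOn ℝ ∞ ℓ {x | IsUnit x} := (contDiffOn_log _).sub (contDiffOn_log _)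
    have hopen : IsOpen {x : mixedEmbedding.mixedSpace E | IsUnit x} := Units.isOpen
    refine ⟨fun x => ∫ y in (0 : ℝ)..1, (ℓ x : ℂ) *
      g' (x * (expAt (L.w i) ((y - 1) * ℓ x)).1), contDiffOn_integral hopen ?_, fun x => ?_⟩
    · have hℓ' : ContDiffOn ℝ ∞ (fun p : mixedEmbedding.mixedSpace E × ℝ => ℓ p.1)
          ({x | IsUnit x} ×ˢ Set.univ) :=
        hℓ.comp contDiff_fst.contDiffOn fun p hp => hp.1
      refine (Complex.ofRealCLM.contDiff.comp_contDiffOn hℓ').mul (hg'.comp ?_ fun p hp =>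
        IsUnit.mul hp.1 (Units.isUnit _))
      refine contDiff_fst.contDiffOn.mul ((contDiff_expAt (L.w i)).comp_contDiffOn ?_)
      exact (contDiff_snd.sub contDiff_const).contDiffOn.mul hℓ'
    · change _ = primitive L i g (mixedToInf x, s)
      rw [primitive]
      refine intervalIntegral.integral_congr fun y _ => ?_
      change (ℓ x : ℂ) * g' _ = ((L.logAbs i (mixedToInf x)).toAdd : ℂ) * _
      rw [logAbs_mixedToInf]
      refine congrArg ((ℓ x : ℂ) * ·) ((hgg (x * expAt (L.w i) ((y - 1) * ℓ x))).trans ?_)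
      rw [map_mul]; rfl
  · have hij : i ≠ j := fun h => hj (h ▸ hi)
    have hl : (L.logAbs i (t * L.oneParam j x)).toAdd = (L.logAbs i t).toAdd := by
      rw [map_mul, toAdd_mul, logAbs_oneParam, if_neg hij, add_zero]
    simp only [primitive, hl]
    refine intervalIntegral.integral_congr fun y _ => ?_
    refine congrArg (_ * ·) (Eq.trans ?_ (hg.2.2 j hj x _ s))
    exact congrArg (fun r => g (r, s)) (mul_right_comm t _ _)

theorem primitive_oneParam {g : TAdele F E → ℂ} (i : Fin L.u)
    (t : TAdele F E) (x : ℝ) :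
    primitive L i g (t.1 * L.oneParam i x, t.2) =
      ∫ y in (-(L.logAbs i t.1).toAdd)..x, g (t.1 * L.oneParam i y, t.2) := by
  classical
  have hl : (L.logAbs i (t.1 * L.oneParam i x)).toAdd = (L.logAbs i t.1).toAdd + x := by
    rw [map_mul, toAdd_mul, logAbs_oneParam, if_pos rfl]
  set a := (L.logAbs i t.1).toAdd with ha
  simp only [primitive, hl]
  rw [intervalIntegral.integral_const_mul]
  have h := intervalIntegral.smul_integral_comp_mul_add
    (fun y => g (t.1 * L.oneParam i y, t.2)) (a + x) (-a) (a := 0) (b := 1)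
  rw [Complex.real_smul] at h
  rw [show (a + x) * 0 + -a = -a by ring, show (a + x) * 1 + -a = x by ring] at h
  rw [← h]
  congr 1
  refine intervalIntegral.integral_congr fun y _ => ?_
  rw [mul_assoc, ← oneParam_add]
  congr 4
  ring

theorem lieDeriv_primitive {J : Set (Fin L.u)} {g : TAdele F E → ℂ} (i : Fin L.u)
    (hg : g ∈ smoothFun L J) : lieDeriv L i (primitive L i g) = g := by
  funext t
  have hc : Continuous fun y : ℝ => g (t.1 * L.oneParam i y, t.2) :=
    hg.1.comp ((continuous_const.mul (continuous_oneParam L i)).prodMk continuous_const)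
  simp only [lieDeriv, primitive_oneParam]
  rw [(hc.integral_hasStrictDerivAt _ 0).hasDerivAt.deriv, mul_oneParam_zero]

theorem mem_of_lieDeriv_eq_zero {J : Set (Fin L.u)} {i : Fin L.u} {f : TAdele F E → ℂ}
    (hf : f ∈ smoothFun L J) (h0 : lieDeriv L i f = 0) : f ∈ smoothFun L (J \ {i}) := by
  refine ⟨hf.1, hf.2.1, fun j hj x t s => ?_⟩
  by_cases hji : j = i
  · subst hji
    have hadd : ∀ a : ℝ, (fun y : ℝ => f (t * L.oneParam j y, s)) =
        (fun y : ℝ => f ((t * L.oneParam j a) * L.oneParam j y, s)) ∘ fun y => y - a := by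
      intro a; funext y
      simp only [Function.comp_apply]
      rw [mul_assoc, ← oneParam_add]
      congr 3; ring_nf
    have hd : ∀ a : ℝ, HasDerivAt (fun y : ℝ => f (t * L.oneParam j y, s)) 0 a := by
      intro a
      have h1 := (differentiable_oneParam L hf j (t * L.oneParam j a, s)).hasDerivAt
      have h2 : deriv (fun x : ℝ => f ((t * L.oneParam j a) * L.oneParam j x, s)) 0 = 0 :=
        congrFun h0 (t * L.oneParam j a, s)
      simp only at h1
      rw [h2] at h1
      rw [hadd a]
      have h3 : HasDerivAt (fun y : ℝ => y - a) 1 a := (hasDerivAt_id a).sub_const a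
      have h4 := HasDerivAt.scomp (x := a) (h := fun y : ℝ => y - a) (h' := 1)
        (g₁ := fun y : ℝ => f ((t * L.oneParam j a) * L.oneParam j y, s)) (g₁' := 0)
        (by simpa using h1) h3
      simpa using h4
    have h5 := is_const_of_deriv_eq_zero (fun a => (hd a).differentiableAt)
      (fun a => (hd a).deriv) x 0
    simp only [mul_oneParam_zero] at h5
    exact h5
  · exact hf.2.2 j (fun h => hj ⟨h, hji⟩) x t s

end Functions

/-! ### The `T(F)`-modules and the connecting homomorphisms -/

section Connecting

variable {F E : Type} [Field F] [NumberField F] [Field E] [NumberField E] [Algebra F E]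

/-- The action of `T(F)` by translation on a translation stable space of functions. -/
def transRep {k A : Type} [CommRing k] [AddCommGroup A] [Module k A]
    (V : Submodule k (TAdele F E → A))
    (hV : ∀ γ : TRat F E, ∀ f ∈ V, translate γ f ∈ V) : Representation k (TRat F E) V where
  toFun γ :=
    { toFun := fun f => ⟨translate γ f.1, hV γ f.1 f.2⟩
      map_add' := fun _ _ => rfl
      map_smul' := fun _ _ => rfl }
  map_one' := by
    refine LinearMap.ext fun f => Subtype.ext (funext fun t => ?_)
    change f.1 ((diag F E 1)⁻¹ * t) = f.1 t
    rw [map_one]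
    exact congrArg f.1 ((congrArg (· * t) inv_one).trans (one_mul t))
  map_mul' γ γ' := by
    refine LinearMap.ext fun f => Subtype.ext (funext fun t => ?_)
    change f.1 ((diag F E (γ * γ'))⁻¹ * t) = f.1 ((diag F E γ')⁻¹ * ((diag F E γ)⁻¹ * t))
    rw [map_mul]
    exact congrArg f.1 ((congrArg (· * t) (mul_inv_rev _ _)).trans (mul_assoc _ _ _))

variable (L : SplitPlaces F E)

/-- The `T(F)`-module `C^Σ(T(𝔸_F), ℂ)`. -/
abbrev smoothRep (J : Set (Fin L.u)) : Rep ℂ (TRat F E) :=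
  Rep.of (transRep (smoothFun L J) fun γ _ hf => translate_mem L hf γ)

/-- The `T(F)`-module of the `f ∈ C^Σ` with `δ_σ f ∈ C^Σ`. -/
abbrev derivRep (J : Set (Fin L.u)) (i : Fin L.u) : Rep ℂ (TRat F E) :=
  Rep.of (transRep (derivDomain L J i) fun γ _ hf =>
    ⟨translate_mem L hf.1 γ, (lieDeriv_translate L i γ _).symm ▸ translate_mem L hf.2 γ⟩)

variable {L} in
theorem lieDeriv_eq_zero_of_invariant {J J' : Set (Fin L.u)} {i : Fin L.u} (hJ : J' = J \ {i})
    {f : TAdele F E → ℂ} (hf : f ∈ smoothFun L J') : lieDeriv L i f = 0 := by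
  subst hJ
  funext t
  have h : (fun x : ℝ => f (t.1 * L.oneParam i x, t.2)) = fun _ => f (t.1, t.2) :=
    funext fun x => hf.2.2 i (fun h => h.2 rfl) x t.1 t.2
  simp only [lieDeriv, h, deriv_const]
  rfl

variable {L} in
/-- The inclusion `C^{Σ ∖ σ} → C^Σ`, with values in the domain of `δ_σ`. -/
def inclHom {J J' : Set (Fin L.u)} {i : Fin L.u} (hJ : J' = J \ {i}) :
    smoothRep L J' ⟶ derivRep L J i :=
  Rep.ofHom
    { toFun := fun f => ⟨f.1, smoothFun_mono L (hJ ▸ Set.sdiff_subset) f.2, by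
        rw [lieDeriv_eq_zero_of_invariant hJ f.2]; exact zero_mem _⟩
      map_add' := fun _ _ => rfl
      map_smul' := fun _ _ => rfl
      isIntertwining' := fun _ => rfl }

/-- The map `δ_σ`, defined on its domain in `C^Σ`, with values in `C^Σ`. -/
def derivHom (J : Set (Fin L.u)) (i : Fin L.u) : derivRep L J i ⟶ smoothRep L J :=
  Rep.ofHom
    { toFun := fun f => ⟨lieDeriv L i f.1, f.2.2⟩
      map_add' := fun f g => Subtype.ext (funext fun t =>
        deriv_add (differentiable_oneParam L f.2.1 i t) (differentiable_oneParam L g.2.1 i t))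
      map_smul' := fun a f => Subtype.ext (funext fun t =>
        deriv_const_smul a (differentiable_oneParam L f.2.1 i t))
      isIntertwining' := fun γ => LinearMap.ext fun f =>
        Subtype.ext (lieDeriv_translate L i γ f.1) }

variable {L} in
/-- The sequence `0 → C^{Σ ∖ σ} → C^Σ → C^Σ → 0` whose second map is `δ_σ`. -/
def seq {J J' : Set (Fin L.u)} {i : Fin L.u} (hJ : J' = J \ {i}) :
    ShortComplex (Rep ℂ (TRat F E)) where
  X₁ := smoothRep L J'
  X₂ := derivRep L J i
  X₃ := smoothRep L J
  f := inclHom hJ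
  g := derivHom L J i
  zero := Rep.hom_ext (Representation.IntertwiningMap.ext (LinearMap.ext fun f =>
    Subtype.ext (lieDeriv_eq_zero_of_invariant hJ f.2)))

variable {L} in
theorem seq_shortExact {J J' : Set (Fin L.u)} {i : Fin L.u} (hJ : J' = J \ {i}) (hi : i ∈ J) :
    (seq hJ).ShortExact where
  mono_f := (Rep.mono_iff_injective _).2 fun f g h =>
    Subtype.ext (congrArg (fun x : derivDomain L J i => x.1) h)
  epi_g := (Rep.epi_iff_surjective _).2 fun g => by
    have h := lieDeriv_primitive L i g.2
    exact ⟨⟨primitive L i g.1, primitive_mem L hi g.2, h.symm ▸ g.2⟩, Subtype.ext h⟩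
  exact := by
    refine (forget₂ _ (ModuleCat ℂ)).reflects_exact_of_faithful _ ?_
    rw [ShortComplex.moduleCat_exact_iff]
    intro f hf
    have h := mem_of_lieDeriv_eq_zero L f.2.1 (congrArg (fun x : smoothFun L J => x.1) hf)
    rw [← hJ] at h
    exact ⟨⟨f.1, h⟩, rfl⟩

/-- The set of indices `{n, …, u - 1}`. -/
def tail (n : ℕ) : Set (Fin L.u) := {j | n ≤ (j : ℕ)}

theorem tail_succ (i : Fin L.u) : tail L (i + 1) = tail L i \ {i} := by
  ext j
  simp only [tail, Set.mem_ofPred_eq, Set.mem_sdiff, Set.mem_singleton_iff, Fin.ext_iff]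
  omega

/-- The composite `∂_{n - 1} ∘ ⋯ ∘ ∂_0` of connecting homomorphisms, where
`∂_i : H^i(T(F), C^{{σ_i, …, σ_{u-1}}}) → H^{i+1}(T(F), C^{{σ_{i+1}, …, σ_{u-1}}})` is the one of
the exact sequence of `σ_i`. -/
def iterConn : ∀ n : ℕ, n ≤ L.u →
    (groupCohomology (smoothRep L (tail L 0)) 0 ⟶ groupCohomology (smoothRep L (tail L n)) n)
  | 0, _ => 𝟙 _
  | n + 1, hn =>
    iterConn n (Nat.le_of_succ_le hn) ≫
      groupCohomology.δ (seq_shortExact (tail_succ L ⟨n, hn⟩) (Nat.le_refl n)) n (n + 1) rfl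

/-- `∂ φ ∈ H^u(T(F), C^∅(T(𝔸_F), ℂ))` for `φ ∈ H^0(T(F), C^{Σ_T}(T(𝔸_F), ℂ))`, i.e. for
`φ ∈ C^{Σ_T}` which is `T(F)`-invariant. -/
def conn (φ : (smoothRep L (tail L 0)).ρ.invariants) :
    groupCohomology (smoothRep L (tail L L.u)) L.u :=
  iterConn L L.u le_rfl ((groupCohomology.H0Iso (smoothRep L (tail L 0))).inv φ)

end Connecting

/-! ### The fundamental class `η` and the cap product -/

section Fundamental

variable {F E : Type} [Field F] [NumberField F] [Field E] [NumberField E] [Algebra F E]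
variable (L : SplitPlaces F E)

/-- The `ℤ`-valued functions in `C^∅(T(𝔸_F), ℂ)` which are compactly supported in the variable in
`T(𝔸_F^∞)`. -/
def ccFun : Submodule ℤ (TAdele F E → ℤ) where
  carrier := {f | (fun t => (f t : ℂ)) ∈ smoothFun L ∅ ∧
    ∀ t, HasCompactSupport fun s => f (t, s)}
  add_mem' {f g} hf hg := by
    refine ⟨?_, fun t => (hf.2 t).add (hg.2 t)⟩
    have h : (fun t => ((f + g) t : ℂ)) = (fun t => (f t : ℂ)) + fun t => (g t : ℂ) :=
      funext fun t => Int.cast_add _ _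
    rw [h]
    exact add_mem hf.1 hg.1
  zero_mem' := by
    refine ⟨?_, fun t => HasCompactSupport.zero⟩
    have h : (fun t : TAdele F E => ((0 : TAdele F E → ℤ) t : ℂ)) = 0 :=
      funext fun t => Int.cast_zero
    rw [h]
    exact zero_mem _
  smul_mem' a f hf := by
    refine ⟨?_, fun t => (hf.2 t).smul_left (f := fun _ => a)⟩
    have h : (fun t => ((a • f) t : ℂ)) = (a : ℂ) • fun t => (f t : ℂ) :=
      funext fun t => Int.cast_mul _ _
    rw [h]
    exact Submodule.smul_mem _ _ hf.1

theorem translate_mem_ccFun (γ : TRat F E) {f : TAdele F E → ℤ} (hf : f ∈ ccFun L) :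
    translate γ f ∈ ccFun L :=
  ⟨translate_mem L hf.1 γ, fun t => (hf.2 ((diag F E γ)⁻¹.1 * t)).comp_homeomorph
    (Homeomorph.mulLeft (diag F E γ)⁻¹.2)⟩

/-- The `T(F)`-module `C_c^∅(T(𝔸_F), ℤ)`. -/
abbrev ccRep : Rep ℤ (TRat F E) :=
  Rep.of (transRep (ccFun L) fun γ _ hf => translate_mem_ccFun L γ hf)

open scoped Classical in
/-- `ι(1_𝓕)`, the function `(t_∞, t_f) ↦ 1_{T(F_∞)_+}(t_∞) 1_𝓕(t_f)`. -/
def iotaFun (c : Ideal (𝓞 F)) (r : ClPos E c → TFin F E) : TAdele F E → ℤ := fun t =>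
  if t.1 ∈ infPos F E ∧ t.2 ∈ finDomain E c r then 1 else 0

theorem translate_iotaFun (c : Ideal (𝓞 F)) (r : ClPos E c → TFin F E) {γ : TRat F E}
    (hγ : γ ∈ unitsPos E c) : translate γ (iotaFun c r) = iotaFun c r := by
  funext t
  have h1 : (diag F E γ)⁻¹.1 * t.1 ∈ infPos F E ↔ t.1 ∈ infPos F E :=
    (infPos F E).mul_mem_cancel_left ((infPos F E).inv_mem hγ.1)
  have h2 : ∀ g ∈ maxCompact E c, ∀ x, x ∈ finDomain E c r → g * x ∈ finDomain E c r := by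
    rintro g hg _ ⟨i, y, hy, rfl⟩
    exact ⟨i, g * y, mul_mem hg hy, mul_left_comm _ _ _⟩
  have h3 : (diag F E γ)⁻¹.2 * t.2 ∈ finDomain E c r ↔ t.2 ∈ finDomain E c r := by
    refine ⟨fun h => ?_, h2 _ ((maxCompact E c).inv_mem hγ.2) _⟩
    have h4 := h2 _ hγ.2 _ h
    have h5 : toFin F E γ * ((diag F E γ)⁻¹.2 * t.2) = t.2 := mul_inv_cancel_left _ _
    rwa [h5] at h4
  classical exact if_congr (and_congr h1 h3) rfl rfl

/-- The map of `T(𝒪_F)_+`-modules `ℤ → C_c^∅(T(𝔸_F), ℤ)`, `1 ↦ ι(1_𝓕)`. -/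
def iotaHom (c : Ideal (𝓞 F)) (r : ClPos E c → TFin F E) (hb : iotaFun c r ∈ ccFun L) :
    Rep.trivial ℤ (unitsPos E c) ℤ ⟶ Rep.res (unitsPos E c).subtype (ccRep L) :=
  Rep.ofHom
    { LinearMap.toSpanSingleton ℤ (ccFun L) ⟨iotaFun c r, hb⟩ with
      isIntertwining' := fun γ => LinearMap.ext fun n => by
        have h : (ccRep L).ρ γ.1 (⟨iotaFun c r, hb⟩ : ccFun L) = ⟨iotaFun c r, hb⟩ :=
          Subtype.ext (translate_iotaFun c r γ.2)
        change n • (⟨iotaFun c r, hb⟩ : ccFun L) =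
          (ccRep L).ρ γ.1 (n • (⟨iotaFun c r, hb⟩ : ccFun L))
        rw [map_zsmul, h] }

/-- The vector of logarithms `(log |γ|_σ)_σ ∈ ℝ^u` of `γ ∈ T(𝒪_F)_+`. -/
def unitLog (c : Ideal (𝓞 F)) (γ : unitsPos E c) : Fin L.u → ℝ := L.logVec (toInf F E γ.1)

/-- The inhomogeneous `u`-chain of `T(𝒪_F)_+` which represents the fundamental class of the torus
`T(F_∞)_0 / Λ`, if the images of `ε_0, …, ε_{u-1}` in `ℝ^u` are a basis of `Λ`: up to sign this is
the Pontryagin product `∑_π sgn(π) [ε_{π 0} | ⋯ | ε_{π (u-1)}]`. The sign is the one for which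
`e(ω) ∩ ξ = ∫_{T(F_∞)_0 / Λ} ω` for the invariant forms `ω = f d^×t_0`, where `T(F_∞)_0` is
oriented by the coordinates `(log |t|_σ)_σ` and `e` is the composite of the connecting maps in the
order of the enumeration of `Σ_T`, with translations acting by `(γ f)(t) = f (γ⁻¹ t)`. -/
def fundChain (c : Ideal (𝓞 F)) (ε : Fin L.u → unitsPos E c) :
    (Fin L.u → unitsPos E c) →₀ ℤ :=
  ((-1) ^ (L.u * (L.u + 1) / 2) *
      (SignType.sign (Matrix.det (Matrix.of fun i => unitLog L c (ε i))) : ℤ)) •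
    ∑ π : Equiv.Perm (Fin L.u), Finsupp.single (fun i => ε (π i)) (Equiv.Perm.sign π : ℤ)

/-- `ξ ∈ H_u(T(𝒪_F)_+, ℤ)` is (the image of) the fundamental class of `T(F_∞)_0 / Λ`, where
`Λ ⊆ ℝ^u` is the lattice of the logarithms of `T(𝒪_F)_+`. The choice of the `ε i`, which lift a
basis of `Λ`, fixes a splitting `T(𝒪_F)_+ ≃ Λ × T(𝒪_F)_{+,tors}`. -/
def IsFundamentalClass (c : Ideal (𝓞 F))
    (ξ : groupHomology (Rep.trivial ℤ (unitsPos E c) ℤ) L.u) : Prop :=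
  ∃ ε : Fin L.u → unitsPos E c,
    LinearIndependent ℝ (fun i => unitLog L c (ε i)) ∧
    (Submodule.span ℤ (Set.range fun i => unitLog L c (ε i)) : Set (Fin L.u → ℝ)) =
      Set.range (unitLog L c) ∧
    ∃ y : groupHomology.cycles (Rep.trivial ℤ (unitsPos E c) ℤ) L.u,
      groupHomology.iCycles (Rep.trivial ℤ (unitsPos E c) ℤ) L.u y = fundChain L c ε ∧
      groupHomology.π (Rep.trivial ℤ (unitsPos E c) ℤ) L.u y = ξ

/-- `η = ι(1_𝓕) ∩ ξ ∈ H_u(T(F), C_c^∅(T(𝔸_F), ℤ))`: the image of `ξ` under the map induced by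
the inclusion `T(𝒪_F)_+ ⊆ T(F)` and by `1 ↦ ι(1_𝓕)`. -/
def IsEta (c : Ideal (𝓞 F)) (r : ClPos E c → TFin F E)
    (η : groupHomology (ccRep L) L.u) : Prop :=
  ∃ hb : iotaFun c r ∈ ccFun L, ∃ ξ, IsFundamentalClass L c ξ ∧
    η = groupHomology.map (unitsPos E c).subtype (iotaHom L c r hb) L.u ξ

/-- The pairing `⟨f, b⟩ = ∑_{z ∈ T(F_∞)/T(F_∞)_+} ∫_S ∫_{T(𝔸_F^∞)} f(zs, t_f) b(zs, t_f)`. -/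
def pairing (μS : Measure L.compactPart) (μf : Measure (TFin F E))
    (f : TAdele F E → ℂ) (b : TAdele F E → ℤ) : ℂ :=
  ∑ᶠ z : TInf F E ⧸ infPos F E, ∫ s : L.compactPart, ∫ t : TFin F E,
    f (z.out * s, t) * (b (z.out * s, t) : ℂ) ∂μf ∂μS

/-- `κ ∩ η = v` for the cap product
`H^u(T(F), C^∅(T(𝔸_F), ℂ)) × H_u(T(F), C_c^∅(T(𝔸_F), ℤ)) → ℂ` induced by the pairing: on a
cocycle `z` and a cycle `y = ∑ b_g [g]` it is `∑ ⟨z(g), b_g⟩`. -/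
def IsCap (μS : Measure L.compactPart) (μf : Measure (TFin F E))
    (κ : groupCohomology (smoothRep L (tail L L.u)) L.u)
    (η : groupHomology (ccRep L) L.u) (v : ℂ) : Prop :=
  ∀ (z : groupCohomology.cocycles (smoothRep L (tail L L.u)) L.u)
    (y : groupHomology.cycles (ccRep L) L.u),
    groupCohomology.π (smoothRep L (tail L L.u)) L.u z = κ →
    groupHomology.π (ccRep L) L.u y = η →
    ((groupHomology.iCycles (ccRep L) L.u y : (Fin L.u → TRat F E) →₀ ccFun L).sum fun g b =>
      pairing L μS μf ((groupCohomology.iCocycles (smoothRep L (tail L L.u)) L.u z :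
        (Fin L.u → TRat F E) → smoothFun L (tail L L.u)) g).1 b.1) = v

/-- The Haar measure `d^×t` of `T(𝔸_F)`: the measure `d^×t_0 d^×s d^×t_f` on
`T(F_∞)_+ × T(𝔸_F^∞) = T(F_∞)_0 × S × T(𝔸_F^∞)` and on its translates, where
`d^×t_0 = ∏ dr / r` corresponds to the Lebesgue measure of `ℝ^u` under the exponential. -/
def haar (μS : Measure L.compactPart) (μf : Measure (TFin F E)) : Measure (TAdele F E) :=
  Measure.sum fun z : TInf F E ⧸ infPos F E =>
    Measure.map (fun p : (Fin L.u → ℝ) × L.compactPart × TFin F E =>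
      ((z.out * L.expVec p.1 * p.2.1, p.2.2) : TAdele F E)) (volume.prod (μS.prod μf))

end Fundamental

end RelTorus

end

noncomputable section

namespace RelTorus


/-! ### Archimedean part: the identity component, the logarithms, compactness of their kernel, and
weak approximation. -/

section InfinitePart

variable {F E : Type} [Field F] [NumberField F] [Field E] [NumberField E] [Algebra F E]

/-! The cap product is computed with an explicit cocycle for `∂φ`, and then averaged until only a
determinant remains.

The operator `primitive` is a linear section of `δ_σ`. If `z` is a cocycle with values in `C^Σ`,
applying the section to its values and taking the coboundary leaves only `g₀ · P(z(g₁, …)) - P(g₀ ·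
z(g₁, …))`, since all other faces commute with `P`. Iteration gives `iterCocycle`, which represents
`∂φ` by `exists_cocycle_eq_iterCocycle`. The pairing is `T(F)`-invariant, so the two differentials
are adjoint (`chainPair_d`) and the cap product may be computed on any cocycle and any cycle. On the
Pontryagin cycle that defines `η` it becomes, up to the prescribed sign, the alternating sum
`altSum`, by `pairing_iotaFun` and `sum_pairing_eq`.

Integration over `S × 𝓕` commutes with the primitives, and turns the action of `T(𝒪_F)_+` into
translation by `Λ` on `ℝ^u`. Hence `altSum` depends only on the `Λ`-periodic function `A`, the
average of `φ` (`avg_iterCocycle`), through the same iterated recipe on `ℝ^u` (`lineCocycle`). The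
recipe is hard to evaluate on `A` itself. But translating `φ` by `e^v ∈ T(F_∞)_0` does not change
`∂φ`: translation is an endomorphism of every exact sequence and the identity on `C^∅`
(`conn_shiftInv`). So `altSum` may be integrated over all `v` in a period parallelotope of `Λ`; as
the recipe is linear in the function, this replaces `A` by the constant `∫ A`
(`integral_lineCocycle`, `integral_avg_add`). On a constant every step is multiplication by minus
one coordinate of one logarithm vector (`lineCocycle_const`), and the alternating sum is a
determinant up to the sign of the reversal permutation (`sum_sign_prod_rev`). Its absolute value is
the volume of the parallelotope, its sign is that of the normalisation of `ξ`, and `smul_altSum`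
follows: the cap product is the integral of `A` over the parallelotope.

That integral is the integral of `φ` over `boxSet`, which meets every orbit of `T(F)` in exactly `h`
points (`encard_mul_mem_boxSet`), hence is `h` times the integral over any fundamental domain.

The arithmetic input is finiteness: `Cl(T)_+` is finite (`finite_ClPos`, from the class number of
`E`), and `Λ` is discrete and spans `ℝ^u` (`finite_logVec_le`, `span_logLattice`, from Dirichlet's
unit theorem). These make the box relatively compact and `T(F)` discrete and cocompact, which gives
integrability and a fundamental domain (`exists_isFundamentalDomain`). -/

theorem continuous_ringEquiv_mixedSpace :
    Continuous (InfiniteAdeleRing.ringEquiv_mixedSpace E) := by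
  have h : ∀ v : InfinitePlace E, Continuous fun a : InfiniteAdeleRing E => a v :=
    fun v => continuous_apply v
  refine Continuous.prodMk (continuous_pi fun v => ?_) (continuous_pi fun v => ?_)
  · exact (InfinitePlace.Completion.isometry_extensionEmbeddingOfIsReal v.2).continuous.comp
      (h v.1)
  · exact (InfinitePlace.Completion.isometry_extensionEmbedding v.1).continuous.comp (h v.1)

variable (E) in
/-- The units of `E_∞` and of `ℝ^r × ℂ^s` are homeomorphic. -/
def unitsMixedHomeo : (mixedEmbedding.mixedSpace E)ˣ ≃ₜ (InfiniteAdeleRing E)ˣ where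
  toEquiv := (Units.mapEquiv (InfiniteAdeleRing.ringEquiv_mixedSpace E).symm.toMulEquiv).toEquiv
  continuous_toFun := Continuous.units_map (N := InfiniteAdeleRing E)
    (InfiniteAdeleRing.ringEquiv_mixedSpace E).symm.toMonoidHom continuous_symm
  continuous_invFun := Continuous.units_map (M := InfiniteAdeleRing E)
    (InfiniteAdeleRing.ringEquiv_mixedSpace E).toMonoidHom continuous_ringEquiv_mixedSpace

theorem isOpenQuotientMap_mixedToInf :
    IsOpenQuotientMap (mixedToInf : (mixedEmbedding.mixedSpace E)ˣ →* TInf F E) :=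
  (QuotientGroup.isOpenQuotientMap_mk (G := (InfiniteAdeleRing E)ˣ)).comp
    (unitsMixedHomeo E).isOpenQuotientMap

instance : SecondCountableTopology (mixedEmbedding.mixedSpace E)ˣ :=
  haveI : SecondCountableTopology (mixedEmbedding.mixedSpace E)ᵐᵒᵖ :=
    MulOpposite.opHomeomorph.symm.secondCountableTopology
  Units.isEmbedding_embedProduct.secondCountableTopology

instance : SecondCountableTopology (TInf F E) :=
  isOpenQuotientMap_mixedToInf.isQuotientMap.secondCountableTopology
    isOpenQuotientMap_mixedToInf.isOpenMap

/-- The unit ball around `1` in `E ⊗ ℝ` consists of units (geometric series) and is convex, so its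
image is a connected neighbourhood of `1`, contained in the identity component. Consequently
`T(F_∞)/T(F_∞)_+` is discrete. -/
theorem isOpen_infPos : IsOpen (infPos F E : Set (TInf F E)) := by
  classical
  refine Subgroup.isOpen_of_mem_nhds _ (g := 1) ?_
  let B : Set (mixedEmbedding.mixedSpace E) := Metric.ball 1 1
  have hB : B ⊆ Set.range ((↑) : (mixedEmbedding.mixedSpace E)ˣ → mixedEmbedding.mixedSpace E) :=
    fun x hx => by
      have h1 : ‖1 - x‖ < 1 := by
        have := Metric.mem_ball.1 hx
        rwa [dist_comm, dist_eq_norm] at this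
      exact ⟨Units.oneSub (1 - x) h1, by simp⟩
  have hoe := Units.isOpenEmbedding_val (R := mixedEmbedding.mixedSpace E)
  let B' : Set (mixedEmbedding.mixedSpace E)ˣ := (↑) ⁻¹' B
  have hB' : IsOpen B' := Metric.isOpen_ball.preimage hoe.continuous
  have hB'c : IsPreconnected B' := by
    rw [← hoe.isInducing.isPreconnected_image, Set.image_preimage_eq_of_subset hB]
    exact (convex_ball _ _).isPreconnected
  have h1 : (1 : (mixedEmbedding.mixedSpace E)ˣ) ∈ B' := by
    change ((1 : (mixedEmbedding.mixedSpace E)ˣ) : mixedEmbedding.mixedSpace E) ∈ Metric.ball 1 1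
    simp
  have himg : (mixedToInf '' B' : Set (TInf F E)) ∈ nhds 1 :=
    (isOpenQuotientMap_mixedToInf.isOpenMap _ hB').mem_nhds ⟨1, h1, map_one _⟩
  refine Filter.mem_of_superset himg ?_
  exact (hB'c.image _ isOpenQuotientMap_mixedToInf.continuous.continuousOn).subset_connectedComponent
    ⟨1, h1, map_one _⟩

theorem isClosed_infPos : IsClosed (infPos F E : Set (TInf F E)) :=
  (infPos F E).isClosed_of_isOpen isOpen_infPos

instance : DiscreteTopology (TInf F E ⧸ infPos F E) :=
  QuotientGroup.discreteTopology isOpen_infPos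

/-- Weak approximation: `T(F)` meets every coset of `T(F_∞)_+`. -/
theorem exists_toInf_mem (t : TInf F E) : ∃ γ : TRat F E, t⁻¹ * toInf F E γ ∈ infPos F E := by
  classical
  let O : Set (mixedEmbedding.mixedSpace E)ˣ := {u | t⁻¹ * mixedToInf u ∈ infPos F E}
  have hO : IsOpen O := isOpen_infPos.preimage
    (continuous_const.mul isOpenQuotientMap_mixedToInf.continuous)
  have hne : O.Nonempty := by
    obtain ⟨u, hu⟩ := mixedToInf_surjective t
    exact ⟨u, by simp [O, hu, one_mem]⟩
  have hoe := Units.isOpenEmbedding_val (R := mixedEmbedding.mixedSpace E)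
  have hd : DenseRange fun x : E =>
      InfiniteAdeleRing.ringEquiv_mixedSpace E (algebraMap E (InfiniteAdeleRing E) x) :=
    (InfiniteAdeleRing.ringEquiv_mixedSpace E).surjective.denseRange.comp
      (InfiniteAdeleRing.denseRange_algebraMap E) continuous_ringEquiv_mixedSpace
  obtain ⟨x, u, hu, hux⟩ := hd.exists_mem_open (hoe.isOpenMap _ hO) (hne.image _)
  have hx : x ≠ 0 := by
    rintro rfl
    simp only [map_zero] at hux
    exact u.ne_zero hux
  refine ⟨QuotientGroup.mk (Units.mk0 x hx), ?_⟩
  have : toInf F E (QuotientGroup.mk (Units.mk0 x hx)) = mixedToInf u := by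
    change QuotientGroup.mk _ = QuotientGroup.mk _
    congr 1
    refine Units.ext ?_
    change algebraMap E (InfiniteAdeleRing E) x =
      (InfiniteAdeleRing.ringEquiv_mixedSpace E).symm (u : mixedEmbedding.mixedSpace E)
    rw [hux, RingEquiv.symm_apply_apply]
  rw [this]
  exact hu

/-! #### Places in a quadratic extension -/

theorem isGalois_of_finrank_eq_two (hE : Module.finrank F E = 2) : IsGalois F E := by
  haveI : Algebra.IsQuadraticExtension F E := ⟨hE⟩
  infer_instance

/-- The Galois group has order two and is transitive on the places above a given place of `F`. -/
theorem place_eq_or_eq (hE : Module.finrank F E = 2) {w₁ w₂ w₃ : InfinitePlace E} (h : w₁ ≠ w₂)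
    (h₂ : w₁.comap (algebraMap F E) = w₂.comap (algebraMap F E))
    (h₃ : w₁.comap (algebraMap F E) = w₃.comap (algebraMap F E)) : w₃ = w₁ ∨ w₃ = w₂ := by
  haveI := isGalois_of_finrank_eq_two hE
  haveI : FiniteDimensional F E := Module.finite_of_finrank_pos (by omega)
  obtain ⟨g, hg⟩ := InfinitePlace.exists_smul_eq_of_comap_eq h₂
  obtain ⟨k, hk⟩ := InfinitePlace.exists_smul_eq_of_comap_eq h₃
  have hc : Nat.card Gal(E/F) = 2 := (IsGalois.card_aut_eq_finrank F E).trans hE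
  have hg1 : g ≠ 1 := by rintro rfl; exact h (by simpa using hg)
  obtain ⟨a, b, hab, hu⟩ := Nat.card_eq_two_iff.1 hc
  have h1 : ∀ x : Gal(E/F), x = a ∨ x = b := fun x => by
    have : x ∈ ({a, b} : Set _) := hu ▸ Set.mem_univ x
    simpa using this
  have hk1 : k = 1 ∨ k = g := by
    rcases h1 1 with h | h <;> rcases h1 g with h' | h' <;> rcases h1 k with h'' | h'' <;>
      simp_all
  rcases hk1 with rfl | rfl
  · left; rw [← hk, one_smul]
  · right; rw [← hk, hg]

theorem exists_norm_eq (v : InfinitePlace F) (ρ : ℝ) (hρ : 0 ≤ ρ) :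
    ∃ a : v.Completion, ‖a‖ = ρ := by
  rcases v.isReal_or_isComplex with hv | hv
  · refine ⟨(InfinitePlace.Completion.isometryEquivRealOfIsReal hv).symm ρ, ?_⟩
    have h := InfinitePlace.Completion.isometry_extensionEmbeddingOfIsReal hv
    obtain ⟨a, ha⟩ := InfinitePlace.Completion.surjective_extensionEmbeddingOfIsReal hv ρ
    rw [show (InfinitePlace.Completion.isometryEquivRealOfIsReal hv).symm ρ = a from
      (InfinitePlace.Completion.isometryEquivRealOfIsReal hv).symm_apply_eq.2 ha.symm]
    rw [← (AddMonoidHomClass.isometry_iff_norm _).1 h a, ha, Real.norm_of_nonneg hρ]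
  · have h := InfinitePlace.Completion.isometry_extensionEmbedding v
    obtain ⟨a, ha⟩ := InfinitePlace.Completion.surjective_extensionEmbedding_of_isComplex hv (ρ : ℂ)
    refine ⟨a, ?_⟩
    rw [← (AddMonoidHomClass.isometry_iff_norm _).1 h a, ha, Complex.norm_real,
      Real.norm_of_nonneg hρ]

variable (L : SplitPlaces F E)

namespace SplitPlaces

theorem logVec_mul (s t : TInf F E) : L.logVec (s * t) = L.logVec s + L.logVec t :=
  funext fun i => by simp [logVec]

theorem logVec_one : L.logVec (1 : TInf F E) = 0 := funext fun i => by simp [logVec]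

theorem logVec_inv (s : TInf F E) : L.logVec s⁻¹ = - L.logVec s :=
  funext fun i => by simp [logVec]

theorem continuous_logVec : Continuous L.logVec :=
  continuous_pi fun i => continuous_logAbs L i

theorem expVec_add (x y : Fin L.u → ℝ) : L.expVec (x + y) = L.expVec x * L.expVec y := by
  simp only [expVec, Pi.add_apply, oneParam_add]
  exact Finset.prod_mul_distrib

theorem expVec_zero : L.expVec 0 = 1 := by
  simp only [expVec, Pi.zero_apply, oneParam_zero]
  exact Finset.prod_const_one

theorem expVec_neg (x : Fin L.u → ℝ) : L.expVec (-x) = (L.expVec x)⁻¹ := by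
  rw [eq_inv_iff_mul_eq_one, ← expVec_add, neg_add_cancel, expVec_zero]

theorem continuous_expVec : Continuous L.expVec :=
  continuous_finsetProd _ fun i _ => (continuous_oneParam L i).comp (continuous_apply i)

theorem logVec_oneParam (i : Fin L.u) (x : ℝ) : L.logVec (L.oneParam i x) = Pi.single i x := by
  classical
  funext j
  rw [logVec, logAbs_oneParam, Pi.single_apply]

theorem logVec_expVec (x : Fin L.u → ℝ) : L.logVec (L.expVec x) = x := by
  classical
  have h : ∀ s : Finset (Fin L.u), L.logVec (∏ i ∈ s, L.oneParam i (x i)) =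
      ∑ i ∈ s, Pi.single i (x i) := fun s => by
    induction s using Finset.induction_on with
    | empty => simpa using L.logVec_one
    | insert a s ha ih => rw [Finset.prod_insert ha, Finset.sum_insert ha, logVec_mul, ih,
        logVec_oneParam]
  rw [expVec, h, Finset.univ_sum_single]

theorem expVec_mem_infPos (x : Fin L.u → ℝ) : L.expVec x ∈ infPos F E :=
  (isPreconnected_range L.continuous_expVec).subset_connectedComponent
    ⟨0, L.expVec_zero⟩ ⟨x, rfl⟩

theorem mem_compactPart {t : TInf F E} :
    t ∈ L.compactPart ↔ t ∈ infPos F E ∧ L.logVec t = 0 := by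
  rw [compactPart, Subgroup.mem_inf, Subgroup.mem_iInf, funext_iff]
  exact Iff.rfl

theorem expVec_logVec_inv_mul_mem {t : TInf F E} (ht : t ∈ infPos F E) :
    (L.expVec (L.logVec t))⁻¹ * t ∈ L.compactPart := by
  rw [mem_compactPart, logVec_mul, logVec_inv, logVec_expVec]
  exact ⟨mul_mem (inv_mem (L.expVec_mem_infPos _)) ht, neg_add_cancel _⟩

/-- At each place `v` of `F` a representative is divided by an element of `F_v` with the norm that
it has at one chosen place above `v`. If there is a second place above `v`, then `v` splits, and the
vanishing of the logarithm says that both norms agree. -/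
theorem exists_unit_circle (hE : Module.finrank F E = 2) {t : TInf F E} (ht : L.logVec t = 0) :
    ∃ x : (InfiniteAdeleRing E)ˣ, QuotientGroup.mk x = t ∧
      ∀ w, ‖(x : InfiniteAdeleRing E) w‖ = 1 := by
  obtain ⟨x, rfl⟩ := QuotientGroup.mk_surjective t
  have hx : ∀ w, 0 < ‖(x : InfiniteAdeleRing E) w‖ := fun w => by
    have h : (x : InfiniteAdeleRing E) w * (x⁻¹ : (InfiniteAdeleRing E)ˣ).1 w = 1 :=
      congrFun x.mul_inv w
    exact norm_pos_iff.2 (left_ne_zero_of_mul_eq_one h)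
  have hs : Function.Surjective fun w : InfinitePlace E => w.comap (algebraMap F E) :=
    haveI : FiniteDimensional F E := Module.finite_of_finrank_pos (by omega)
    InfinitePlace.comap_surjective
  choose p hp using hs
  choose a ha using fun v : InfinitePlace F =>
    exists_norm_eq v ‖(x : InfiniteAdeleRing E) (p v)‖⁻¹ (inv_nonneg.2 (norm_nonneg _))
  have ha0 : ∀ v, a v ≠ 0 := fun v => norm_ne_zero_iff.1 (by rw [ha]; exact (inv_pos.2 (hx _)).ne')
  let A : (InfiniteAdeleRing F)ˣ := ⟨a, fun v => (a v)⁻¹,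
    funext fun v => mul_inv_cancel₀ (ha0 v), funext fun v => inv_mul_cancel₀ (ha0 v)⟩
  refine ⟨x * Units.map (infMap F E : InfiniteAdeleRing F →* InfiniteAdeleRing E) A, ?_, ?_⟩
  · refine (QuotientGroup.eq.2 ?_).symm
    rw [inv_mul_cancel_left]
    exact ⟨A, rfl⟩
  · intro w
    change ‖(x : InfiniteAdeleRing E) w * infMap F E a w‖ = 1
    refine (norm_mul _ _).trans ?_
    refine (congrArg (‖(x : InfiniteAdeleRing E) w‖ * ·) ((norm_infMap a w).trans (ha _))).trans ?_
    change ‖(x : InfiniteAdeleRing E) w‖ * ‖(x : InfiniteAdeleRing E) (p (w.comap _))‖⁻¹ = 1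
    by_cases hw : p (w.comap (algebraMap F E)) = w
    · rw [hw]; exact mul_inv_cancel₀ (hx w).ne'
    · have hsplit : w.comap (algebraMap F E) ∈ Set.range L.σ := by
        rw [L.range_σ]
        exact ⟨_, _, hw, hp _, rfl⟩
      obtain ⟨i, hi⟩ := hsplit
      have hl : Real.log ‖(x : InfiniteAdeleRing E) (L.w i)‖ -
          Real.log ‖(x : InfiniteAdeleRing E) (L.w' i)‖ = 0 := congrFun ht i
      have hn : ‖(x : InfiniteAdeleRing E) (L.w i)‖ = ‖(x : InfiniteAdeleRing E) (L.w' i)‖ :=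
        Real.log_injOn_pos (hx _) (hx _) (sub_eq_zero.1 hl)
      have key : ∀ w₃ : InfinitePlace E, w₃.comap (algebraMap F E) = L.σ i →
          ‖(x : InfiniteAdeleRing E) w₃‖ = ‖(x : InfiniteAdeleRing E) (L.w i)‖ := fun w₃ h₃ => by
        rcases place_eq_or_eq hE (L.w_ne i) ((L.comap_w i).trans (L.comap_w' i).symm)
          ((L.comap_w i).trans h₃.symm) with rfl | rfl
        · rfl
        · exact hn.symm
      rw [key w hi.symm, key _ ((hp _).trans hi.symm), ← key w hi.symm]
      exact mul_inv_cancel₀ (hx w).ne'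

/-- It is a closed subset of the image of the units `y` with `y` and `y⁻¹` in the closed unit ball,
a compact set because `y ↦ (y, y⁻¹)` is a closed embedding. -/
theorem isCompact_ker_logVec (hE : Module.finrank F E = 2) :
    IsCompact {t : TInf F E | L.logVec t = 0} := by
  classical
  let M := mixedEmbedding.mixedSpace E
  let C : Set Mˣ := Units.embedProduct M ⁻¹'
    (Metric.closedBall 0 1 ×ˢ (MulOpposite.opHomeomorph.symm ⁻¹' Metric.closedBall (0 : M) 1))
  have hC : IsCompact C := by
    refine Units.isClosedEmbedding_embedProduct.isCompact_preimage ?_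
    refine (isCompact_closedBall _ _).prod ?_
    exact MulOpposite.opHomeomorph.symm.isCompact_preimage.2 (isCompact_closedBall _ _)
  refine (hC.image isOpenQuotientMap_mixedToInf.continuous).of_isClosed_subset
    (isClosed_singleton.preimage L.continuous_logVec) fun t ht => ?_
  obtain ⟨x, rfl, hx⟩ := L.exists_unit_circle hE ht
  have hx' : ∀ w, ‖(x⁻¹ : (InfiniteAdeleRing E)ˣ).1 w‖ = 1 := fun w => by
    have h : (x : InfiniteAdeleRing E) w * (x⁻¹ : (InfiniteAdeleRing E)ˣ).1 w = 1 :=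
      congrFun x.mul_inv w
    have := congrArg norm h
    rwa [norm_mul, hx, one_mul, norm_one] at this
  have key : ∀ y : M, (∀ w, ‖(InfiniteAdeleRing.ringEquiv_mixedSpace E).symm y w‖ = 1) →
      y ∈ Metric.closedBall (0 : M) 1 := fun y hy => by
    rw [mem_closedBall_zero_iff]
    refine max_le ((pi_norm_le_iff_of_nonneg zero_le_one).2 fun v => ?_)
      ((pi_norm_le_iff_of_nonneg zero_le_one).2 fun v => ?_)
    · rw [← norm_symm_of_isReal y v.1 v.2, hy]
    · rw [← norm_symm_of_isComplex y v.1 v.2, hy]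
  refine ⟨(unitsMixedHomeo E).symm x, ⟨key _ ?_, key _ ?_⟩, ?_⟩
  · intro w
    exact (congrArg (fun z : InfiniteAdeleRing E => ‖z w‖)
      ((InfiniteAdeleRing.ringEquiv_mixedSpace E).symm_apply_apply _)).trans (hx w)
  · intro w
    exact (congrArg (fun z : InfiniteAdeleRing E => ‖z w‖)
      ((InfiniteAdeleRing.ringEquiv_mixedSpace E).symm_apply_apply _)).trans (hx' w)
  · exact congrArg QuotientGroup.mk ((unitsMixedHomeo E).apply_symm_apply x)

theorem isCompact_compactPart (hE : Module.finrank F E = 2) :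
    IsCompact (L.compactPart : Set (TInf F E)) := by
  have : (L.compactPart : Set (TInf F E)) = (infPos F E : Set (TInf F E)) ∩ {t | L.logVec t = 0} :=
    Set.ext fun t => L.mem_compactPart
  rw [this]
  exact (L.isCompact_ker_logVec hE).inter_left isClosed_infPos

/-- The discrete quotient is the image of the compact kernel of the logarithms, since `T(F_∞)_0 ⊆
T(F_∞)_+` accounts for the rest. -/
theorem finite_quotient_infPos (L : SplitPlaces F E) (hE : Module.finrank F E = 2) :
    Finite (TInf F E ⧸ infPos F E) := by
  refine Set.finite_univ_iff.1 ?_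
  have h := (L.isCompact_ker_logVec hE).image
    (QuotientGroup.continuous_mk (N := infPos F E))
  refine h.finite_of_discrete.subset fun z _ => ?_
  obtain ⟨t, rfl⟩ := QuotientGroup.mk_surjective z
  refine ⟨t * (L.expVec (L.logVec t))⁻¹, ?_, ?_⟩
  · simp only [Set.mem_ofPred_eq, logVec_mul, logVec_inv, logVec_expVec, add_neg_cancel]
  · refine QuotientGroup.eq.2 ?_
    rw [mul_inv_rev, inv_inv, mul_assoc, inv_mul_cancel, mul_one]
    exact L.expVec_mem_infPos _

end SplitPlaces

end InfinitePart


/-! ### Finite adeles of `F` -/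

section FiniteAdeles

variable {F : Type} [Field F] [NumberField F]

open HeightOneSpectrum

theorem valued_algebraMap (v : HeightOneSpectrum (𝓞 F)) (a : 𝓞 F) :
    Valued.v ((algebraMap (𝓞 F) F a : F) : v.adicCompletion F) = v.intValuation a := by
  rw [valuedAdicCompletion_eq_valuation', valuation_of_algebraMap]

/-- Density of `F` in `F_v` gives an approximation `k ∈ F`, which is then integral at `v`; a second
approximation replaces `k` by an algebraic integer of `F`. -/
theorem exists_valued_sub_le (v : HeightOneSpectrum (𝓞 F)) {x : v.adicCompletion F}
    (hx : x ∈ v.adicCompletionIntegers F) {N : 𝓞 F} (hN : N ≠ 0) :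
    ∃ a : 𝓞 F, Valued.v (x - ((algebraMap (𝓞 F) F a : F) : v.adicCompletion F)) ≤
      v.intValuation N := by
  have hN' : v.intValuation N ≠ 0 := v.intValuation_ne_zero N hN
  have hNv := valued_algebraMap v N
  set N' : v.adicCompletion F := ((algebraMap (𝓞 F) F N : F) : v.adicCompletion F) with hN'def
  let O : Set (v.adicCompletion F) := (fun y => (x - y) * N'⁻¹) ⁻¹' v.adicCompletionIntegers F
  have hO : IsOpen O := by
    have hc : Continuous fun y : v.adicCompletion F => (x - y) * N'⁻¹ :=
      (continuous_const.sub continuous_id).mul continuous_const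
    exact (Valued.isOpen_valuationSubring (v.adicCompletion F)).preimage hc
  obtain ⟨k, hk⟩ := (denseRange_algebraMap (K := F) v).exists_mem_open hO
    ⟨x, by change (x - x) * N'⁻¹ ∈ v.adicCompletionIntegers F; rw [sub_self, zero_mul]; exact zero_mem _⟩
  change (x - (k : v.adicCompletion F)) * N'⁻¹ ∈ v.adicCompletionIntegers F at hk
  rw [mem_adicCompletionIntegers, map_mul, map_inv₀, hNv, mul_inv_le_iff₀ (zero_lt_iff.2 hN'),
    one_mul] at hk
  have hk1 : v.valuation F k ≤ 1 := by
    rw [← valuedAdicCompletion_eq_valuation']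
    have : (k : v.adicCompletion F) = x - (x - k) := by ring
    rw [this]
    exact (Valuation.map_sub _ _ _).trans (max_le hx (hk.trans (v.intValuation_le_one N)))
  obtain ⟨a, ha⟩ := exists_valuation_sub_lt_of_integer v hk1 (Units.mk0 _ hN')
  refine ⟨a, ?_⟩
  have : x - ((algebraMap (𝓞 F) F a : F) : v.adicCompletion F) =
      (x - k) - ((algebraMap (𝓞 F) F a - k : F) : v.adicCompletion F) := by
    have h := adicCompletion.coe_add F v (algebraMap (𝓞 F) F a - k) k
    rw [sub_add_cancel] at h
    rw [h]; ring
  rw [this]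
  refine (Valuation.map_sub _ _ _).trans (max_le hk ?_)
  rw [valuedAdicCompletion_eq_valuation']
  exact ha.le

/-- Approximation modulo a uniformizer shows that the finite ring `𝒪_F/v` surjects onto the residue
field. This is the finiteness that makes the local integers, and so `𝒪̂_F`, compact. -/
theorem finite_residueField (v : HeightOneSpectrum (𝓞 F)) :
    Finite (IsLocalRing.ResidueField (v.adicCompletionIntegers F)) := by
  obtain ⟨ϖ, hϖ⟩ := intValuation_exists_uniformizer v
  have hϖ0 : ϖ ≠ 0 := by rintro rfl; simp [WithZero.exp_ne_zero.symm] at hϖ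
  have hϖ1 : v.intValuation ϖ < 1 := by rw [hϖ]; exact WithZero.exp_lt_exp.2 (by norm_num)
  have hker : ∀ a : 𝓞 F, a ∈ v.asIdeal →
      ((IsLocalRing.residue (v.adicCompletionIntegers F)).comp
        (algebraMap (𝓞 F) (v.adicCompletionIntegers F))) a = 0 := fun a ha => by
    rw [RingHom.comp_apply, IsLocalRing.residue_eq_zero_iff, IsLocalRing.mem_maximalIdeal,
      mem_nonunits_iff, adicCompletionIntegers.isUnit_iff_valued_eq_one]
    rw [← v.intValuation_lt_one_iff_mem, ← valued_algebraMap] at ha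
    exact ha.ne
  haveI : Finite (𝓞 F ⧸ v.asIdeal) := Ideal.finiteQuotientOfFreeOfNeBot _ v.ne_bot
  refine Finite.of_surjective (Ideal.Quotient.lift v.asIdeal _ hker) fun y => ?_
  obtain ⟨x, rfl⟩ := IsLocalRing.residue_surjective y
  obtain ⟨a, ha⟩ := exists_valued_sub_le v x.2 hϖ0
  refine ⟨Ideal.Quotient.mk _ a, ?_⟩
  rw [Ideal.Quotient.lift_mk, RingHom.comp_apply, ← sub_eq_zero, ← map_sub,
    IsLocalRing.residue_eq_zero_iff, IsLocalRing.mem_maximalIdeal, mem_nonunits_iff,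
    adicCompletionIntegers.isUnit_iff_valued_eq_one]
  refine ne_of_lt (lt_of_le_of_lt ?_ hϖ1)
  rw [← Valuation.map_neg, ← NegMemClass.coe_neg, neg_sub]
  exact ha

instance compactSpace_adicCompletionIntegers (v : HeightOneSpectrum (𝓞 F)) :
    CompactSpace (v.adicCompletionIntegers F) := by
  haveI := finite_residueField v
  have h : CompactSpace (Valued.integer (v.adicCompletion F)) := by
    rw [Valued.integer.compactSpace_iff_completeSpace_and_isDiscreteValuationRing_and_finite_residueField]
    refine ⟨?_, inferInstanceAs (IsDiscreteValuationRing (v.adicCompletionIntegers F)),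
      inferInstanceAs (Finite (IsLocalRing.ResidueField (v.adicCompletionIntegers F)))⟩
    exact (Valued.isClosed_integer (v.adicCompletion F)).isComplete.completeSpace_coe
  exact h

theorem isOpen_intAdeles : IsOpen (intAdeles F : Set (FiniteAdeleRing (𝓞 F) F)) := by
  have h := RestrictedProduct.isOpen_forall_mem
    (R := fun v : HeightOneSpectrum (𝓞 F) => v.adicCompletion F)
    (A := fun v : HeightOneSpectrum (𝓞 F) => (v.adicCompletionIntegers F : Set _))
    fun v => Valued.isOpen_valuationSubring (v.adicCompletion F)
  exact h

theorem isCompact_intAdeles : IsCompact (intAdeles F : Set (FiniteAdeleRing (𝓞 F) F)) := by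
  haveI : ∀ v : HeightOneSpectrum (𝓞 F),
      CompactSpace (v.adicCompletionIntegers F : Set (v.adicCompletion F)) :=
    fun v => compactSpace_adicCompletionIntegers v
  have h := isCompact_range (RestrictedProduct.isEmbedding_structureMap
    (R := fun v : HeightOneSpectrum (𝓞 F) => v.adicCompletion F)
    (A := fun v : HeightOneSpectrum (𝓞 F) => (v.adicCompletionIntegers F : Set _))
    (𝓕 := Filter.cofinite)).continuous
  rw [RestrictedProduct.range_structureMap] at h
  exact h

instance : T2Space (FiniteAdeleRing (𝓞 F) F) :=
  inferInstanceAs (T2Space (RestrictedProduct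
    (fun v : HeightOneSpectrum (𝓞 F) => v.adicCompletion F)
    (fun v => (v.adicCompletionIntegers F : Set (v.adicCompletion F))) Filter.cofinite))

theorem algebraMap_mem_intAdeles_iff (x : F) :
    algebraMap F (FiniteAdeleRing (𝓞 F) F) x ∈ intAdeles F ↔
      ∃ a : 𝓞 F, algebraMap (𝓞 F) F a = x := by
  constructor
  · intro h
    obtain ⟨a, ha⟩ := mem_integers_of_valuation_le_one (R := 𝓞 F) F x fun v => by
      have := h v
      rw [FiniteAdeleRing.algebraMap_apply, mem_adicCompletionIntegers,
        valuedAdicCompletion_eq_valuation'] at this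
      exact this
    exact ⟨a, ha⟩
  · rintro ⟨a, rfl⟩ v
    exact coe_algebraMap_mem _ _ v a

theorem algebraMap_mem_intAdeles (a : 𝓞 F) :
    algebraMap F (FiniteAdeleRing (𝓞 F) F) (algebraMap (𝓞 F) F a) ∈ intAdeles F :=
  (algebraMap_mem_intAdeles_iff _).2 ⟨a, rfl⟩

theorem exists_mul_mem_intAdeles (a : FiniteAdeleRing (𝓞 F) F) :
    ∃ N : 𝓞 F, N ≠ 0 ∧
      algebraMap F (FiniteAdeleRing (𝓞 F) F) (algebraMap (𝓞 F) F N) * a ∈ intAdeles F := by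
  classical
  have hfin : {v : HeightOneSpectrum (𝓞 F) | a v ∉ v.adicCompletionIntegers F}.Finite := a.2
  choose b hb0 hb using fun v : HeightOneSpectrum (𝓞 F) =>
    adicCompletion.mul_nonZeroDivisor_mem_adicCompletionIntegers v (a v)
  refine ⟨∏ v ∈ hfin.toFinset, b v,
    Finset.prod_ne_zero_iff.2 fun v _ => nonZeroDivisors.ne_zero (hb0 v), fun v => ?_⟩
  change ((algebraMap (𝓞 F) F (∏ v ∈ hfin.toFinset, b v) : F) : v.adicCompletion F) * a v ∈ _
  by_cases hv : a v ∈ v.adicCompletionIntegers F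
  · exact mul_mem (coe_algebraMap_mem _ _ v _) hv
  · rw [← Finset.mul_prod_erase _ _ (hfin.mem_toFinset.2 hv), map_mul, adicCompletion.coe_mul,
      mul_comm, ← mul_assoc]
    exact mul_mem (hb v) (coe_algebraMap_mem _ _ v _)

/-- Only finitely many places divide `N`; local approximations there are glued by the Chinese
remainder theorem, and at all other places integrality suffices. -/
theorem exists_sub_mul_mem_intAdeles {b : FiniteAdeleRing (𝓞 F) F} (hb : b ∈ intAdeles F)
    {N : 𝓞 F} (hN : N ≠ 0) :
    ∃ y : 𝓞 F, ∀ v, Valued.v (b v - ((algebraMap (𝓞 F) F y : F) : v.adicCompletion F)) ≤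
      v.intValuation N := by
  classical
  have hfin : {v : HeightOneSpectrum (𝓞 F) | v.intValuation N < 1}.Finite := by
    refine (HeightOneSpectrum.Support.finite (𝓞 F) (algebraMap (𝓞 F) F N)⁻¹).subset fun v hv => ?_
    change 1 < v.valuation F (algebraMap (𝓞 F) F N)⁻¹
    rw [map_inv₀, valuation_of_algebraMap]
    exact (one_lt_inv₀ (zero_lt_iff.2 (v.intValuation_ne_zero N hN))).2 hv
  choose a ha using fun v => exists_valued_sub_le v (hb v) hN
  obtain ⟨y, hy⟩ := IsDedekindDomain.exists_forall_sub_mem_ideal (s := hfin.toFinset)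
    (fun v : HeightOneSpectrum (𝓞 F) => v.asIdeal)
    (fun v => multiplicity v.asIdeal (Ideal.span {N})) (fun v _ => v.prime)
    (fun v _ w _ hvw h => hvw (HeightOneSpectrum.ext h)) (fun v => a v.1)
  refine ⟨y, fun v => ?_⟩
  by_cases hv : v.intValuation N < 1
  · have h1 := hy v (hfin.mem_toFinset.2 hv)
    rw [← intValuation_le_pow_iff_mem, ← v.intValuation_eq_exp_neg_multiplicity hN] at h1
    have : b v - ((algebraMap (𝓞 F) F y : F) : v.adicCompletion F) =
      (b v - ((algebraMap (𝓞 F) F (a v) : F) : v.adicCompletion F)) -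
        ((algebraMap (𝓞 F) F (y - a v) : F) : v.adicCompletion F) := by
      have h := adicCompletion.coe_add F v (algebraMap (𝓞 F) F (y - a v)) (algebraMap (𝓞 F) F (a v))
      rw [← map_add, sub_add_cancel] at h
      rw [h]; ring
    rw [this]
    refine (Valuation.map_sub _ _ _).trans (max_le (ha v) ?_)
    rw [valued_algebraMap]
    exact h1
  · have h1 : v.intValuation N = 1 := le_antisymm (v.intValuation_le_one N) (not_lt.1 hv)
    rw [h1]
    exact sub_mem (hb v) (coe_algebraMap_mem _ _ v y)

/-- Strong approximation: `𝔸_F^∞ = F + N 𝒪̂_F`. -/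
theorem exists_eq_algebraMap_add (a : FiniteAdeleRing (𝓞 F) F) {N : 𝓞 F} (hN : N ≠ 0) :
    ∃ x : F, ∃ b ∈ intAdeles F, a = algebraMap F (FiniteAdeleRing (𝓞 F) F) x +
      algebraMap F (FiniteAdeleRing (𝓞 F) F) (algebraMap (𝓞 F) F N) * b := by
  obtain ⟨M, hM, hMa⟩ := exists_mul_mem_intAdeles a
  obtain ⟨y, hy⟩ := exists_sub_mul_mem_intAdeles hMa (mul_ne_zero hN hM)
  have hM' : algebraMap (𝓞 F) F M ≠ 0 := by simpa using hM
  have hN' : algebraMap (𝓞 F) F N ≠ 0 := by simpa using hN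
  set f := algebraMap F (FiniteAdeleRing (𝓞 F) F) with hf
  have hfM : f (algebraMap (𝓞 F) F M) * f (algebraMap (𝓞 F) F M)⁻¹ = 1 := by
    rw [← map_mul, mul_inv_cancel₀ hM', map_one]
  have hfN : f (algebraMap (𝓞 F) F N) * f (algebraMap (𝓞 F) F N)⁻¹ = 1 := by
    rw [← map_mul, mul_inv_cancel₀ hN', map_one]
  -- With `M a` integral and `y` close to `M a` modulo `N M`, take `x = y / M` and `b = (M a - y) /
  -- (N M)`.
  refine ⟨algebraMap (𝓞 F) F y * (algebraMap (𝓞 F) F M)⁻¹,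
    f (algebraMap (𝓞 F) F N)⁻¹ * f (algebraMap (𝓞 F) F M)⁻¹ *
      (f (algebraMap (𝓞 F) F M) * a - f (algebraMap (𝓞 F) F y)), fun v => ?_, ?_⟩
  · have h := hy v
    rw [map_mul, ← valued_algebraMap, ← valued_algebraMap, ← map_mul] at h
    have hNM : (((algebraMap (𝓞 F) F N : F) : v.adicCompletion F) *
      ((algebraMap (𝓞 F) F M : F) : v.adicCompletion F)) ≠ 0 := by
      rw [← adicCompletion.coe_mul]
      intro h0
      have := congrArg Valued.v h0
      rw [valuedAdicCompletion_eq_valuation', map_zero, map_eq_zero] at this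
      exact mul_ne_zero hN' hM' this
    change ((((algebraMap (𝓞 F) F N)⁻¹ : F) : v.adicCompletion F) *
      (((algebraMap (𝓞 F) F M)⁻¹ : F) : v.adicCompletion F)) * _ ∈ v.adicCompletionIntegers F
    have hinv : ((((algebraMap (𝓞 F) F N)⁻¹ : F) : v.adicCompletion F) *
      (((algebraMap (𝓞 F) F M)⁻¹ : F) : v.adicCompletion F)) =
      (((algebraMap (𝓞 F) F N : F) : v.adicCompletion F) *
      ((algebraMap (𝓞 F) F M : F) : v.adicCompletion F))⁻¹ := by
      refine eq_inv_of_mul_eq_one_left ?_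
      rw [← adicCompletion.coe_mul, ← adicCompletion.coe_mul, ← adicCompletion.coe_mul,
        ← mul_inv, inv_mul_cancel₀ (mul_ne_zero hN' hM'), adicCompletion.coe_one]
    rw [hinv, mem_adicCompletionIntegers, map_mul, map_inv₀,
      inv_mul_le_iff₀ (zero_lt_iff.2 ((map_ne_zero _).2 hNM)), mul_one]
    exact h
  · rw [map_mul]
    linear_combination (-1 : FiniteAdeleRing (𝓞 F) F) * a * hfM -
      (f (algebraMap (𝓞 F) F M) * a - f (algebraMap (𝓞 F) F y)) * f (algebraMap (𝓞 F) F M)⁻¹ * hfN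

end FiniteAdeles


/-! ### Finite adeles of `E` -/

section FiniteAdelesE

variable {F E : Type} [Field F] [NumberField F] [Field E] [NumberField E] [Algebra F E]

instance : FiniteDimensional F E := Module.Finite.of_restrictScalars_finite ℚ F E

theorem order_top : order E (⊤ : Ideal (𝓞 F)) = Set.univ :=
  Set.eq_univ_of_forall fun x => ⟨0, x, by simp [Ideal.map_top], by simp⟩

/-- Any `F`-basis of `E` is scaled by denominators to become integral, and then by a nonzero `d ∈
c`, which puts it into `c 𝒪_E ⊆ 𝒪_c`. -/
theorem exists_basis_mem_order {c : Ideal (𝓞 F)} (hc : c ≠ ⊥) :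
    ∃ b : Module.Basis (Fin (Module.finrank F E)) F E,
      ∀ i, ∃ x ∈ order E c, algebraMap (𝓞 E) E x = b i := by
  obtain ⟨d, hd, hd0⟩ := Submodule.exists_mem_ne_zero_of_ne_bot hc
  have h1 : ∀ i, ∃ y : 𝓞 F, y ≠ 0 ∧ IsIntegral (𝓞 F) (y • Module.finBasis F E i) := fun i =>
    ((IsFractionRing.isAlgebraic_iff (𝓞 F) F E).2 
      (Algebra.IsAlgebraic.isAlgebraic (R := F) (Module.finBasis F E i))).exists_integral_multiple
  choose y hy0 hy using h1
  have hw : ∀ i, IsUnit (algebraMap (𝓞 F) F (d * y i)) := fun i => by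
    simpa using ⟨hd0, hy0 i⟩
  have hz : ∀ i, ∃ z : 𝓞 E, algebraMap (𝓞 E) E z = y i • Module.finBasis F E i := fun i =>
    ⟨⟨y i • Module.finBasis F E i, isIntegral_trans (R := ℤ) (A := 𝓞 F) _ (hy i)⟩, rfl⟩
  choose z hz using hz
  refine ⟨(Module.finBasis F E).isUnitSMul hw, fun i => ⟨algebraMap (𝓞 F) (𝓞 E) d * z i,
    ⟨0, algebraMap (𝓞 F) (𝓞 E) d * z i, Ideal.mul_mem_right _ _ (Ideal.mem_map_of_mem _ hd),
      by simp⟩, ?_⟩⟩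
  rw [Module.Basis.isUnitSMul_apply, map_mul, hz, map_mul, mul_smul, ← IsScalarTower.algebraMap_apply, IsScalarTower.algebraMap_apply (𝓞 F) F E,
    ← Algebra.smul_def]
  simp only [algebraMap_smul]

variable (b : Module.Basis (Fin (Module.finrank F E)) F E)

/-- The basis of `Ê` over `𝔸_F^∞` given by a basis of `E` over `F`. -/
def hatBasis : Module.Basis (Fin (Module.finrank F E)) (FiniteAdeleRing (𝓞 F) F) (FinAdeles F E) :=
  Algebra.TensorProduct.basis (FiniteAdeleRing (𝓞 F) F) b

theorem hatBasis_apply (i) : hatBasis b i = finEmb F E (b i) :=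
  Algebra.TensorProduct.basis_apply _ _

theorem hatBasis_repr_finEmb (x : E) (i) : (hatBasis b).repr (finEmb F E x) i =
    algebraMap F (FiniteAdeleRing (𝓞 F) F) (b.repr x i) := by
  have := Algebra.TensorProduct.basis_repr_tmul (A := FiniteAdeleRing (𝓞 F) F) b 1 x
  refine (congrArg (fun f => f i) this).trans ?_
  simp

theorem continuous_hatBasis_repr :
    Continuous (hatBasis b).equivFun :=
  IsModuleTopology.continuous_of_linearMap (hatBasis b).equivFun.toLinearMap

theorem continuous_hatBasis_symm :
    Continuous (hatBasis b).equivFun.symm :=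
  IsModuleTopology.continuous_of_linearMap (hatBasis b).equivFun.symm.toLinearMap

/-- The lattice `⨁ᵢ 𝒪̂_F bᵢ` in `Ê`. -/
def hatLattice : Set (FinAdeles F E) := {y | ∀ i, (hatBasis b).equivFun y i ∈ intAdeles F}

theorem isOpen_hatLattice : IsOpen (hatLattice b) := by
  have : hatLattice b = (hatBasis b).equivFun ⁻¹' (Set.univ.pi fun _ => intAdeles F) := by
    ext; simp [hatLattice]
  rw [this]
  exact (isOpen_set_pi Set.finite_univ fun _ _ => isOpen_intAdeles).preimage
    (continuous_hatBasis_repr b)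

theorem isCompact_hatLattice : IsCompact (hatLattice b) := by
  have : hatLattice b = (hatBasis b).equivFun.symm '' (Set.univ.pi fun _ => intAdeles F) := by
    rw [LinearEquiv.image_symm_eq_preimage]
    ext; simp [hatLattice]
  rw [this]
  exact (isCompact_univ_pi fun _ => isCompact_intAdeles).image (continuous_hatBasis_symm b)

instance : T2Space (FinAdeles F E) :=
  (Topology.IsEmbedding.of_leftInverse
    (hatBasis (Module.finBasis F E)).equivFun.left_inv
    (continuous_hatBasis_symm _) (continuous_hatBasis_repr _)).t2Space


theorem smul_def_intAdeles (a : intAdeles F) (y : FinAdeles F E) :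
    a • y = (a : FiniteAdeleRing (𝓞 F) F) • y := rfl

theorem mem_hatOrder_of_mem {c : Ideal (𝓞 F)} {x : 𝓞 E} (hx : x ∈ order E c) :
    finEmb F E (algebraMap (𝓞 E) E x) ∈ hatOrder E c :=
  Algebra.subset_adjoin ⟨x, hx, rfl⟩

/-- Together with `exists_smul_mem_hatLattice` this squeezes `𝒪̂_c` between commensurable lattices
`⨁ 𝒪̂_F bᵢ`: the lower one makes it open, the upper one compact. -/
theorem hatLattice_subset_hatOrder {c : Ideal (𝓞 F)}
    (hb : ∀ i, ∃ x ∈ order E c, algebraMap (𝓞 E) E x = b i) :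
    hatLattice b ⊆ hatOrder E c := by
  intro y hy
  rw [← (hatBasis b).sum_equivFun y]
  refine sum_mem fun i _ => ?_
  obtain ⟨x, hx, hxb⟩ := hb i
  rw [hatBasis_apply, ← hxb]
  exact (hatOrder E c).smul_mem (mem_hatOrder_of_mem hx) (⟨_, hy i⟩ : intAdeles F)

theorem hatOrder_le_top (c : Ideal (𝓞 F)) : hatOrder E c ≤ hatOrder E ⊤ :=
  Algebra.adjoin_mono (Set.image_mono (by rw [order_top]; exact Set.subset_univ _))

theorem isOpen_hatOrder {c : Ideal (𝓞 F)} (hc : c ≠ ⊥) :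
    IsOpen (hatOrder E c : Set (FinAdeles F E)) := by
  obtain ⟨b, hb⟩ := exists_basis_mem_order (E := E) hc
  refine (Subalgebra.toSubmodule (hatOrder E c)).toAddSubgroup.isOpen_of_mem_nhds (g := 0) ?_
  refine Filter.mem_of_superset ((isOpen_hatLattice b).mem_nhds fun i => ?_)
    (hatLattice_subset_hatOrder b hb)
  rw [map_zero]
  exact zero_mem _

/-- `𝒪_E` is finitely generated over `𝒪_F`, so one `N` clears the denominators of all coordinates;
the claim passes to the `𝒪̂_F`-span, which is already the generated algebra because the image of
`𝒪_E` is multiplicatively closed. -/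
theorem exists_smul_mem_hatLattice : ∃ N : 𝓞 F, N ≠ 0 ∧ ∀ y ∈ hatOrder E (⊤ : Ideal (𝓞 F)),
    algebraMap F (FiniteAdeleRing (𝓞 F) F) (algebraMap (𝓞 F) F N) • y ∈ hatLattice b := by
  classical
  obtain ⟨s, hs⟩ := Module.Finite.fg_top (R := 𝓞 F) (M := 𝓞 E)
  obtain ⟨N, hN⟩ := IsLocalization.exist_integer_multiples_of_finset (nonZeroDivisors (𝓞 F))
    (s.biUnion fun x => Finset.univ.image fun i => b.repr (algebraMap (𝓞 E) E x) i)
  have h1 : ∀ x : 𝓞 E, ∀ i, ∃ a : 𝓞 F, algebraMap (𝓞 F) F a =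
      algebraMap (𝓞 F) F N * b.repr (algebraMap (𝓞 E) E x) i := fun x i => by
    have hx : x ∈ Submodule.span (𝓞 F) (s : Set (𝓞 E)) := hs ▸ Submodule.mem_top
    induction hx using Submodule.span_induction with
    | mem x hx =>
      obtain ⟨a, ha⟩ := hN (b.repr (algebraMap (𝓞 E) E x) i)
        (Finset.mem_biUnion.2 ⟨x, hx, Finset.mem_image_of_mem _ (Finset.mem_univ i)⟩)
      exact ⟨a, by rw [ha, Algebra.smul_def]⟩
    | zero => exact ⟨0, by simp⟩
    | add x y _ _ hx hy =>
      obtain ⟨a, ha⟩ := hx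
      obtain ⟨a', ha'⟩ := hy
      exact ⟨a + a', by rw [map_add, ha, ha', map_add, map_add, Finsupp.add_apply, mul_add]⟩
    | smul r x _ hx =>
      obtain ⟨a, ha⟩ := hx
      refine ⟨r * a, ?_⟩
      have : algebraMap (𝓞 E) E (r • x) = algebraMap (𝓞 F) F r • algebraMap (𝓞 E) E x := by
        rw [Algebra.smul_def, map_mul, Algebra.smul_def, ← IsScalarTower.algebraMap_apply,
          ← IsScalarTower.algebraMap_apply]
      rw [this, map_smul, Finsupp.smul_apply, map_mul, ha, smul_eq_mul]
      ring
  refine ⟨N, nonZeroDivisors.coe_ne_zero N, fun y hy => ?_⟩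
  have hcl : ((Submonoid.closure ((fun x : 𝓞 E => finEmb F E (algebraMap (𝓞 E) E x)) ''
      order E (⊤ : Ideal (𝓞 F)))) : Set (FinAdeles F E)) ⊆
      Set.range fun x : 𝓞 E => finEmb F E (algebraMap (𝓞 E) E x) := by
    change _ ⊆ (MonoidHom.mrange (((finEmb F E).comp (algebraMap (𝓞 E) E) :
      𝓞 E →+* FinAdeles F E) : 𝓞 E →* FinAdeles F E) : Set (FinAdeles F E))
    rw [SetLike.coe_subset_coe, Submonoid.closure_le]
    rintro _ ⟨x, _, rfl⟩
    exact ⟨x, rfl⟩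
  have hy' : y ∈ Submodule.span (intAdeles F)
      (Set.range fun x : 𝓞 E => finEmb F E (algebraMap (𝓞 E) E x)) := by
    have : y ∈ Subalgebra.toSubmodule (hatOrder E (⊤ : Ideal (𝓞 F))) := hy
    rw [hatOrder, Algebra.adjoin_eq_span] at this
    exact Submodule.span_mono hcl this
  clear hy
  induction hy' using Submodule.span_induction with
  | mem y hy =>
    obtain ⟨x, rfl⟩ := hy
    intro i
    obtain ⟨a, ha⟩ := h1 x i
    rw [map_smul, Pi.smul_apply, Module.Basis.equivFun_apply]
    change _ • (hatBasis b).repr (finEmb F E (algebraMap (𝓞 E) E x)) i ∈ _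
    rw [hatBasis_repr_finEmb, smul_eq_mul, ← map_mul, ← ha]
    exact algebraMap_mem_intAdeles a
  | zero => intro i; rw [smul_zero, map_zero]; exact zero_mem _
  | add x y _ _ hx hy =>
    intro i
    rw [smul_add, map_add]
    exact add_mem (hx i) (hy i)
  | smul r x _ hx =>
    intro i
    rw [smul_def_intAdeles, smul_comm, map_smul]
    exact mul_mem r.2 (hx i)

theorem isCompact_hatOrder {c : Ideal (𝓞 F)} (hc : c ≠ ⊥) :
    IsCompact (hatOrder E c : Set (FinAdeles F E)) := by
  let b := Module.finBasis F E
  obtain ⟨N, hN, h⟩ := exists_smul_mem_hatLattice b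
  have hN' : algebraMap (𝓞 F) F N ≠ 0 := by simpa using hN
  set f := algebraMap F (FiniteAdeleRing (𝓞 F) F)
  have hcont : Continuous fun y : FinAdeles F E => f (algebraMap (𝓞 F) F N)⁻¹ • y :=
    continuous_const_smul _
  have hcl : IsClosed (hatOrder E c : Set (FinAdeles F E)) :=
    (Subalgebra.toSubmodule (hatOrder E c)).toAddSubgroup.isClosed_of_isOpen (isOpen_hatOrder hc)
  refine ((isCompact_hatLattice b).image hcont).of_isClosed_subset hcl fun y hy => ?_
  refine ⟨_, h y (hatOrder_le_top c hy), ?_⟩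
  change f _ • f _ • y = y
  rw [smul_smul, ← map_mul, inv_mul_cancel₀ hN', map_one, one_smul]

theorem isOpen_maxCompact {c : Ideal (𝓞 F)} (hc : c ≠ ⊥) :
    IsOpen (maxCompact E c : Set (TFin F E)) := by
  have h : IsOpen ((hatOrder E c).toSubmonoid.units : Set (FinAdeles F E)ˣ) := by
    have : ((hatOrder E c).toSubmonoid.units : Set (FinAdeles F E)ˣ) =
        (fun u : (FinAdeles F E)ˣ => (u : FinAdeles F E)) ⁻¹' (hatOrder E c) ∩
        (fun u : (FinAdeles F E)ˣ => ((u⁻¹ : (FinAdeles F E)ˣ) : FinAdeles F E)) ⁻¹'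
          (hatOrder E c) := by
      ext u
      exact Submonoid.mem_units_iff _ _
    rw [this]
    exact ((isOpen_hatOrder hc).preimage Units.continuous_val).inter
      ((isOpen_hatOrder hc).preimage Units.continuous_coe_inv)
  exact QuotientGroup.isOpenMap_coe _ h

theorem isCompact_maxCompact {c : Ideal (𝓞 F)} (hc : c ≠ ⊥) :
    IsCompact (maxCompact E c : Set (TFin F E)) := by
  have h : IsCompact ((hatOrder E c).toSubmonoid.units : Set (FinAdeles F E)ˣ) := by
    have : ((hatOrder E c).toSubmonoid.units : Set (FinAdeles F E)ˣ) =
        Units.embedProduct (FinAdeles F E) ⁻¹' ((hatOrder E c : Set (FinAdeles F E)) ×ˢ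
          (MulOpposite.opHomeomorph.symm ⁻¹' (hatOrder E c : Set (FinAdeles F E)))) := by
      ext u
      exact Submonoid.mem_units_iff _ _
    rw [this]
    exact Units.isClosedEmbedding_embedProduct.isCompact_preimage
      ((isCompact_hatOrder hc).prod
        (MulOpposite.opHomeomorph.symm.isCompact_preimage.2 (isCompact_hatOrder hc)))
  exact h.image QuotientGroup.continuous_mk

/-- An element of `E` in the closure of the maximal order at all places is integral. -/
theorem exists_algebraMap_eq_of_finEmb_mem {x : E}
    (hx : finEmb F E x ∈ hatOrder E (⊤ : Ideal (𝓞 F))) : ∃ a : 𝓞 E, algebraMap (𝓞 E) E a = x := by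
  let b := Module.finBasis F E
  obtain ⟨N, hN, h⟩ := exists_smul_mem_hatLattice b
  have hN' : algebraMap (𝓞 F) F N ≠ 0 := by simpa using hN
  -- All of `𝒪_F[x]` lies in this finitely generated module of elements with denominator `N`, so `x`
  -- is integral.
  let M : Submodule (𝓞 F) E := Submodule.span (𝓞 F)
    (Set.range fun i => (algebraMap (𝓞 F) F N)⁻¹ • b i)
  haveI : Module.Finite (𝓞 F) M := Module.Finite.span_of_finite _ (Set.finite_range _)
  have key : ∀ y : E, finEmb F E y ∈ hatOrder E (⊤ : Ideal (𝓞 F)) → y ∈ M := fun y hy => by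
    rw [← b.sum_repr y]
    refine sum_mem fun i _ => ?_
    have h1 := h _ hy i
    rw [map_smul, Pi.smul_apply, Module.Basis.equivFun_apply, hatBasis_repr_finEmb, smul_eq_mul,
      ← map_mul, algebraMap_mem_intAdeles_iff] at h1
    obtain ⟨a, ha⟩ := h1
    have : b.repr y i • b i = a • ((algebraMap (𝓞 F) F N)⁻¹ • b i) := by
      rw [← algebraMap_smul F a, smul_smul, ha, mul_right_comm, mul_inv_cancel₀ hN', one_mul]
    rw [this]
    exact M.smul_mem _ (Submodule.subset_span ⟨i, rfl⟩)
  have hle : Subalgebra.toSubmodule (Algebra.adjoin (𝓞 F) {x}) ≤ M := fun y hy => by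
    refine key y ?_
    change y ∈ Algebra.adjoin (𝓞 F) {x} at hy
    induction hy using Algebra.adjoin_induction with
    | mem y hy => rw [Set.mem_singleton_iff.1 hy]; exact hx
    | algebraMap r =>
      rw [IsScalarTower.algebraMap_apply (𝓞 F) F E, finEmb_algebraMap]
      exact (hatOrder E (⊤ : Ideal (𝓞 F))).algebraMap_mem
        (⟨_, algebraMap_mem_intAdeles r⟩ : intAdeles F)
    | add y z _ _ hy hz => rw [map_add]; exact add_mem hy hz
    | mul y z _ _ hy hz => rw [map_mul]; exact mul_mem hy hz
  have hint : IsIntegral (𝓞 F) x := IsIntegral.of_mem_of_fg (Algebra.adjoin (𝓞 F) {x})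
    (Submodule.FG.of_le (Module.Finite.iff_fg.1 inferInstance) hle) x
    (Algebra.subset_adjoin rfl)
  exact ⟨⟨x, isIntegral_trans (R := ℤ) (A := 𝓞 F) _ hint⟩, rfl⟩

/-! #### Topology of `T(𝔸_F^∞)` -/

instance : Nontrivial (FiniteAdeleRing (𝓞 F) F) := by
  obtain ⟨m, hm⟩ := Ideal.exists_maximal (𝓞 F)
  let v : HeightOneSpectrum (𝓞 F) := ⟨m, hm.isPrime,
    Ring.ne_bot_of_isMaximal_of_not_isField hm (RingOfIntegers.not_isField F)⟩
  exact ⟨⟨0, 1, fun h => zero_ne_one (congrArg (fun a : FiniteAdeleRing (𝓞 F) F => a v) h)⟩⟩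

theorem finEmb_injective : Function.Injective (finEmb F E) := by
  let b := Module.finBasis F E
  intro x y h
  refine b.repr.injective (Finsupp.ext fun i => ?_)
  have := congrArg (fun z => (hatBasis b).repr z i) h
  simp only [hatBasis_repr_finEmb] at this
  exact (algebraMap F (FiniteAdeleRing (𝓞 F) F)).injective this

-- An `F`-linear retraction of `F → E`, extended to the adeles. It detects when an element of `Ê`
-- comes from `𝔸_F^∞`, compatibly with the rational points.
variable (F E) in
theorem exists_retraction : ∃ (l : E →ₗ[F] F)
    (lh : FinAdeles F E →ₗ[FiniteAdeleRing (𝓞 F) F] FiniteAdeleRing (𝓞 F) F),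
    lh 1 = 1 ∧ ∀ x, lh (finEmb F E x) = algebraMap F _ (l x) := by
  obtain ⟨l, hl⟩ := LinearMap.exists_leftInverse_of_injective (Algebra.linearMap F E)
    (LinearMap.ker_eq_bot.2 (algebraMap F E).injective)
  let lh : FiniteAdeleRing (𝓞 F) F ⊗[F] E →ₗ[FiniteAdeleRing (𝓞 F) F] FiniteAdeleRing (𝓞 F) F :=
    (TensorProduct.AlgebraTensorModule.rid F (FiniteAdeleRing (𝓞 F) F)
      (FiniteAdeleRing (𝓞 F) F)).toLinearMap ∘ₗ l.baseChange (FiniteAdeleRing (𝓞 F) F)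
  have h : ∀ x, lh (finEmb F E x) = algebraMap F _ (l x) := fun x => by
    change lh ((1 : FiniteAdeleRing (𝓞 F) F) ⊗ₜ[F] x) = _
    simp [lh, Algebra.algebraMap_eq_smul_one]
  refine ⟨l, lh, ?_, h⟩
  have h1 := h 1
  have h2 : l 1 = 1 := by simpa using LinearMap.congr_fun hl 1
  rw [map_one, h2, map_one] at h1
  exact h1

/-- The image is cut out by the closed condition that the retraction fixes `u`; then the retraction
of `u⁻¹` is the inverse of that of `u`. Closedness makes the quotient `T(𝔸_F^∞)` Hausdorff. -/
theorem isClosed_range_units : IsClosed ((Units.map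
    (algebraMap (FiniteAdeleRing (𝓞 F) F) (FinAdeles F E) :
      FiniteAdeleRing (𝓞 F) F →* FinAdeles F E)).range : Set (FinAdeles F E)ˣ) := by
  obtain ⟨l, lh, h1, -⟩ := exists_retraction F E
  have hlh : Continuous lh := IsModuleTopology.continuous_of_linearMap lh
  have hal : Continuous (algebraMap (FiniteAdeleRing (𝓞 F) F) (FinAdeles F E)) :=
    IsModuleTopology.continuous_of_linearMap (Algebra.linearMap _ (FinAdeles F E))
  have : ((Units.map (algebraMap (FiniteAdeleRing (𝓞 F) F) (FinAdeles F E) :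
      FiniteAdeleRing (𝓞 F) F →* FinAdeles F E)).range : Set (FinAdeles F E)ˣ) =
      {u : (FinAdeles F E)ˣ | algebraMap _ (FinAdeles F E) (lh (u : FinAdeles F E)) = u} := by
    ext u
    constructor
    · rintro ⟨a, rfl⟩
      change algebraMap _ (FinAdeles F E) (lh (algebraMap _ (FinAdeles F E) (a : FiniteAdeleRing (𝓞 F) F))) =
        algebraMap _ (FinAdeles F E) (a : FiniteAdeleRing (𝓞 F) F)
      rw [Algebra.algebraMap_eq_smul_one (a : FiniteAdeleRing (𝓞 F) F), map_smul, h1, smul_eq_mul,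
        mul_one, Algebra.algebraMap_eq_smul_one]
    · intro hu
      have hu : algebraMap _ (FinAdeles F E) (lh (u : FinAdeles F E)) = u := hu
      have hm : lh u * lh ((u⁻¹ : (FinAdeles F E)ˣ) : FinAdeles F E) = 1 := by
        rw [← smul_eq_mul, ← map_smul, Algebra.smul_def, hu, Units.mul_inv, h1]
      exact ⟨⟨lh u, lh ((u⁻¹ : (FinAdeles F E)ˣ) : FinAdeles F E), hm, by rw [mul_comm, hm]⟩,
        Units.ext hu⟩
  rw [this]
  exact isClosed_eq (hal.comp (hlh.comp Units.continuous_val)) Units.continuous_val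

instance : T3Space (TFin F E) :=
  haveI : IsClosed ((Units.map
    (algebraMap (FiniteAdeleRing (𝓞 F) F) (FinAdeles F E) :
      FiniteAdeleRing (𝓞 F) F →* FinAdeles F E)).range : Set (FinAdeles F E)ˣ) :=
    isClosed_range_units
  QuotientGroup.instT3Space _

/-- If `x ∈ Eˣ` becomes a finite idele of `F`, the retraction shows that this idele is the element
`l x` of `F`, so `x` itself lies in `Fˣ`. -/
theorem toFin_injective : Function.Injective (toFin F E) := by
  rw [injective_iff_map_eq_one]
  intro γ hγ
  obtain ⟨x, rfl⟩ := QuotientGroup.mk_surjective γ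
  obtain ⟨a, ha⟩ := (QuotientGroup.eq_one_iff (Units.map (finEmb F E : E →* FinAdeles F E) x)).1 hγ
  obtain ⟨l, lh, h1, h2⟩ := exists_retraction F E
  have ha' : algebraMap _ (FinAdeles F E) (a : FiniteAdeleRing (𝓞 F) F) = finEmb F E x :=
    congrArg Units.val ha
  have h3 : (a : FiniteAdeleRing (𝓞 F) F) = algebraMap F _ (l x) := by
    rw [← h2, ← ha', Algebra.algebraMap_eq_smul_one (a : FiniteAdeleRing (𝓞 F) F), map_smul, h1,
      smul_eq_mul, mul_one]
  rw [h3, ← finEmb_algebraMap] at ha'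
  have hx := finEmb_injective ha'
  have hl : l x ≠ 0 := fun h => x.ne_zero (by rw [← hx, h, map_zero])
  exact (QuotientGroup.eq_one_iff x).2 ⟨Units.mk0 _ hl, Units.ext hx⟩

theorem diag_injective : Function.Injective (diag F E) := fun _ _ h =>
  toFin_injective (congrArg Prod.snd h)

instance : Countable (TRat F E) := by
  haveI : Countable E := by
    exact (Module.finBasis ℚ E).equivFun.toEquiv.countable_iff.2 inferInstance
  haveI : Countable Eˣ := Units.val_injective.countable
  exact (QuotientGroup.mk_surjective
    (s := (Units.map (algebraMap F E : F →* E)).range)).countable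

end FiniteAdelesE


/-! ### Finiteness of `Cl(T)_+` -/

section ClassNumber

variable {F E : Type} [Field F] [NumberField F] [Field E] [NumberField E] [Algebra F E]

theorem algebraMap_smul_mem_hatOrder (c : Ideal (𝓞 F)) (a : 𝓞 F) {y : FinAdeles F E}
    (hy : y ∈ hatOrder E c) :
    finEmb F E (algebraMap F E (algebraMap (𝓞 F) F a)) * y ∈ hatOrder E c := by
  rw [finEmb_algebraMap, ← Algebra.smul_def]
  exact (hatOrder E c).smul_mem hy (⟨_, algebraMap_mem_intAdeles a⟩ : intAdeles F)

/-- The element of `Ê` defined by an element of `𝒪_F`. -/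
def finInt (E : Type) [Field E] [NumberField E] [Algebra F E] (N : 𝓞 F) : FinAdeles F E :=
  finEmb F E (algebraMap F E (algebraMap (𝓞 F) F N))

theorem finInt_mul (M N : 𝓞 F) : finInt E (M * N) = finInt E M * finInt E N := by
  simp only [finInt, map_mul]

theorem exists_finInt_mul_mem {c : Ideal (𝓞 F)} (hc : c ≠ ⊥) (y : FinAdeles F E) :
    ∃ N : 𝓞 F, N ≠ 0 ∧ finInt E N * y ∈ hatOrder E c := by
  classical
  obtain ⟨b, hb⟩ := exists_basis_mem_order (E := E) hc
  choose N hN0 hN using fun i => exists_mul_mem_intAdeles ((hatBasis b).equivFun y i)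
  refine ⟨∏ i, N i, Finset.prod_ne_zero_iff.2 fun i _ => hN0 i,
    hatLattice_subset_hatOrder b hb fun i => ?_⟩
  rw [finInt, finEmb_algebraMap, ← Algebra.smul_def, map_smul, Pi.smul_apply, smul_eq_mul,
    ← Finset.mul_prod_erase _ _ (Finset.mem_univ i), map_mul, map_mul, mul_right_comm]
  exact mul_mem (hN i) (algebraMap_mem_intAdeles _)

/-- Strong approximation for `F`, applied to each coordinate in a basis contained in `𝒪_c`. -/
theorem exists_eq_finEmb_add {c : Ideal (𝓞 F)} (hc : c ≠ ⊥) (y : FinAdeles F E) {N : 𝓞 F}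
    (hN : N ≠ 0) : ∃ e : E, ∃ r ∈ hatOrder E c, y = finEmb F E e + finInt E N * r := by
  classical
  obtain ⟨b, hb⟩ := exists_basis_mem_order (E := E) hc
  choose x a ha hxa using fun i => exists_eq_algebraMap_add ((hatBasis b).equivFun y i) hN
  refine ⟨∑ i, x i • b i, ∑ i, a i • hatBasis b i, ?_, ?_⟩
  · refine sum_mem fun i _ => ?_
    obtain ⟨z, hz, hzb⟩ := hb i
    rw [hatBasis_apply, ← hzb]
    exact (hatOrder E c).smul_mem (mem_hatOrder_of_mem hz) (⟨_, ha i⟩ : intAdeles F)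
  · conv_lhs => rw [← (hatBasis b).sum_equivFun y]
    rw [map_sum, Finset.mul_sum, ← Finset.sum_add_distrib]
    refine Finset.sum_congr rfl fun i _ => ?_
    rw [hxa i, add_smul, mul_smul, hatBasis_apply, finInt, finEmb_algebraMap, ← Algebra.smul_def]
    congr 1
    rw [Algebra.smul_def (x i), map_mul, finEmb_algebraMap, ← Algebra.smul_def]

/-- The fractional ideal `E ∩ a 𝒪̂_E` as a submodule. -/
def idealOf (a : (FinAdeles F E)ˣ) : Submodule (𝓞 E) E where
  carrier := {x | finEmb F E x * ((a⁻¹ : (FinAdeles F E)ˣ) : FinAdeles F E) ∈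
    hatOrder E (⊤ : Ideal (𝓞 F))}
  add_mem' {x y} hx hy := by
    change finEmb F E (x + y) * ((a⁻¹ : (FinAdeles F E)ˣ) : FinAdeles F E) ∈ hatOrder E (⊤ : Ideal (𝓞 F))
    rw [map_add, add_mul]
    exact add_mem hx hy
  zero_mem' := by
    change finEmb F E 0 * ((a⁻¹ : (FinAdeles F E)ˣ) : FinAdeles F E) ∈ hatOrder E (⊤ : Ideal (𝓞 F))
    rw [map_zero, zero_mul]
    exact zero_mem _
  smul_mem' r x hx := by
    change finEmb F E (r • x) * ((a⁻¹ : (FinAdeles F E)ˣ) : FinAdeles F E) ∈ hatOrder E (⊤ : Ideal (𝓞 F))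
    rw [Algebra.smul_def, map_mul, mul_assoc]
    exact mul_mem (mem_hatOrder_of_mem (by rw [order_top]; exact Set.mem_univ _)) hx

theorem mem_idealOf {a : (FinAdeles F E)ˣ} {x : E} : x ∈ idealOf a ↔
    finEmb F E x * ((a⁻¹ : (FinAdeles F E)ˣ) : FinAdeles F E) ∈ hatOrder E (⊤ : Ideal (𝓞 F)) :=
  Iff.rfl

theorem top_ne_bot' : (⊤ : Ideal (𝓞 F)) ≠ ⊥ := top_ne_bot

theorem isFractional_idealOf (a : (FinAdeles F E)ˣ) :
    IsFractional (nonZeroDivisors (𝓞 E)) (idealOf a) := by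
  obtain ⟨N, hN, h⟩ := exists_finInt_mul_mem top_ne_bot' (a : FinAdeles F E)
  have hN' : algebraMap (𝓞 F) (𝓞 E) N ≠ 0 :=
    (map_ne_zero_iff _ (FaithfulSMul.algebraMap_injective (𝓞 F) (𝓞 E))).2 hN
  refine ⟨algebraMap (𝓞 F) (𝓞 E) N, mem_nonZeroDivisors_of_ne_zero hN', fun x hx => ?_⟩
  · refine exists_algebraMap_eq_of_finEmb_mem (F := F) ?_
    have : finEmb F E (algebraMap (𝓞 F) (𝓞 E) N • x) =
        (finEmb F E x * ((a⁻¹ : (FinAdeles F E)ˣ) : FinAdeles F E)) * (finInt E N * a) := by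
      rw [Algebra.smul_def, map_mul, ← IsScalarTower.algebraMap_apply,
        IsScalarTower.algebraMap_apply (𝓞 F) F E]
      change finInt E N * _ = _
      linear_combination (-1 : FinAdeles F E) * finInt E N * finEmb F E x * a.inv_mul
    rw [this]
    exact mul_mem hx h

theorem idealOf_ne_bot (a : (FinAdeles F E)ˣ) : idealOf a ≠ ⊥ := by
  obtain ⟨N, hN, h⟩ := exists_finInt_mul_mem top_ne_bot'
    ((a⁻¹ : (FinAdeles F E)ˣ) : FinAdeles F E)
  intro h0
  have : algebraMap F E (algebraMap (𝓞 F) F N) ∈ idealOf a := h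
  rw [h0, Submodule.mem_bot] at this
  simp at this
  exact hN this

/-- `E ∩ a 𝒪̂_E` as an invertible fractional ideal. -/
def fracIdealOf (a : (FinAdeles F E)ˣ) : (FractionalIdeal (nonZeroDivisors (𝓞 E)) E)ˣ :=
  Units.mk0 ⟨idealOf a, isFractional_idealOf a⟩ fun h => idealOf_ne_bot a (by
    have := congrArg (fun I : FractionalIdeal (nonZeroDivisors (𝓞 E)) E => (I : Submodule (𝓞 E) E)) h
    simpa using this)

/-- An element `e ∈ E` sufficiently close to `a` lies in `E ∩ a 𝒪̂_E`, hence in `a' 𝒪̂_E`, and the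
error is small enough to stay integral after multiplication by `a'⁻¹`. Thus the global ideal
determines the idele up to `𝒪̂_Eˣ`. -/
theorem mem_hatOrder_of_idealOf_le {a a' : (FinAdeles F E)ˣ} (h : idealOf a ≤ idealOf a') :
    (a : FinAdeles F E) * ((a'⁻¹ : (FinAdeles F E)ˣ) : FinAdeles F E) ∈
      hatOrder E (⊤ : Ideal (𝓞 F)) := by
  obtain ⟨N, hN0, hN⟩ := exists_finInt_mul_mem top_ne_bot'
    ((a⁻¹ : (FinAdeles F E)ˣ) : FinAdeles F E)
  obtain ⟨M, hM0, hM⟩ := exists_finInt_mul_mem top_ne_bot'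
    ((a'⁻¹ : (FinAdeles F E)ˣ) : FinAdeles F E)
  obtain ⟨e, r, hr, har⟩ := exists_eq_finEmb_add top_ne_bot' (a : FinAdeles F E)
    (mul_ne_zero hN0 hM0)
  rw [finInt_mul] at har
  have he : e ∈ idealOf a := by
    rw [mem_idealOf]
    have : finEmb F E e * ((a⁻¹ : (FinAdeles F E)ˣ) : FinAdeles F E) =
        1 - finInt E M * (r * (finInt E N * ((a⁻¹ : (FinAdeles F E)ˣ) : FinAdeles F E))) := by
      linear_combination a.mul_inv - ((a⁻¹ : (FinAdeles F E)ˣ) : FinAdeles F E) * har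
    rw [this]
    exact sub_mem (one_mem _) (algebraMap_smul_mem_hatOrder _ _ (mul_mem hr hN))
  have he' := mem_idealOf.1 (h he)
  have : (a : FinAdeles F E) * ((a'⁻¹ : (FinAdeles F E)ˣ) : FinAdeles F E) =
      finEmb F E e * ((a'⁻¹ : (FinAdeles F E)ˣ) : FinAdeles F E) +
        finInt E N * (r * (finInt E M * ((a'⁻¹ : (FinAdeles F E)ˣ) : FinAdeles F E))) := by
    linear_combination ((a'⁻¹ : (FinAdeles F E)ˣ) : FinAdeles F E) * har
  rw [this]
  exact add_mem he' (algebraMap_smul_mem_hatOrder _ _ (mul_mem hr hM))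

variable (F E) in
/-- The subgroup `Eˣ 𝒪̂_Eˣ` of `Êˣ`. -/
def principalUnits : Subgroup (FinAdeles F E)ˣ :=
  (Units.map (finEmb F E : E →* FinAdeles F E)).range ⊔
    (hatOrder E (⊤ : Ideal (𝓞 F))).toSubmonoid.units

/-- The ideal `E ∩ a 𝒪̂_E` embeds this quotient into the ideal class group of `E`: if two ideals
differ by a principal one, the ideles differ by an element of `Eˣ` and a unit. -/
theorem finite_quotient_principalUnits : Finite ((FinAdeles F E)ˣ ⧸ principalUnits F E) := by
  haveI : Finite ((FractionalIdeal (nonZeroDivisors (𝓞 E)) E)ˣ ⧸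
      (toPrincipalIdeal (𝓞 E) E).range) :=
    Finite.of_equiv _ (ClassGroup.equiv (R := 𝓞 E) E).toEquiv
  refine Finite.of_injective (β := (FractionalIdeal (nonZeroDivisors (𝓞 E)) E)ˣ ⧸
    (toPrincipalIdeal (𝓞 E) E).range)
    (fun q => QuotientGroup.mk (fracIdealOf q.out)) fun q q' h => ?_
  obtain ⟨x, hx⟩ := QuotientGroup.eq.1 h
  rw [← QuotientGroup.out_eq' q, ← QuotientGroup.out_eq' q']
  set a := q.out
  set a' := q'.out
  let X : (FinAdeles F E)ˣ := Units.map (finEmb F E : E →* FinAdeles F E) x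
  have h1 : fracIdealOf a' = toPrincipalIdeal (𝓞 E) E x * fracIdealOf a := by
    rw [hx, mul_right_comm, inv_mul_cancel, one_mul]
  have h2 : ∀ y, y ∈ idealOf a' ↔ ∃ z ∈ idealOf a, (x : E) * z = y := fun y => by
    have := congrArg (fun I : (FractionalIdeal (nonZeroDivisors (𝓞 E)) E)ˣ =>
      y ∈ (I : FractionalIdeal (nonZeroDivisors (𝓞 E)) E)) h1
    simp only [Units.val_mul, coe_toPrincipalIdeal, FractionalIdeal.mem_singleton_mul] at this
    refine (iff_of_eq this).trans ?_
    constructor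
    · rintro ⟨z, hz, rfl⟩; exact ⟨z, hz, rfl⟩
    · rintro ⟨z, hz, rfl⟩; exact ⟨z, hz, rfl⟩
  have h3 : idealOf a' = idealOf (X * a) := by
    ext y
    rw [h2, mem_idealOf, mul_inv_rev, Units.val_mul]
    have hX : ((X⁻¹ : (FinAdeles F E)ˣ) : FinAdeles F E) = finEmb F E (x : E)⁻¹ := by
      rw [← Units.val_inv_eq_inv_val]; rfl
    rw [hX]
    constructor
    · rintro ⟨z, hz, rfl⟩
      rw [mem_idealOf] at hz
      convert hz using 1
      rw [mul_comm _ (finEmb F E (x : E)⁻¹), ← mul_assoc, ← map_mul]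
      congr 2
      field_simp
    · intro hy
      refine ⟨(x : E)⁻¹ * y, ?_, by field_simp⟩
      rw [mem_idealOf, map_mul]
      convert hy using 1
      ring
  have h4 := mem_hatOrder_of_idealOf_le h3.le
  have h5 := mem_hatOrder_of_idealOf_le h3.ge
  rw [QuotientGroup.eq]
  have h6 : a' * (X * a)⁻¹ ∈ (hatOrder E (⊤ : Ideal (𝓞 F))).toSubmonoid.units := by
    rw [Submonoid.mem_units_iff]
    refine ⟨h4, ?_⟩
    rw [mul_inv_rev, inv_inv]
    exact h5
  have h7 : a⁻¹ * a' = X * (a' * (X * a)⁻¹) := by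
    rw [mul_inv_rev, mul_comm a⁻¹ X⁻¹, mul_left_comm X, mul_inv_cancel_left, mul_comm]
  rw [h7]
  exact mul_mem (Subgroup.mem_sup_left ⟨x, rfl⟩) (Subgroup.mem_sup_right h6)

theorem maxCompact_le_top (c : Ideal (𝓞 F)) : maxCompact E c ≤ maxCompact E ⊤ :=
  Subgroup.map_mono fun u hu => by
    rw [Submonoid.mem_units_iff] at hu ⊢
    exact ⟨hatOrder_le_top c hu.1, hatOrder_le_top c hu.2⟩

theorem isOpen_maxCompact_sup {c : Ideal (𝓞 F)} (hc : c ≠ ⊥) :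
    IsOpen (maxCompact E c ⊔ (ratPos E).map (toFin F E) : Subgroup (TFin F E)).carrier :=
  Subgroup.isOpen_mono le_sup_left (isOpen_maxCompact hc)

/-- A finite idele of `E` is a product `o · x · u` with `o` from a finite set, `x ∈ Eˣ` and `u ∈
𝒪̂_Eˣ`. Modulo `T(F)_+` the factor `x` takes finitely many values, by the component of its image in
`T(F_∞)`; so does `u` modulo the open subgroup `U`, by compactness. -/
theorem finite_ClPos (L : SplitPlaces F E) (hE : Module.finrank F E = 2) {c : Ideal (𝓞 F)}
    (hc : c ≠ ⊥) : Finite (ClPos E c) := by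
  haveI := L.finite_quotient_infPos hE
  haveI := finite_quotient_principalUnits (F := F) (E := E)
  haveI : DiscreteTopology (ClPos E c) :=
    QuotientGroup.discreteTopology (isOpen_maxCompact_sup hc)
  choose γ hγ using fun z : TInf F E ⧸ infPos F E => exists_toInf_mem z.out
  let π : TFin F E →* ClPos E c := QuotientGroup.mk' _
  have hK : (π '' (maxCompact E (⊤ : Ideal (𝓞 F)) : Set (TFin F E))).Finite :=
    ((isCompact_maxCompact top_ne_bot').image QuotientGroup.continuous_mk).finite_of_discrete
  let ψ : (TInf F E ⧸ infPos F E) × ((FinAdeles F E)ˣ ⧸ principalUnits F E) ×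
      (π '' (maxCompact E (⊤ : Ideal (𝓞 F)) : Set (TFin F E))) → ClPos E c := fun p =>
    π (toFin F E (γ p.1)) * π (QuotientGroup.mk p.2.1.out) * p.2.2
  haveI := hK.to_subtype
  refine Finite.of_surjective ψ fun x => ?_
  obtain ⟨t, rfl⟩ := QuotientGroup.mk_surjective x
  obtain ⟨a, rfl⟩ := QuotientGroup.mk_surjective t
  have h1 : (QuotientGroup.mk a : (FinAdeles F E)ˣ ⧸ principalUnits F E).out⁻¹ * a ∈
      principalUnits F E := QuotientGroup.eq.1 (QuotientGroup.out_eq' _)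
  obtain ⟨_, ⟨x, rfl⟩, u, hu, hxu⟩ := Subgroup.mem_sup.1 h1
  let δ : TRat F E := QuotientGroup.mk x
  let z : TInf F E ⧸ infPos F E := QuotientGroup.mk (toInf F E δ)
  have hδ : (γ z)⁻¹ * δ ∈ ratPos E := by
    have h2 : z.out⁻¹ * toInf F E δ ∈ infPos F E := QuotientGroup.eq.1 (QuotientGroup.out_eq' _)
    have h3 := mul_mem (inv_mem (hγ z)) h2
    change toInf F E _ ∈ infPos F E
    rwa [mul_inv_rev, inv_inv, mul_assoc, mul_inv_cancel_left, ← map_inv, ← map_mul] at h3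
  refine ⟨⟨z, QuotientGroup.mk a, ⟨_, QuotientGroup.mk u, ⟨u, hu, rfl⟩, rfl⟩⟩, ?_⟩
  have h4 : π (toFin F E (γ z)) = π (toFin F E δ) :=
    QuotientGroup.eq.2 (Subgroup.mem_sup_right ⟨_, hδ, by rw [map_mul, map_inv]⟩)
  let m : (FinAdeles F E)ˣ →* TFin F E := QuotientGroup.mk' _
  set o := (QuotientGroup.mk a : (FinAdeles F E)ˣ ⧸ principalUnits F E).out
  change π (toFin F E (γ z)) * π (m o) * π (m u) = π (m a)
  have h5 : toFin F E δ = m (Units.map (finEmb F E : E →* FinAdeles F E) x) := rfl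
  rw [h4, h5, ← map_mul π, ← map_mul π, ← map_mul m, ← map_mul m]
  congr 2
  rw [mul_comm _ o, mul_assoc, hxu, mul_inv_cancel_left]

end ClassNumber


/-! ### The lattice of logarithms of `T(𝒪_F)_+` -/

section UnitLattice

variable {F E : Type} [Field F] [NumberField F] [Field E] [NumberField E] [Algebra F E]

/-- The automorphism `id ⊗ g` of `Ê = 𝔸_F^∞ ⊗ E`. -/
def finConj (g : Gal(E/F)) : FinAdeles F E →ₐ[FiniteAdeleRing (𝓞 F) F] FinAdeles F E :=
  (Algebra.TensorProduct.map (AlgHom.id (FiniteAdeleRing (𝓞 F) F) (FiniteAdeleRing (𝓞 F) F))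
    (g : E →ₐ[F] E) : FiniteAdeleRing (𝓞 F) F ⊗[F] E →ₐ[FiniteAdeleRing (𝓞 F) F]
      FiniteAdeleRing (𝓞 F) F ⊗[F] E)

theorem finConj_finEmb (g : Gal(E/F)) (x : E) : finConj g (finEmb F E x) = finEmb F E (g x) := by
  change Algebra.TensorProduct.map _ _ ((1 : FiniteAdeleRing (𝓞 F) F) ⊗ₜ[F] x) =
    (1 : FiniteAdeleRing (𝓞 F) F) ⊗ₜ[F] (g x)
  rw [Algebra.TensorProduct.map_tmul]
  rfl

theorem finConj_mem_hatOrder (g : Gal(E/F)) {y : FinAdeles F E}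
    (hy : y ∈ hatOrder E (⊤ : Ideal (𝓞 F))) : finConj g y ∈ hatOrder E (⊤ : Ideal (𝓞 F)) := by
  induction hy using Algebra.adjoin_induction with
  | mem y hy =>
    obtain ⟨x, -, rfl⟩ := hy
    change finConj g (finEmb F E x) ∈ _
    rw [finConj_finEmb]
    have : g (x : E) = ((RingOfIntegers.mapRingEquiv (g : E ≃+* E) x : 𝓞 E) : E) := rfl
    rw [this]
    exact mem_hatOrder_of_mem (by rw [order_top]; exact Set.mem_univ _)
  | algebraMap a =>
    change finConj g (algebraMap (FiniteAdeleRing (𝓞 F) F) (FinAdeles F E) a.1) ∈ _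
    rw [AlgHom.commutes]
    exact (hatOrder E (⊤ : Ideal (𝓞 F))).algebraMap_mem a
  | add x y _ _ hx hy => rw [map_add]; exact add_mem hx hy
  | mul x y _ _ hx hy => rw [map_mul]; exact mul_mem hx hy

theorem norm_algebraMap_apply (x : E) (w : InfinitePlace E) :
    ‖algebraMap E (InfiniteAdeleRing E) x w‖ = w x := by
  rw [InfiniteAdeleRing.algebraMap_apply]
  exact InfinitePlace.Completion.norm_coe w _

theorem SplitPlaces.logVec_toInf_mk (L : SplitPlaces F E) (x : Eˣ) (i : Fin L.u) :
    L.logVec (toInf F E (QuotientGroup.mk x)) i =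
      Real.log (L.w i (x : E)) - Real.log (L.w' i (x : E)) := by
  change Real.log ‖algebraMap E (InfiniteAdeleRing E) x (L.w i)‖ -
    Real.log ‖algebraMap E (InfiniteAdeleRing E) x (L.w' i)‖ = _
  rw [norm_algebraMap_apply, norm_algebraMap_apply]

/-- Locally `x = v a` with `v ∈ 𝒪̂_Eˣ` and `a` a finite idele of `F`; `g` fixes `a`, so `x / g x = v
/ g v` is everywhere integral. -/
theorem exists_integer_eq_div (g : Gal(E/F)) {x : Eˣ}
    (hx : toFin F E (QuotientGroup.mk x) ∈ maxCompact E (⊤ : Ideal (𝓞 F))) :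
    ∃ a : 𝓞 E, algebraMap (𝓞 E) E a = (x : E) / g x := by
  obtain ⟨v, hv, hvx⟩ := hx
  obtain ⟨a, ha⟩ := QuotientGroup.eq.1 hvx
  rw [SetLike.mem_coe, Submonoid.mem_units_iff] at hv
  refine exists_algebraMap_eq_of_finEmb_mem (F := F) ?_
  have h1 : finEmb F E x = v * algebraMap (FiniteAdeleRing (𝓞 F) F) (FinAdeles F E) a := by
    have : Units.map (finEmb F E : E →* FinAdeles F E) x = v *
        Units.map (algebraMap (FiniteAdeleRing (𝓞 F) F) (FinAdeles F E) :
          FiniteAdeleRing (𝓞 F) F →* FinAdeles F E) a := by rw [ha, mul_inv_cancel_left]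
    exact congrArg Units.val this
  have h2 : finEmb F E (g x) =
      finConj g v * algebraMap (FiniteAdeleRing (𝓞 F) F) (FinAdeles F E) a := by
    rw [← finConj_finEmb, h1, map_mul, AlgHom.commutes]
  have hgx : g (x : E) ≠ 0 := (map_ne_zero g).2 x.ne_zero
  have h3 : finEmb F E (g x)⁻¹ * finEmb F E (g x) = 1 := by
    rw [← map_mul, inv_mul_cancel₀ hgx, map_one]
  have h4 : finConj g (v : FinAdeles F E) * finConj g ((v⁻¹ : (FinAdeles F E)ˣ) : FinAdeles F E)
      = 1 := by rw [← map_mul, Units.mul_inv, map_one]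
  have h5 : finEmb F E ((x : E) / g x) =
      (v : FinAdeles F E) * finConj g ((v⁻¹ : (FinAdeles F E)ˣ) : FinAdeles F E) := by
    rw [div_eq_mul_inv, map_mul]
    rw [h1]
    rw [h2] at h3
    set A := algebraMap (FiniteAdeleRing (𝓞 F) F) (FinAdeles F E) a
    linear_combination (v : FinAdeles F E) *
      finConj g ((v⁻¹ : (FinAdeles F E)ˣ) : FinAdeles F E) * h3 -
      (v : FinAdeles F E) * finEmb F E (g x)⁻¹ * A * h4
  rw [h5]
  exact mul_mem hv.1 (finConj_mem_hatOrder g hv.2)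

theorem exists_gal_ne_one (hE : Module.finrank F E = 2) :
    ∃ g : Gal(E/F), g ≠ 1 ∧ ∀ k : Gal(E/F), k = 1 ∨ k = g := by
  haveI := isGalois_of_finrank_eq_two hE
  have hc : Nat.card Gal(E/F) = 2 := (IsGalois.card_aut_eq_finrank F E).trans hE
  obtain ⟨a, b, hab, hu⟩ := Nat.card_eq_two_iff.1 hc
  have h1 : ∀ x : Gal(E/F), x = a ∨ x = b := fun x => by
    have : x ∈ ({a, b} : Set _) := hu ▸ Set.mem_univ x
    simpa using this
  rcases h1 1 with h | h
  · exact ⟨b, fun hb => hab (h.symm.trans hb.symm), fun k => h ▸ h1 k⟩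
  · exact ⟨a, fun ha => hab (ha.trans h), fun k => h ▸ (h1 k).symm⟩

/-- The quotient is `w(x) / w'(x)` with `w'` conjugate to `w`. It is `1` if `w' = w`; otherwise the
place below splits, and the logarithm of the quotient is plus or minus the coordinate of `logVec`.
-/
theorem SplitPlaces.apply_div_le (L : SplitPlaces F E) (hE : Module.finrank F E = 2)
    (g : Gal(E/F)) (x : Eˣ) {R : ℝ} (hR : 0 ≤ R)
    (hx : ∀ i, |L.logVec (toInf F E (QuotientGroup.mk x)) i| ≤ R) (w : InfinitePlace E) :
    w ((x : E) / g x) ≤ Real.exp R := by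
  have hp : ∀ v : InfinitePlace E, 0 < v (x : E) := fun v => InfinitePlace.pos_iff.2 x.ne_zero
  have h1 : w (g x) = (g.symm • w) (x : E) := rfl
  rw [map_div₀, h1]
  by_cases hw : g.symm • w = w
  · rw [hw, div_self (hp w).ne']
    exact Real.one_le_exp hR
  · have hcomap : (g.symm • w).comap (algebraMap F E) = w.comap (algebraMap F E) :=
      haveI := isGalois_of_finrank_eq_two hE
      (InfinitePlace.mem_orbit_iff.1 ⟨g.symm, rfl⟩).symm
    have : w.comap (algebraMap F E) ∈ Set.range L.σ := by
      rw [L.range_σ]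
      exact ⟨_, _, hw, hcomap, rfl⟩
    obtain ⟨i, hi⟩ := this
    have h2 := hx i
    rw [L.logVec_toInf_mk, ← Real.log_div (hp _).ne' (hp _).ne'] at h2
    have h3 : w (x : E) / (g.symm • w) (x : E) ≤ Real.exp |Real.log (L.w i (x : E) / L.w' i (x : E))| := by
      rw [← Real.log_le_iff_le_exp (div_pos (hp _) (hp _))]
      rcases place_eq_or_eq hE (L.w_ne i) ((L.comap_w i).trans (L.comap_w' i).symm)
        ((L.comap_w i).trans hi) with e | e <;>
      rcases place_eq_or_eq hE (L.w_ne i) ((L.comap_w i).trans (L.comap_w' i).symm)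
        ((L.comap_w i).trans (hi.trans hcomap.symm)) with e' | e'
      · exact absurd (e'.trans e.symm) hw
      · rw [e, ← e, e', e]; exact le_abs_self _
      · rw [e', e, ← inv_div, Real.log_inv]; exact neg_le_abs _
      · exact absurd (e'.trans e.symm) hw
    exact h3.trans (Real.exp_le_exp.2 h2)

/-- The hypothesis says that `y / x` is fixed by `g`, hence by the whole Galois group, so it lies in
`Fˣ`. -/
theorem mk_eq_of_div_eq (hE : Module.finrank F E = 2) {g : Gal(E/F)}
    (hg : ∀ k : Gal(E/F), k = 1 ∨ k = g) {x y : Eˣ} (h : (x : E) / g x = (y : E) / g y) :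
    (QuotientGroup.mk x : TRat F E) = QuotientGroup.mk y := by
  haveI := isGalois_of_finrank_eq_two hE
  have hgx : g (x : E) ≠ 0 := (map_ne_zero g).2 x.ne_zero
  have hgy : g (y : E) ≠ 0 := (map_ne_zero g).2 y.ne_zero
  have h1 : ((x⁻¹ * y : Eˣ) : E) ∈ Set.range (algebraMap F E) := by
    rw [IsGalois.mem_range_algebraMap_iff_fixed]
    intro k
    rcases hg k with rfl | rfl
    · rfl
    · rw [Units.val_mul, map_mul, Units.val_inv_eq_inv_val, map_inv₀]
      have := x.ne_zero
      field_simp at h ⊢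
      exact h
  obtain ⟨z, hz⟩ := h1
  have hz0 : z ≠ 0 := by rintro rfl; rw [map_zero] at hz; exact (x⁻¹ * y).ne_zero hz.symm
  exact QuotientGroup.eq.2 ⟨Units.mk0 z hz0, Units.ext hz⟩

/-- The map `x ↦ x / g x` is injective on `Eˣ/Fˣ` and sends the set to algebraic integers whose
conjugates are bounded by `e^R`, of which there are finitely many. -/
theorem finite_logVec_le (L : SplitPlaces F E) (hE : Module.finrank F E = 2) (c : Ideal (𝓞 F))
    {R : ℝ} (hR : 0 ≤ R) :
    {γ : TRat F E | γ ∈ unitsPos E c ∧ ∀ i, |L.logVec (toInf F E γ) i| ≤ R}.Finite := by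
  obtain ⟨g, -, hg⟩ := exists_gal_ne_one hE
  have hf := Embeddings.finite_of_norm_le E ℂ (Real.exp R)
  refine Set.Finite.of_finite_image (f := fun γ : TRat F E =>
    ((Quotient.out γ : Eˣ) : E) / g (Quotient.out γ : Eˣ)) (hf.subset ?_) ?_
  · rintro _ ⟨γ, ⟨hγ, hγR⟩, rfl⟩
    have e : (QuotientGroup.mk (Quotient.out γ : Eˣ) : TRat F E) = γ := QuotientGroup.out_eq' γ
    obtain ⟨a, ha⟩ := exists_integer_eq_div g (x := (Quotient.out γ : Eˣ))
      (by rw [e]; exact maxCompact_le_top c hγ.2)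
    refine ⟨?_, fun φ => ?_⟩
    · change IsIntegral ℤ (((Quotient.out γ : Eˣ) : E) / g (Quotient.out γ : Eˣ))
      rw [← ha]; exact a.2
    · have := L.apply_div_le hE g (Quotient.out γ : Eˣ) hR (by rwa [e]) (InfinitePlace.mk φ)
      rwa [InfinitePlace.apply] at this
  · intro γ _ γ' _ h
    exact (QuotientGroup.out_eq' γ).symm.trans
      ((mk_eq_of_div_eq hE hg h).trans (QuotientGroup.out_eq' γ'))

/-- Both `T(F_∞)/T(F_∞)_+` and the image of the compact group of conductor `1` modulo the open
subgroup `U` are finite. -/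
theorem exists_pow_mem_unitsPos (L : SplitPlaces F E) (hE : Module.finrank F E = 2)
    {c : Ideal (𝓞 F)} (hc : c ≠ ⊥) {γ : TRat F E}
    (hγ : toFin F E γ ∈ maxCompact E (⊤ : Ideal (𝓞 F))) :
    ∃ n : ℕ, 0 < n ∧ γ ^ n ∈ unitsPos E c := by
  haveI := L.finite_quotient_infPos hE
  haveI : DiscreteTopology (TFin F E ⧸ maxCompact E c) :=
    QuotientGroup.discreteTopology (isOpen_maxCompact hc)
  let π : TFin F E →* TFin F E ⧸ maxCompact E c := QuotientGroup.mk' _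
  have h1 : (π '' (maxCompact E (⊤ : Ideal (𝓞 F)) : Set (TFin F E))).Finite :=
    ((isCompact_maxCompact top_ne_bot').image QuotientGroup.continuous_mk).finite_of_discrete
  have h2 : IsOfFinOrder (π (toFin F E γ)) := by
    rw [← finite_powers]
    refine h1.subset ?_
    rintro _ ⟨n, rfl⟩
    exact ⟨toFin F E γ ^ n, pow_mem hγ n, map_pow _ _ _⟩
  have h3 : IsOfFinOrder (QuotientGroup.mk' (infPos F E) (toInf F E γ)) := isOfFinOrder_of_finite _
  obtain ⟨m, hm, hm'⟩ := h2.exists_pow_eq_one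
  obtain ⟨n, hn, hn'⟩ := h3.exists_pow_eq_one
  refine ⟨m * n, Nat.mul_pos hm hn, ?_, ?_⟩
  · change toInf F E (γ ^ (m * n)) ∈ infPos F E
    rw [← QuotientGroup.eq_one_iff, map_pow, mul_comm, pow_mul]
    change QuotientGroup.mk' (infPos F E) _ = 1
    rw [map_pow, map_pow, hn', one_pow]
  · change toFin F E (γ ^ (m * n)) ∈ maxCompact E c
    rw [← QuotientGroup.eq_one_iff, map_pow, pow_mul]
    change π _ = 1
    rw [map_pow, map_pow, hm', one_pow]

theorem toFin_unit_mem (u : (𝓞 E)ˣ) :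
    toFin F E (QuotientGroup.mk (Units.map (algebraMap (𝓞 E) E : 𝓞 E →* E) u)) ∈
      maxCompact E (⊤ : Ideal (𝓞 F)) := by
  refine ⟨Units.map (finEmb F E : E →* FinAdeles F E)
    (Units.map (algebraMap (𝓞 E) E : 𝓞 E →* E) u), ?_, rfl⟩
  have h : ∀ x : 𝓞 E, finEmb F E (algebraMap (𝓞 E) E x) ∈ hatOrder E (⊤ : Ideal (𝓞 F)) := fun x =>
    mem_hatOrder_of_mem (by rw [order_top]; exact Set.mem_univ _)
  exact (Submonoid.mem_units_iff _ _).2 ⟨h u, h (u⁻¹ : (𝓞 E)ˣ)⟩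

/-- `unitLog` as a homomorphism. -/
def unitLogHom (L : SplitPlaces F E) (c : Ideal (𝓞 F)) :
    Additive (unitsPos E c) →+ (Fin L.u → ℝ) where
  toFun γ := unitLog L c γ.toMul
  map_zero' := by
    change L.logVec (toInf F E 1) = 0
    rw [map_one, L.logVec_one]
  map_add' γ γ' := by
    change L.logVec (toInf F E (γ.toMul.1 * γ'.toMul.1)) = _
    rw [map_mul, L.logVec_mul]
    rfl

/-- The lattice `Λ ⊆ ℝ^u`. -/
def logLattice (L : SplitPlaces F E) (c : Ideal (𝓞 F)) : Submodule ℤ (Fin L.u → ℝ) :=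
  AddSubgroup.toIntSubmodule (unitLogHom L c).range

theorem coe_logLattice (L : SplitPlaces F E) (c : Ideal (𝓞 F)) :
    (logLattice L c : Set (Fin L.u → ℝ)) = Set.range (unitLog L c) := rfl

theorem discreteTopology_logLattice (L : SplitPlaces F E) (hE : Module.finrank F E = 2)
    (c : Ideal (𝓞 F)) : DiscreteTopology (logLattice L c) := by
  refine discreteTopology_of_isOpen_singleton_zero ?_
  refine isOpen_singleton_of_finite_mem_nhds 0 (s := Metric.closedBall 0 1) ?_ ?_
  · exact Metric.closedBall_mem_nhds _ (by simp)
  · refine Set.Finite.of_finite_image ?_ (Set.injOn_of_injective Subtype.val_injective)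
    refine ((finite_logVec_le L hE c zero_le_one).image
      (fun γ => L.logVec (toInf F E γ))).subset ?_
    rintro _ ⟨⟨_, γ, rfl⟩, hx, rfl⟩
    refine ⟨γ.toMul.1, ⟨γ.toMul.2, fun i => ?_⟩, rfl⟩
    rw [mem_closedBall_zero_iff] at hx
    exact (norm_le_pi_norm (unitLogHom L c γ) i).trans hx

/-- A linear form vanishing on `Λ` vanishes on the logarithms of all units of `𝒪_E`, since powers of
them lie in `T(𝒪_F)_+`. Such a relation among the `log w(u)` must be proportional to the product
formula, whereas this one is antisymmetric in the two places above each `σ`. -/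
theorem span_logLattice (L : SplitPlaces F E) (hE : Module.finrank F E = 2)
    {c : Ideal (𝓞 F)} (hc : c ≠ ⊥) :
    Submodule.span ℝ (logLattice L c : Set (Fin L.u → ℝ)) = ⊤ := by
  classical
  by_contra hne
  obtain ⟨f, hf0, hf⟩ := Submodule.exists_le_ker_of_lt_top _ (lt_top_iff_ne_top.2 hne)
  let a : Fin L.u → ℝ := fun i => f (Pi.single i 1)
  have hfa : ∀ x, f x = ∑ i, a i * x i := fun x => by
    conv_lhs => rw [← Finset.univ_sum_single x]
    rw [map_sum]
    refine Finset.sum_congr rfl fun i _ => ?_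
    have : Pi.single i (x i) = x i • (Pi.single i 1 : Fin L.u → ℝ) := by
      rw [← Pi.single_smul, smul_eq_mul, mul_one]
    rw [this, map_smul, smul_eq_mul, mul_comm]
  have hu : ∀ u : (𝓞 E)ˣ, ∑ i, a i * (Real.log (L.w i (u : E)) - Real.log (L.w' i (u : E))) = 0 := by
    intro u
    obtain ⟨n, hn, h⟩ := exists_pow_mem_unitsPos L hE hc (toFin_unit_mem (F := F) u)
    have h1 : f (unitLog L c ⟨_, h⟩) = 0 := hf (Submodule.subset_span ⟨Additive.ofMul ⟨_, h⟩, rfl⟩)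
    rw [hfa] at h1
    have h2 : ∀ i, unitLog L c ⟨_, h⟩ i =
        n * (Real.log (L.w i (u : E)) - Real.log (L.w' i (u : E))) := fun i => by
      change L.logVec (toInf F E (QuotientGroup.mk
        (Units.map (algebraMap (𝓞 E) E : 𝓞 E →* E) u ^ n))) i = _
      rw [L.logVec_toInf_mk, Units.val_pow_eq_pow_val, map_pow, map_pow, Real.log_pow,
        Real.log_pow, mul_sub]
      rfl
    simp only [h2, mul_left_comm (a _), ← Finset.mul_sum] at h1
    exact (mul_eq_zero.1 h1).resolve_left (by exact_mod_cast hn.ne')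
  -- The form rewritten as a relation over all places of `E`: `a i` at `w i`, `-a i` at `w' i`, and
  -- `0` elsewhere.
  let d : InfinitePlace E → ℝ := fun w =>
    ∑ i, ((if L.w i = w then a i else 0) - (if L.w' i = w then a i else 0))
  have hd : ∀ u : (𝓞 E)ˣ, ∑ w, d w * Real.log (w (u : E)) = 0 := fun u => by
    rw [← hu u]
    simp only [d, Finset.sum_mul]
    rw [Finset.sum_comm]
    refine Finset.sum_congr rfl fun i _ => ?_
    simp [sub_mul, Finset.sum_sub_distrib, ite_mul, mul_sub]
  -- Subtracting the multiple `k` of the product formula, with `k` the least of the `d w / mult w`,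
  -- makes all coefficients nonnegative and the one at `w₁` zero. A unit smaller than `1` at all
  -- places other than `w₁` then forces the remaining coefficients to vanish.
  obtain ⟨w₁, -, hw₁⟩ := Finset.exists_min_image (Finset.univ : Finset (InfinitePlace E))
    (fun w => d w / w.mult) Finset.univ_nonempty
  set k := d w₁ / w₁.mult
  have hm : ∀ w : InfinitePlace E, (0 : ℝ) < w.mult := fun w => by exact_mod_cast InfinitePlace.mult_pos
  have hdk : ∀ w, 0 ≤ d w - k * w.mult := fun w => by
    have := hw₁ w (Finset.mem_univ _)
    rw [le_div_iff₀ (hm w)] at this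
    linarith
  obtain ⟨u, hu1⟩ := Units.dirichletUnitTheorem.exists_unit E w₁
  have hs : ∑ w, (d w - k * w.mult) * Real.log (w (u : E)) = 0 := by
    simp only [sub_mul, Finset.sum_sub_distrib, hd, mul_assoc, ← Finset.mul_sum,
      Units.sum_mult_mul_log, mul_zero, sub_zero]
  have hle : ∀ w, (d w - k * w.mult) * Real.log (w (u : E)) ≤ 0 := fun w => by
    by_cases h : w = w₁
    · have : d w - k * w.mult = 0 := by
        rw [h, div_mul_cancel₀ _ (hm w₁).ne', sub_self]
      rw [this, zero_mul]
    · exact mul_nonpos_of_nonneg_of_nonpos (hdk w) (hu1 w h).le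
  have hz := (Finset.sum_eq_zero_iff_of_nonpos fun w _ => hle w).1 hs
  have hdw : ∀ w, d w = k * w.mult := fun w => by
    by_cases h : w = w₁
    · rw [h, div_mul_cancel₀ _ (hm w₁).ne']
    · have := (mul_eq_zero.1 (hz w (Finset.mem_univ _))).resolve_right (hu1 w h).ne
      linarith
  have hww : ∀ i j, L.w i = L.w j ↔ i = j := fun i j => ⟨fun h => L.σ_injective (by
    rw [← L.comap_w, h, L.comap_w]), fun h => by rw [h]⟩
  have hww' : ∀ i j, L.w' i = L.w' j ↔ i = j := fun i j => ⟨fun h => L.σ_injective (by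
    rw [← L.comap_w', h, L.comap_w']), fun h => by rw [h]⟩
  have hne' : ∀ i j, L.w' i ≠ L.w j := fun i j h => by
    have hij : i = j := L.σ_injective (by rw [← L.comap_w', h, L.comap_w])
    subst hij
    exact L.w_ne i h.symm
  have hda : ∀ i, d (L.w i) = a i := fun i => by
    simp [d, hww, hne']
  have hda' : ∀ i, d (L.w' i) = - a i := fun i => by
    have : ∀ j, L.w j ≠ L.w' i := fun j h => hne' i j h.symm
    simp [d, hww', this]
  -- The values `a i` and `-a i` have the sign of `k` times positive multiplicities, so `k = 0`.
  have ha : ∀ i, a i = 0 := fun i => by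
    have h1 := (hda i).symm.trans (hdw _)
    have h2 := (hda' i).symm.trans (hdw _)
    have h3 : k * ((L.w i).mult + (L.w' i).mult) = 0 := by linarith
    have h4 : k = 0 := (mul_eq_zero.1 h3).resolve_right
      (add_pos (hm (L.w i)) (hm (L.w' i))).ne'
    rw [h1, h4, zero_mul]
  exact hf0 (LinearMap.ext fun x => by rw [hfa]; simp [ha])

theorem exists_unitLog_basis (L : SplitPlaces F E) (hE : Module.finrank F E = 2)
    {c : Ideal (𝓞 F)} (hc : c ≠ ⊥) : ∃ ε : Fin L.u → unitsPos E c,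
      LinearIndependent ℝ (fun i => unitLog L c (ε i)) ∧
      (Submodule.span ℤ (Set.range fun i => unitLog L c (ε i)) : Set (Fin L.u → ℝ)) =
        Set.range (unitLog L c) := by
  haveI := discreteTopology_logLattice L hE c
  haveI : IsZLattice ℝ (logLattice L c) := ⟨span_logLattice L hE hc⟩
  let b := IsZLattice.basis (logLattice L c)
  choose ε hε using fun i => (b i).2
  have h : (fun i => unitLog L c (ε i).toMul) = b.ofZLatticeBasis ℝ (logLattice L c) :=
    funext fun i => (hε i).trans (b.ofZLatticeBasis_apply ℝ (logLattice L c) i).symm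
  refine ⟨fun i => (ε i).toMul, ?_, ?_⟩
  · rw [h]
    exact (b.ofZLatticeBasis ℝ (logLattice L c)).linearIndependent
  · rw [h, b.ofZLatticeBasis_span ℝ (logLattice L c), coe_logLattice]

theorem finite_ker_unitLog (L : SplitPlaces F E) (hE : Module.finrank F E = 2)
    (c : Ideal (𝓞 F)) : {γ : unitsPos E c | unitLog L c γ = 0}.Finite := by
  refine Set.Finite.of_finite_image ((finite_logVec_le L hE c le_rfl).subset ?_)
    (Set.injOn_of_injective Subtype.val_injective)
  rintro _ ⟨γ, hγ, rfl⟩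
  refine ⟨γ.2, fun i => ?_⟩
  have : L.logVec (toInf F E γ.1) = 0 := hγ
  rw [this]; simp

/-- The kernel of the logarithms is finite, hence torsion, and `ℝ^u` is torsion-free. -/
theorem mem_torsion_iff (L : SplitPlaces F E) (hE : Module.finrank F E = 2)
    (c : Ideal (𝓞 F)) (γ : unitsPos E c) :
    γ ∈ CommGroup.torsion (unitsPos E c) ↔ unitLog L c γ = 0 := by
  have hpow : ∀ n : ℕ, unitLog L c (γ ^ n) = n • unitLog L c γ := fun n =>
    map_nsmul (unitLogHom L c) n (Additive.ofMul γ)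
  constructor
  · intro h
    obtain ⟨n, hn, h1⟩ := isOfFinOrder_iff_pow_eq_one.1 h
    have h2 := hpow n
    rw [h1] at h2
    have h3 : unitLog L c 1 = 0 := map_zero (unitLogHom L c)
    rw [h3] at h2
    exact (smul_eq_zero.1 h2.symm).resolve_left hn.ne'
  · intro h
    change IsOfFinOrder γ
    rw [← finite_powers]
    refine (finite_ker_unitLog L hE c).subset ?_
    rintro _ ⟨n, rfl⟩
    exact (hpow n).trans (by rw [h, smul_zero])

theorem torsionCard_eq (L : SplitPlaces F E) (hE : Module.finrank F E = 2) (c : Ideal (𝓞 F)) :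
    torsionCard E c = {γ : unitsPos E c | unitLog L c γ = 0}.ncard := by
  rw [torsionCard, ← Nat.card_coe_set_eq]
  exact Nat.card_congr (Equiv.subtypeEquivRight fun γ => mem_torsion_iff L hE c γ)

end UnitLattice


/-! ### The chain `fundChain` is a cycle and `ι(1_𝓕)` lies in `C_c^∅` -/

section Cycle

theorem contractNth_comp_swap {G : Type*} [CommGroup G] {n : ℕ} (g : Fin (n + 1) → G)
    (j : Fin n) :
    Fin.contractNth j.castSucc (· * ·) (g ∘ Equiv.swap j.castSucc j.succ) =
      Fin.contractNth j.castSucc (· * ·) g := by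
  funext k
  rcases lt_trichotomy (k : ℕ) j with h | h | h
  · rw [Fin.contractNth_apply_of_lt _ _ _ _ h, Fin.contractNth_apply_of_lt _ _ _ _ h,
      Function.comp_apply, Equiv.swap_apply_of_ne_of_ne]
    · exact fun e => h.ne (by simpa using congrArg Fin.val e)
    · exact fun e => by have := congrArg Fin.val e; simp at this; omega
  · rw [Fin.contractNth_apply_of_eq _ _ _ _ h, Fin.contractNth_apply_of_eq _ _ _ _ h]
    obtain rfl : k = j := Fin.ext h
    simp only [Function.comp_apply, Equiv.swap_apply_left, Equiv.swap_apply_right]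
    exact mul_comm _ _
  · rw [Fin.contractNth_apply_of_gt _ _ _ _ h, Fin.contractNth_apply_of_gt _ _ _ _ h,
      Function.comp_apply, Equiv.swap_apply_of_ne_of_ne]
    · exact fun e => by have := congrArg Fin.val e; simp at this; omega
    · exact fun e => h.ne' (by simpa using congrArg Fin.val e)

theorem contractNth_last {G : Type*} [Mul G] {n : ℕ} (g : Fin (n + 1) → G) :
    Fin.contractNth (Fin.last n) (· * ·) g = g ∘ Fin.castSucc := by
  funext k
  rw [Fin.contractNth_apply_of_lt _ _ _ _ k.2]
  rfl

/-- An inner face multiplies two adjacent entries, so in a commutative group swapping them preserves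
the face and reverses the sign: the terms cancel in pairs. -/
theorem sum_sign_contractNth {G : Type*} [CommGroup G] {n : ℕ} (ε : Fin (n + 1) → G) (j : Fin n) :
    ∑ π : Equiv.Perm (Fin (n + 1)), Finsupp.single
      (Fin.contractNth j.castSucc (· * ·) (ε ∘ π)) (Equiv.Perm.sign π : ℤ) = 0 := by
  refine Finset.sum_involution (fun π _ => π * Equiv.swap j.castSucc j.succ) ?_ ?_
    (fun _ _ => Finset.mem_univ _) ?_
  · intro π _
    rw [Equiv.Perm.coe_mul, ← Function.comp_assoc, contractNth_comp_swap, ← Finsupp.single_add,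
      Equiv.Perm.sign_mul, Equiv.Perm.sign_swap (Fin.castSucc_lt_succ).ne]
    simp
  · intro π _ _ h
    have := mul_left_cancel (h.trans (mul_one π).symm)
    rw [Equiv.swap_eq_one_iff] at this
    exact (Fin.castSucc_lt_succ (i := j)).ne this
  · intro π _
    rw [mul_assoc, Equiv.swap_mul_self, mul_one]

/-- Dropping the first and dropping the last entry are exchanged by a cyclic rotation of `n + 1`
letters, of sign `(-1)^n`. This makes the two outer faces of the boundary cancel. -/
theorem sum_sign_castSucc {G : Type*} {n : ℕ} (ε : Fin (n + 1) → G) :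
    ∑ π : Equiv.Perm (Fin (n + 1)), Finsupp.single
      ((ε ∘ π) ∘ Fin.castSucc) (Equiv.Perm.sign π : ℤ) =
    (-1 : ℤ) ^ n • ∑ π : Equiv.Perm (Fin (n + 1)), Finsupp.single
      ((ε ∘ π) ∘ Fin.succ) (Equiv.Perm.sign π : ℤ) := by
  rw [Finset.smul_sum]
  refine (Fintype.sum_equiv (Equiv.mulRight (finRotate (n + 1))) _ _ fun π => ?_).symm
  have h1 : (finRotate (n + 1)) ∘ Fin.castSucc = (Fin.succ : Fin n → Fin (n + 1)) := by
    funext i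
    simp [finRotate_succ_apply]
  have h2 : (ε ∘ ⇑(π * finRotate (n + 1))) ∘ Fin.castSucc = (ε ∘ π) ∘ Fin.succ := by
    rw [← h1]; rfl
  rw [Equiv.coe_mulRight, h2, Finsupp.smul_single, Equiv.Perm.sign_mul, sign_finRotate]
  congr 1
  simp [mul_comm]

theorem d_sum_sign {G : Type} [CommGroup G] {n : ℕ} (ε : Fin (n + 1) → G) :
    groupHomology.inhomogeneousChains.d (Rep.trivial ℤ G ℤ) n
      (∑ π : Equiv.Perm (Fin (n + 1)), Finsupp.single (ε ∘ π) (Equiv.Perm.sign π : ℤ)) = 0 := by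
  have h : ∀ π : Equiv.Perm (Fin (n + 1)),
      groupHomology.inhomogeneousChains.d (Rep.trivial ℤ G ℤ) n
        (Finsupp.single (ε ∘ π) (Equiv.Perm.sign π : ℤ)) =
      (Finsupp.single ((ε ∘ π) ∘ Fin.succ) (Equiv.Perm.sign π : ℤ) : (Fin n → G) →₀ ℤ) +
      (∑ j : Fin n, (-1 : ℤ) ^ ((j : ℕ) + 1) • (Finsupp.single (Fin.contractNth j.castSucc (· * ·)
        (ε ∘ π)) (Equiv.Perm.sign π : ℤ) : (Fin n → G) →₀ ℤ) +
      (-1 : ℤ) ^ (n + 1) • (Finsupp.single ((ε ∘ π) ∘ Fin.castSucc) (Equiv.Perm.sign π : ℤ) :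
        (Fin n → G) →₀ ℤ)) := fun π => by
    refine (groupHomology.inhomogeneousChains.d_single (A := Rep.trivial ℤ G ℤ) n (ε ∘ π)
      (Equiv.Perm.sign π : ℤ)).trans ?_
    rw [Fin.sum_univ_castSucc, contractNth_last]
    rfl
  rw [map_sum]
  refine (Finset.sum_congr rfl fun π _ => h π).trans ?_
  rw [Finset.sum_add_distrib, Finset.sum_add_distrib, Finset.sum_comm, ← Finset.smul_sum,
    sum_sign_castSucc, smul_smul]
  have h0 : ∀ j : Fin n, ∑ π : Equiv.Perm (Fin (n + 1)), (-1 : ℤ) ^ ((j : ℕ) + 1) •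
      (Finsupp.single (Fin.contractNth j.castSucc (· * ·) (ε ∘ π)) (Equiv.Perm.sign π : ℤ) :
        (Fin n → G) →₀ ℤ) = 0 := fun j => by
    rw [← Finset.smul_sum, sum_sign_contractNth, smul_zero]
  rw [Finset.sum_eq_zero fun j _ => h0 j, zero_add, pow_succ, mul_right_comm, ← mul_pow]
  simp

variable {F E : Type} [Field F] [NumberField F] [Field E] [NumberField E] [Algebra F E]

theorem exists_cycle_eq_fundChain (L : SplitPlaces F E) (c : Ideal (𝓞 F))
    (ε : Fin L.u → unitsPos E c) :
    ∃ y : groupHomology.cycles (Rep.trivial ℤ (unitsPos E c) ℤ) L.u,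
      groupHomology.iCycles (Rep.trivial ℤ (unitsPos E c) ℤ) L.u y = fundChain L c ε := by
  suffices h : (groupHomology.inhomogeneousChains (Rep.trivial ℤ (unitsPos E c) ℤ)).d L.u
      ((ComplexShape.down ℕ).next L.u) (fundChain L c ε) = 0 from
    ⟨groupHomology.cyclesMk _ _ rfl (fundChain L c ε) h, groupHomology.iCycles_mk rfl _ h⟩
  rw [fundChain]
  generalize ((-1 : ℤ) ^ (L.u * (L.u + 1) / 2) *
    (SignType.sign (Matrix.det (Matrix.of fun i => unitLog L c (ε i))) : ℤ)) = k
  generalize L.u = u at *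
  cases u with
  | zero =>
    -- In degree `0` the next index is a dummy and the differential is zero.
    rw [HomologicalComplex.shape]
    · rfl
    · simp
  | succ n =>
    rw [show (ComplexShape.down ℕ).next (n + 1) = n by simp, 
      groupHomology.inhomogeneousChains.d_def]
    refine (map_zsmul (groupHomology.inhomogeneousChains.d
      (Rep.trivial ℤ (unitsPos E c) ℤ) n).hom k _).trans ?_
    refine (congrArg (k • ·) (d_sum_sign ε)).trans (smul_zero k)

end Cycle

/-! ### Smoothness and compact support of `ι(1_𝓕)`, and existence of `η`. -/

section Iota

variable {F E : Type} [Field F] [NumberField F] [Field E] [NumberField E] [Algebra F E]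

/-- The pullback to the units is extended by `0`; since the units are open, it is constant near each
of them. -/
theorem SmoothInf.of_isLocallyConstant {f : TInf F E → ℂ} (hf : IsLocallyConstant f) :
    SmoothInf f := by
  classical
  refine ⟨fun x => if h : IsUnit x then f (mixedToInf h.unit) else 0, fun x hx => ?_, fun x => ?_⟩
  · refine ContDiffAt.contDiffWithinAt ?_
    obtain ⟨y, rfl⟩ := hx
    have h1 : ∀ᶠ z : (mixedEmbedding.mixedSpace E)ˣ in nhds y,
        f (mixedToInf z) = f (mixedToInf y) :=
      (hf.comp_continuous isOpenQuotientMap_mixedToInf.continuous).eventually_eq y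
    have h2 : ∀ᶠ z : mixedEmbedding.mixedSpace E in nhds (y : mixedEmbedding.mixedSpace E),
        (if h : IsUnit z then f (mixedToInf h.unit) else 0) = f (mixedToInf y) := by
      rw [← Units.isOpenEmbedding_val.map_nhds_eq, Filter.eventually_map]
      filter_upwards [h1] with z hz
      rw [dif_pos z.isUnit, IsUnit.unit_of_val_units, hz]
    exact contDiffAt_const.congr_of_eventuallyEq h2
  · change (if h : IsUnit (x : mixedEmbedding.mixedSpace E) then f (mixedToInf h.unit) else 0) = _
    rw [dif_pos x.isUnit, IsUnit.unit_of_val_units]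

theorem isClopen_infPos : IsClopen (infPos F E : Set (TInf F E)) :=
  ⟨isClosed_infPos, isOpen_infPos⟩

theorem finDomain_eq (c : Ideal (𝓞 F)) (r : ClPos E c → TFin F E) :
    finDomain E c r = ⋃ i, (fun y => r i * y) '' (maxCompact E c : Set (TFin F E)) := by
  ext x
  simp only [finDomain, Set.mem_iUnion, Set.mem_image, SetLike.mem_coe, Set.mem_setOf_eq, eq_comm]

theorem isOpen_finDomain {c : Ideal (𝓞 F)} (hc : c ≠ ⊥) (r : ClPos E c → TFin F E) :
    IsOpen (finDomain E c r) := by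
  rw [finDomain_eq]
  exact isOpen_iUnion fun i => (Homeomorph.mulLeft (r i)).isOpenMap _ (isOpen_maxCompact hc)

theorem isCompact_finDomain (L : SplitPlaces F E) (hE : Module.finrank F E = 2)
    {c : Ideal (𝓞 F)} (hc : c ≠ ⊥) (r : ClPos E c → TFin F E) :
    IsCompact (finDomain E c r) := by
  haveI := finite_ClPos L hE hc
  rw [finDomain_eq]
  exact isCompact_iUnion fun i => (isCompact_maxCompact hc).image (continuous_const_mul _)

theorem oneParam_mem_infPos (L : SplitPlaces F E) (i : Fin L.u) (x : ℝ) :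
    L.oneParam i x ∈ infPos F E :=
  (isPreconnected_range (continuous_oneParam L i)).subset_connectedComponent
    ⟨0, oneParam_zero L i⟩ ⟨x, rfl⟩

/-- `T(F_∞)_+` is clopen, and `𝓕` is open and, by finiteness of `Cl(T)_+`, compact; so the function
is locally constant. -/
theorem iotaFun_mem_ccFun (L : SplitPlaces F E) (hE : Module.finrank F E = 2)
    {c : Ideal (𝓞 F)} (hc : c ≠ ⊥) (r : ClPos E c → TFin F E) : iotaFun c r ∈ ccFun L := by
  classical
  have hK := isCompact_finDomain L hE hc r
  have hcl : IsClopen (finDomain E c r) := ⟨hK.isClosed, isOpen_finDomain hc r⟩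
  have hloc : IsLocallyConstant fun t : TAdele F E => (iotaFun c r t : ℂ) := by
    have h1 : IsClopen {t : TAdele F E | t.1 ∈ infPos F E ∧ t.2 ∈ finDomain E c r} :=
      (isClopen_infPos.preimage continuous_fst).inter (hcl.preimage continuous_snd)
    rw [IsLocallyConstant.iff_eventually_eq]
    intro t
    by_cases ht : t.1 ∈ infPos F E ∧ t.2 ∈ finDomain E c r
    · filter_upwards [h1.isOpen.mem_nhds ht] with s hs
      rw [iotaFun, iotaFun, if_pos ht, if_pos hs]
    · filter_upwards [h1.compl.isOpen.mem_nhds ht] with s hs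
      have hs' : ¬(s.1 ∈ infPos F E ∧ s.2 ∈ finDomain E c r) := hs
      rw [iotaFun, iotaFun, if_neg ht, if_neg hs']
  refine ⟨⟨hloc.continuous, fun s => SmoothInf.of_isLocallyConstant
    (hloc.comp_continuous (continuous_id.prodMk continuous_const)), fun i _ x t s => ?_⟩,
    fun t => ?_⟩
  · simp only [iotaFun, (infPos F E).mul_mem_cancel_right (oneParam_mem_infPos L i x)]
  · refine HasCompactSupport.intro hK fun s hs => ?_
    rw [iotaFun, if_neg fun h => hs h.2]

theorem exists_isEta (L : SplitPlaces F E) (hE : Module.finrank F E = 2)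
    {c : Ideal (𝓞 F)} (hc : c ≠ ⊥) (r : ClPos E c → TFin F E) : ∃ η, IsEta L c r η := by
  obtain ⟨ε, h1, h2⟩ := exists_unitLog_basis L hE hc
  obtain ⟨y, hy⟩ := exists_cycle_eq_fundChain L c ε
  exact ⟨_, iotaFun_mem_ccFun L hE hc r, _, ⟨ε, h1, h2, y, hy, rfl⟩, rfl⟩

end Iota


/-! ### Fundamental domains of countable subgroups -/

section FundamentalDomain

/-- Cover `K` by finitely many translates `B n` of a `V` with `V / V ⊆ W`. Each meets an orbit at
most once, because two elements of an orbit in it differ by an element of `Γ ∩ W = {1}`. Each orbit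
is represented by its point in the first `B n` that it meets. -/
theorem exists_isFundamentalDomain {G : Type*} [CommGroup G] [TopologicalSpace G]
    [IsTopologicalGroup G] [MeasurableSpace G] [OpensMeasurableSpace G] (Γ : Subgroup G)
    {K W : Set G} (hK : IsCompact K) (hcov : ∀ t, ∃ γ : Γ, γ • t ∈ K) (hW : W ∈ nhds (1 : G))
    (hΓ : ∀ γ ∈ Γ, γ ∈ W → γ = 1) (μ : Measure G) : ∃ D, IsFundamentalDomain Γ D μ := by
  obtain ⟨V', hV', hVW⟩ := exists_nhds_split_inv hW
  obtain ⟨V, hVV', hVo, hV1⟩ := mem_nhds_iff.1 hV'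
  obtain ⟨s, hs⟩ := hK.elim_finite_subcover (fun g : G => (fun x => g⁻¹ * x) ⁻¹' V)
    (fun g => hVo.preimage (continuous_const_mul _))
    (fun g _ => Set.mem_iUnion.2 ⟨g, by simpa using hV1⟩)
  let f : Fin s.card → G := fun n => (s.equivFin.symm n : G)
  let B : Fin s.card → Set G := fun n => (fun x => (f n)⁻¹ * x) ⁻¹' V
  have hBo : ∀ n, IsOpen (B n) := fun n => hVo.preimage (continuous_const_mul _)
  let O : Fin s.card → Set G := fun n => {t | ∃ γ : Γ, γ • t ∈ B n}
  have hO : ∀ n, O n = ⋃ γ : Γ, (fun t => γ • t) ⁻¹' B n := fun n => by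
    ext t; simp [O]
  have hOo : ∀ n, IsOpen (O n) := fun n => by
    rw [hO]
    exact isOpen_iUnion fun γ => (hBo n).preimage (continuous_const_mul (γ : G))
  have hOγ : ∀ n (γ : Γ) t, γ • t ∈ O n → t ∈ O n := fun n γ t ⟨δ, h⟩ =>
    ⟨δ * γ, by rwa [mul_smul]⟩
  let D : Set G := ⋃ n, B n ∩ ⋂ m ∈ Set.Iio n, (O m)ᶜ
  refine ⟨D, IsFundamentalDomain.mk' (MeasurableSet.nullMeasurableSet ?_) fun t => ?_⟩
  · exact MeasurableSet.iUnion fun n => (hBo n).measurableSet.inter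
      (MeasurableSet.biInter (Set.to_countable _) fun m _ => (hOo m).measurableSet.compl)
  · have hne : {n | t ∈ O n}.Nonempty := by
      obtain ⟨γ, hγ⟩ := hcov t
      obtain ⟨g, hg, hgt⟩ := Set.mem_iUnion₂.1 (hs hγ)
      exact ⟨s.equivFin ⟨g, hg⟩, γ, by simpa [B, f] using hgt⟩
    obtain ⟨n, ⟨γ, hγ⟩, hmin⟩ := WellFounded.has_min (wellFounded_lt (α := Fin s.card)) _ hne
    refine ⟨γ, Set.mem_iUnion.2 ⟨n, hγ, Set.mem_iInter₂.2 fun m hm h =>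
      hmin m (hOγ m γ t h) hm⟩, fun δ hδ => ?_⟩
    obtain ⟨n', hn', hmin'⟩ := Set.mem_iUnion.1 hδ
    have h1 : ¬ n' < n := fun h => hmin n' ⟨δ, hn'⟩ h
    have h2 : ¬ n < n' := fun h => Set.mem_iInter₂.1 hmin' n h
      ⟨γ * δ⁻¹, by rwa [mul_smul, inv_smul_smul]⟩
    obtain rfl : n' = n := le_antisymm (not_lt.1 h2) (not_lt.1 h1)
    have h3 := hVW _ (hVV' hn') _ (hVV' hγ)
    have h4 : ((f n')⁻¹ * δ • t) / ((f n')⁻¹ * γ • t) = ((δ * γ⁻¹ : Γ) : G) := by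
      change ((f n')⁻¹ * ((δ : G) * t)) / ((f n')⁻¹ * ((γ : G) * t)) = (δ : G) * (γ : G)⁻¹
      rw [mul_div_mul_left_eq_div, mul_div_mul_right_eq_div, div_eq_mul_inv]
    rw [h4] at h3
    have h5 := hΓ _ (δ * γ⁻¹).2 h3
    exact mul_inv_eq_one.1 (Subtype.ext h5)

variable {Γ G : Type*} [Group Γ] [MulAction Γ G] [MeasurableSpace G] [Countable Γ]
  [MeasurableConstSMul Γ G] {μ : Measure G} [SMulInvariantMeasure Γ G μ] {D Q : Set G}

-- Unfolding: the translates of `Q` cover each point of `D` exactly `n` times.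
open scoped Pointwise in
theorem measure_inter_eq_mul (hD : IsFundamentalDomain Γ D μ) (hQ : MeasurableSet Q) {n : ℕ∞}
    (hn : ∀ t : G, {γ : Γ | γ • t ∈ Q}.encard = n) {A : Set G} (hA : MeasurableSet A)
    (hAΓ : ∀ (γ : Γ) t, γ • t ∈ A ↔ t ∈ A) : μ (A ∩ Q) = n * μ (A ∩ D) := by
  classical
  rw [hD.measure_eq_tsum]
  have h1 : ∀ γ : Γ, μ (γ • (A ∩ Q) ∩ D) =
      ∫⁻ t in A ∩ D, Set.indicator (γ • Q) 1 t ∂μ := fun γ => by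
    have hm : MeasurableSet (γ • Q) := hQ.const_smul γ
    rw [lintegral_indicator_one hm, Measure.restrict_apply hm]
    congr 1
    ext t
    simp only [Set.mem_inter_iff, Set.mem_smul_set_iff_inv_smul_mem, hAΓ]
    tauto
  simp only [h1]
  rw [← lintegral_tsum fun γ => (measurable_one.indicator (hQ.const_smul γ)).aemeasurable]
  have h2 : ∀ t : G, ∑' γ : Γ, Set.indicator (γ • Q) (1 : G → ENNReal) t = n := fun t => by
    have h3 : ∀ γ : Γ, Set.indicator (γ • Q) (1 : G → ENNReal) t =
        Set.indicator {γ : Γ | γ • t ∈ Q} 1 γ⁻¹ := fun γ => by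
      simp only [Set.indicator, Set.mem_smul_set_iff_inv_smul_mem, Set.mem_setOf_eq, Pi.one_apply]
    rw [tsum_congr h3]
    refine ((Equiv.inv Γ).tsum_eq (Set.indicator {γ : Γ | γ • t ∈ Q} (1 : Γ → ENNReal))).trans ?_
    rw [← tsum_subtype, ← hn t, ← ENNReal.tsum_set_one]
    rfl
  simp only [h2]
  rw [setLIntegral_const]

/-- An invariant function has the same distribution on `Q` as on `D`, up to the factor `n`. Passing
to image measures on `ℂ` yields integrability and the integral at once. -/
theorem map_restrict_eq_smul (hD : IsFundamentalDomain Γ D μ) (hQ : MeasurableSet Q) {n : ℕ∞}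
    (hn : ∀ t : G, {γ : Γ | γ • t ∈ Q}.encard = n) {φ : G → ℂ} (hφ : Measurable φ)
    (hφΓ : ∀ (γ : Γ) t, φ (γ • t) = φ t) :
    (μ.restrict Q).map φ = (n : ENNReal) • (μ.restrict D).map φ := by
  ext A hA
  rw [Measure.smul_apply, Measure.map_apply hφ hA, Measure.map_apply hφ hA,
    Measure.restrict_apply (hφ hA), Measure.restrict_apply (hφ hA), smul_eq_mul]
  exact measure_inter_eq_mul hD hQ hn (hφ hA) fun γ t => by
    rw [Set.mem_preimage, Set.mem_preimage, hφΓ]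

theorem integral_eq_mul_of_isFundamentalDomain (hD : IsFundamentalDomain Γ D μ)
    (hQ : MeasurableSet Q) {n : ℕ} (hn0 : n ≠ 0)
    (hn : ∀ t : G, {γ : Γ | γ • t ∈ Q}.encard = n) {φ : G → ℂ} (hφ : Measurable φ)
    (hφΓ : ∀ (γ : Γ) t, φ (γ • t) = φ t) (hint : IntegrableOn φ Q μ) :
    IntegrableOn φ D μ ∧ ∫ t in Q, φ t ∂μ = n * ∫ t in D, φ t ∂μ := by
  have h := map_restrict_eq_smul hD hQ hn hφ hφΓ
  have hid : AEStronglyMeasurable (id : ℂ → ℂ) ((μ.restrict Q).map φ) :=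
    continuous_id.aestronglyMeasurable
  have hid' : AEStronglyMeasurable (id : ℂ → ℂ) ((μ.restrict D).map φ) :=
    continuous_id.aestronglyMeasurable
  constructor
  · have h1 : Integrable id ((μ.restrict Q).map φ) :=
      (integrable_map_measure hid hφ.aemeasurable).2 hint
    rw [h, integrable_smul_measure (by simpa using hn0) (by simp)] at h1
    exact (integrable_map_measure hid' hφ.aemeasurable).1 h1
  · have h1 := integral_map hφ.aemeasurable hid
    have h2 := integral_map hφ.aemeasurable hid'
    simp only [id] at h1 h2
    rw [← h1, ← h2, h, integral_smul_measure]
    simp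

end FundamentalDomain

/-! ### The Haar measure and the set of representatives -/

section Haar

variable {F E : Type} [Field F] [NumberField F] [Field E] [NumberField E] [Algebra F E]
variable (L : SplitPlaces F E)

theorem exists_finDomain_mul_eq (c : Ideal (𝓞 F)) {r : ClPos E c → TFin F E}
    (hr : ∀ x, QuotientGroup.mk (r x) = x) (t : TFin F E) :
    ∃ γ ∈ ratPos E, toFin F E γ * t ∈ finDomain E c r := by
  have h1 : (r (QuotientGroup.mk t))⁻¹ * t ∈ maxCompact E c ⊔ (ratPos E).map (toFin F E) :=
    QuotientGroup.eq.1 (hr _)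
  obtain ⟨y, hy, _, ⟨γ, hγ, rfl⟩, h2⟩ := Subgroup.mem_sup.1 h1
  refine ⟨γ⁻¹, inv_mem hγ, QuotientGroup.mk t, y, hy, ?_⟩
  rw [map_inv, inv_mul_eq_iff_eq_mul, mul_left_comm, mul_comm _ y, h2, mul_inv_cancel_left]

/-- Multiplication by `T(F)_+` does not change the class in `Cl(T)_+`, so the point stays in the
same `t̄ᵢ U`, and `γ` has to lie in `U`. -/
theorem mem_finDomain_mul_iff (c : Ideal (𝓞 F)) {r : ClPos E c → TFin F E}
    (hr : ∀ x, QuotientGroup.mk (r x) = x) {t : TFin F E} (ht : t ∈ finDomain E c r)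
    {γ : TRat F E} (hγ : γ ∈ ratPos E) :
    toFin F E γ * t ∈ finDomain E c r ↔ γ ∈ unitsPos E c := by
  obtain ⟨i, y, hy, rfl⟩ := ht
  constructor
  · rintro ⟨j, y', hy', h⟩
    have hij : i = j := by
      rw [← hr i, ← hr j]
      refine QuotientGroup.eq.2 ?_
      have : (r i)⁻¹ * r j = (y * y'⁻¹) * toFin F E γ := by
        have h1 : r j = toFin F E γ * (r i * y) * y'⁻¹ := eq_mul_inv_of_mul_eq h.symm
        rw [h1, mul_assoc, mul_left_comm, mul_assoc (r i), inv_mul_cancel_left, mul_comm]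
      rw [this]
      exact mul_mem (Subgroup.mem_sup_left (mul_mem hy (inv_mem hy')))
        (Subgroup.mem_sup_right ⟨γ, hγ, rfl⟩)
    subst hij
    refine ⟨hγ, ?_⟩
    have : toFin F E γ = y' * y⁻¹ := by
      rw [eq_mul_inv_iff_mul_eq]
      rw [mul_left_comm] at h
      exact mul_left_cancel h
    change toFin F E γ ∈ maxCompact E c
    rw [this]
    exact mul_mem hy' (inv_mem hy)
  · intro h
    exact ⟨i, toFin F E γ * y, mul_mem h.2 hy, mul_left_comm _ _ _⟩

theorem compactSpace_compactPart (L : SplitPlaces F E) (hE : Module.finrank F E = 2) :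
    CompactSpace L.compactPart :=
  isCompact_iff_compactSpace.1 (L.isCompact_compactPart hE)

/-- The countably many translates of the compact set `𝓕` by `T(F)` cover. This makes the Haar
measure σ-finite, as Fubini requires. -/
theorem sigmaCompactSpace_TFin (L : SplitPlaces F E) (hE : Module.finrank F E = 2) :
    SigmaCompactSpace (TFin F E) := by
  have hc : (⊤ : Ideal (𝓞 F)) ≠ ⊥ := top_ne_bot'
  let r : ClPos E (⊤ : Ideal (𝓞 F)) → TFin F E := Quotient.out
  have hr : ∀ x, QuotientGroup.mk (r x) = x := fun x => QuotientGroup.out_eq' x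
  have hK := isCompact_finDomain L hE hc r
  refine SigmaCompactSpace.of_countable (Set.range fun γ : TRat F E =>
    (fun t => toFin F E γ * t) ⁻¹' finDomain E ⊤ r) (Set.countable_range _) ?_ ?_
  · rintro _ ⟨γ, rfl⟩
    exact (Homeomorph.mulLeft (toFin F E γ)).isCompact_preimage.2 hK
  · refine Set.eq_univ_of_forall fun t => ?_
    obtain ⟨γ, -, h⟩ := exists_finDomain_mul_eq ⊤ hr t
    exact ⟨_, ⟨γ, rfl⟩, h⟩

variable (L : SplitPlaces F E) (μS : Measure L.compactPart) (μf : Measure (TFin F E))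

/-- The Haar measure of `a T(F_∞)_+ × T(𝔸_F^∞)`. -/
def haarPiece (a : TInf F E) : Measure (TAdele F E) :=
  Measure.map (fun p : (Fin L.u → ℝ) × L.compactPart × TFin F E =>
      ((a * L.expVec p.1 * p.2.1, p.2.2) : TAdele F E)) (volume.prod (μS.prod μf))

theorem haar_eq_sum : haar L μS μf = Measure.sum fun z : TInf F E ⧸ infPos F E =>
    haarPiece L μS μf z.out := rfl

/-- Second countability of the archimedean factor alone suffices for open sets of the product to be
measurable. -/
instance : OpensMeasurableSpace (L.compactPart × TFin F E) :=
  haveI : SecondCountableTopology L.compactPart :=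
    TopologicalSpace.Subtype.secondCountableTopology (L.compactPart : Set (TInf F E))
  inferInstance

instance : OpensMeasurableSpace ((Fin L.u → ℝ) × L.compactPart × TFin F E) :=
  inferInstance

theorem continuous_param (a : TInf F E) :
    Continuous fun p : (Fin L.u → ℝ) × L.compactPart × TFin F E =>
      ((a * L.expVec p.1 * p.2.1, p.2.2) : TAdele F E) := by
  have := L.continuous_expVec
  fun_prop

variable [μS.IsHaarMeasure] [μf.IsHaarMeasure] [CompactSpace L.compactPart]
  [SigmaCompactSpace (TFin F E)]

theorem measurePreserving_shift (v : Fin L.u → ℝ) (s : L.compactPart) (t : TFin F E) :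
    MeasurePreserving (fun p : (Fin L.u → ℝ) × L.compactPart × TFin F E =>
      (v + p.1, s * p.2.1, t * p.2.2)) (volume.prod (μS.prod μf)) (volume.prod (μS.prod μf)) :=
  (measurePreserving_add_left volume v).prod
    ((measurePreserving_mul_left μS s).prod (measurePreserving_mul_left μf t))

theorem map_shift_eq (a : TInf F E) (v : Fin L.u → ℝ) (s : L.compactPart) (t : TFin F E) :
    Measure.map (fun p : (Fin L.u → ℝ) × L.compactPart × TFin F E =>
      ((a * L.expVec (v + p.1) * (s * p.2.1 : L.compactPart), t * p.2.2) : TAdele F E))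
        (volume.prod (μS.prod μf)) = haarPiece L μS μf a := by
  have h := measurePreserving_shift L μS μf v s t
  conv_rhs => rw [haarPiece, ← h.map_eq]
  rw [Measure.map_map (continuous_param L a).measurable h.measurable]
  rfl

/-- The quotient of two representatives of a coset of `T(F_∞)_+` splits as `e^v · s` with `s ∈ S`,
and is absorbed by the invariance of the measures on `ℝ^u` and `S`. -/
theorem haarPiece_congr {a a' : TInf F E} (h : a⁻¹ * a' ∈ infPos F E) :
    haarPiece L μS μf a' = haarPiece L μS μf a := by
  rw [← map_shift_eq L μS μf a (L.logVec (a⁻¹ * a')) ⟨_, L.expVec_logVec_inv_mul_mem h⟩ 1]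
  rw [haarPiece]
  congr 1
  funext p
  refine Prod.ext ?_ (one_mul _).symm
  change a' * L.expVec p.1 * p.2.1 = a * L.expVec (L.logVec (a⁻¹ * a') + p.1) *
    ((L.expVec (L.logVec (a⁻¹ * a')))⁻¹ * (a⁻¹ * a') * p.2.1)
  rw [L.expVec_add]
  generalize L.expVec (L.logVec (a⁻¹ * a')) = x
  generalize L.expVec p.1 = y
  have : a * (x * y) * (x⁻¹ * (a⁻¹ * a') * (p.2.1 : TInf F E)) =
      (a * a⁻¹) * (x * x⁻¹) * (a' * y * p.2.1) := by
    simp only [mul_assoc, mul_left_comm, mul_comm]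
  rw [this, mul_inv_cancel, mul_inv_cancel, one_mul, one_mul]

theorem map_mul_haarPiece (g : TAdele F E) (a : TInf F E) :
    Measure.map (fun t => g * t) (haarPiece L μS μf a) = haarPiece L μS μf (g.1 * a) := by
  rw [← map_shift_eq L μS μf (g.1 * a) 0 1 g.2, haarPiece, Measure.map_map
    (continuous_const_mul g).measurable (continuous_param L a).measurable]
  congr 1
  funext p
  refine Prod.ext ?_ rfl
  change g.1 * (a * L.expVec p.1 * p.2.1) = g.1 * a * L.expVec (0 + p.1) * (1 * p.2.1 : L.compactPart)
  rw [zero_add, one_mul, mul_assoc, mul_assoc, mul_assoc]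

/-- Translation permutes the cosets of `T(F_∞)_+`, and the measure of a coset does not depend on its
representative. -/
theorem map_mul_haar (g : TAdele F E) :
    Measure.map (fun t => g * t) (haar L μS μf) = haar L μS μf := by
  rw [haar_eq_sum, Measure.map_sum (continuous_const_mul g).measurable.aemeasurable]
  have h : ∀ z : TInf F E ⧸ infPos F E,
      Measure.map (fun t => g * t) (haarPiece L μS μf z.out) =
      haarPiece L μS μf ((QuotientGroup.mk g.1 : TInf F E ⧸ infPos F E) * z).out := fun z => by
    rw [map_mul_haarPiece]
    refine haarPiece_congr L μS μf (QuotientGroup.eq.1 ?_)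
    refine (QuotientGroup.out_eq' _).trans ?_
    conv_lhs => rw [← QuotientGroup.out_eq' z]
    rfl
  simp only [h]
  ext A hA
  rw [Measure.sum_apply _ hA, Measure.sum_apply _ hA]
  exact (Equiv.mulLeft (QuotientGroup.mk g.1 : TInf F E ⧸ infPos F E)).tsum_eq
    fun z => haarPiece L μS μf z.out A

instance : SMulInvariantMeasure (diag F E).range (TAdele F E) (haar L μS μf) where
  measure_preimage_smul γ A hA := by
    conv_rhs => rw [← map_mul_haar L μS μf (γ : TAdele F E)]
    rw [Measure.map_apply (continuous_const_mul (γ : TAdele F E)).measurable hA]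
    rfl

instance : Countable (diag F E).range := (Set.countable_range (diag F E)).to_subtype

/-- The set of the `t` with `t_∞ ∈ T(F_∞)_+`, logarithm in the fundamental parallelotope of a basis
`b` of `ℝ^u` and `t_f ∈ 𝓕`. -/
def boxSet {L : SplitPlaces F E} (c : Ideal (𝓞 F)) (r : ClPos E c → TFin F E)
    (b : Module.Basis (Fin L.u) ℝ (Fin L.u → ℝ)) : Set (TAdele F E) :=
  {t | t.1 ∈ infPos F E ∧ L.logVec t.1 ∈ ZSpan.fundamentalDomain b ∧ t.2 ∈ finDomain E c r}

variable {L}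

theorem measurableSet_boxSet {c : Ideal (𝓞 F)} (hc : c ≠ ⊥) (r : ClPos E c → TFin F E)
    (b : Module.Basis (Fin L.u) ℝ (Fin L.u → ℝ)) : MeasurableSet (boxSet c r b) :=
  (isOpen_infPos.preimage continuous_fst).measurableSet.inter
    (((L.continuous_logVec.comp continuous_fst).measurable
      (ZSpan.fundamentalDomain_measurableSet b)).inter
    ((isOpen_finDomain hc r).preimage continuous_snd).measurableSet)

/-- Three corrections, none of which spoils the previous ones: weak approximation fixes the
archimedean component, then `T(F)_+` moves the finite part into `𝓕`, and `T(𝒪_F)_+` moves the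
logarithm into the parallelotope. -/
theorem exists_mul_mem_boxSet {c : Ideal (𝓞 F)} {r : ClPos E c → TFin F E}
    (hr : ∀ x, QuotientGroup.mk (r x) = x) {b : Module.Basis (Fin L.u) ℝ (Fin L.u → ℝ)}
    (hb : (Submodule.span ℤ (Set.range b) : Set (Fin L.u → ℝ)) = Set.range (unitLog L c))
    (t : TAdele F E) : ∃ γ : TRat F E, diag F E γ * t ∈ boxSet c r b := by
  obtain ⟨γ₁, h₁⟩ := exists_toInf_mem t.1⁻¹
  rw [inv_inv] at h₁
  obtain ⟨γ₂, h₂, h₂'⟩ := exists_finDomain_mul_eq c hr (toFin F E γ₁ * t.2)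
  obtain ⟨v, hv, -⟩ := ZSpan.exist_unique_vadd_mem_fundamentalDomain b
    (L.logVec (toInf F E (γ₂ * γ₁) * t.1))
  have hv' : (v : Fin L.u → ℝ) ∈ Set.range (unitLog L c) := hb ▸ v.2
  obtain ⟨γ₃, h₃⟩ := hv'
  have h4 : toInf F E (γ₂ * γ₁) * t.1 ∈ infPos F E := by
    rw [map_mul, mul_assoc, mul_comm _ t.1]
    exact mul_mem h₂ h₁
  refine ⟨γ₃ * (γ₂ * γ₁), ?_, ?_, ?_⟩
  · change toInf F E (γ₃ * (γ₂ * γ₁)) * t.1 ∈ infPos F E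
    rw [map_mul, mul_assoc]
    exact mul_mem γ₃.2.1 h4
  · change L.logVec (toInf F E (γ₃ * (γ₂ * γ₁)) * t.1) ∈ _
    rw [map_mul, mul_assoc, L.logVec_mul]
    change unitLog L c γ₃ + _ ∈ _
    rw [h₃]
    exact hv
  · change toFin F E (γ₃ * (γ₂ * γ₁)) * t.2 ∈ _
    rw [map_mul, map_mul, mul_assoc, mul_assoc]
    exact (mem_finDomain_mul_iff c hr h₂' γ₃.2.1).2 γ₃.2

theorem mul_mem_boxSet_iff {c : Ideal (𝓞 F)} {r : ClPos E c → TFin F E}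
    (hr : ∀ x, QuotientGroup.mk (r x) = x) {b : Module.Basis (Fin L.u) ℝ (Fin L.u → ℝ)}
    (hb : (Submodule.span ℤ (Set.range b) : Set (Fin L.u → ℝ)) = Set.range (unitLog L c))
    {t : TAdele F E} (ht : t ∈ boxSet c r b) (γ : TRat F E) :
    diag F E γ * t ∈ boxSet c r b ↔ ∃ δ : unitsPos E c, unitLog L c δ = 0 ∧ δ.1 = γ := by
  have hinf : toInf F E γ * t.1 ∈ infPos F E ↔ γ ∈ ratPos E :=
    (infPos F E).mul_mem_cancel_right ht.1
  constructor
  · rintro ⟨h1, h2, h3⟩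
    have hγ : γ ∈ ratPos E := hinf.1 h1
    have hγ' := (mem_finDomain_mul_iff c hr ht.2.2 hγ).1 h3
    refine ⟨⟨γ, hγ'⟩, ?_, rfl⟩
    change L.logVec (toInf F E γ * t.1) ∈ _ at h2
    rw [L.logVec_mul] at h2
    have hmem : unitLog L c ⟨γ, hγ'⟩ ∈ Submodule.span ℤ (Set.range b) := by
      rw [← SetLike.mem_coe, hb]; exact ⟨_, rfl⟩
    have huniq := (ZSpan.exist_unique_vadd_mem_fundamentalDomain b (L.logVec t.1)).unique
      (y₁ := ⟨_, hmem⟩) (y₂ := 0) h2 (by rw [zero_vadd]; exact ht.2.1)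
    exact congrArg Subtype.val huniq
  · rintro ⟨δ, hδ, rfl⟩
    refine ⟨hinf.2 δ.2.1, ?_, (mem_finDomain_mul_iff c hr ht.2.2 δ.2.1).2 δ.2⟩
    change L.logVec (toInf F E δ.1 * t.1) ∈ _
    rw [L.logVec_mul]
    change unitLog L c δ + _ ∈ _
    rw [hδ, zero_add]
    exact ht.2.1

/-- Once one translate is in the box, the others there differ from it by the elements of `T(𝒪_F)_+`
with zero logarithm, that is, the torsion; `T(F)` embeds in `T(𝔸_F)`, so these are distinct. -/
theorem encard_mul_mem_boxSet (hE : Module.finrank F E = 2) {c : Ideal (𝓞 F)}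
    {r : ClPos E c → TFin F E}
    (hr : ∀ x, QuotientGroup.mk (r x) = x) {b : Module.Basis (Fin L.u) ℝ (Fin L.u → ℝ)}
    (hb : (Submodule.span ℤ (Set.range b) : Set (Fin L.u → ℝ)) = Set.range (unitLog L c))
    (t : TAdele F E) :
    {γ : (diag F E).range | γ • t ∈ boxSet c r b}.encard = (torsionCard E c : ℕ∞) := by
  obtain ⟨γ₀, h₀⟩ := exists_mul_mem_boxSet hr hb t
  rw [torsionCard_eq L hE c, (finite_ker_unitLog L hE c).cast_ncard_eq]
  let f : unitsPos E c → (diag F E).range := fun δ => ⟨diag F E (δ.1 * γ₀), _, rfl⟩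
  have hf : Function.Injective f := fun δ δ' h =>
    Subtype.ext (mul_right_cancel (diag_injective (congrArg Subtype.val h)))
  rw [← hf.encard_image]
  congr 1
  ext ⟨_, γ, rfl⟩
  have h1 : (⟨diag F E γ, γ, rfl⟩ : (diag F E).range) • t = diag F E (γ * γ₀⁻¹) *
      (diag F E γ₀ * t) := by
    rw [← mul_assoc, ← map_mul, inv_mul_cancel_right]; rfl
  rw [Set.mem_setOf_eq, h1, mul_mem_boxSet_iff hr hb h₀]
  constructor
  · rintro ⟨δ, hδ, h⟩
    exact ⟨δ, hδ, Subtype.ext (congrArg (diag F E) (by rw [h, inv_mul_cancel_right]))⟩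
  · rintro ⟨δ, hδ, h⟩
    have := diag_injective (congrArg Subtype.val h)
    exact ⟨δ, hδ, by rw [← this, mul_inv_cancel_right]⟩

theorem boxSet_subset_image (c : Ideal (𝓞 F)) (r : ClPos E c → TFin F E)
    (b : Module.Basis (Fin L.u) ℝ (Fin L.u → ℝ)) :
    boxSet c r b ⊆ (fun p : (Fin L.u → ℝ) × L.compactPart × TFin F E =>
      ((1 * L.expVec p.1 * p.2.1, p.2.2) : TAdele F E)) ''
        (closure (ZSpan.fundamentalDomain b) ×ˢ Set.univ ×ˢ finDomain E c r) := by
  rintro t ⟨h1, h2, h3⟩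
  refine ⟨(L.logVec t.1, ⟨_, L.expVec_logVec_inv_mul_mem h1⟩, t.2),
    ⟨subset_closure h2, Set.mem_univ _, h3⟩, Prod.ext ?_ rfl⟩
  change 1 * L.expVec (L.logVec t.1) * ((L.expVec (L.logVec t.1))⁻¹ * t.1) = t.1
  rw [one_mul, mul_inv_cancel_left]

theorem isCompact_closedBox (hE : Module.finrank F E = 2) {c : Ideal (𝓞 F)} (hc : c ≠ ⊥)
    (r : ClPos E c → TFin F E) (b : Module.Basis (Fin L.u) ℝ (Fin L.u → ℝ)) :
    IsCompact (closure (ZSpan.fundamentalDomain b) ×ˢ (Set.univ : Set L.compactPart) ×ˢ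
      finDomain E c r) :=
  (ZSpan.fundamentalDomain_isBounded b).isCompact_closure.prod
    (isCompact_univ.prod (isCompact_finDomain L hE hc r))

/-- Discreteness: an element of `T(F)` near `1` lies in `T(𝒪_F)_+` with bounded logarithm, so it is
one of finitely many. Cocompactness: the closed box is compact and meets every orbit. -/
theorem exists_isFundamentalDomain_haar (hE : Module.finrank F E = 2) {c : Ideal (𝓞 F)}
    (hc : c ≠ ⊥) {r : ClPos E c → TFin F E}
    (hr : ∀ x, QuotientGroup.mk (r x) = x) {b : Module.Basis (Fin L.u) ℝ (Fin L.u → ℝ)}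
    (hb : (Submodule.span ℤ (Set.range b) : Set (Fin L.u → ℝ)) = Set.range (unitLog L c)) :
    ∃ D, IsFundamentalDomain (diag F E).range D (haar L μS μf) := by
  have hfin := finite_logVec_le L hE c zero_le_one
  set S := {γ : TRat F E | γ ∈ unitsPos E c ∧ ∀ i, |L.logVec (toInf F E γ) i| ≤ 1}
  have hS : IsClosed (toFin F E '' (S \ {1})) := ((hfin.subset Set.sdiff_subset).image _).isClosed
  -- The last condition removes the finitely many nontrivial candidates, by their finite components.
  let W : Set (TAdele F E) := {t | t.1 ∈ infPos F E ∧ L.logVec t.1 ∈ Metric.ball 0 1 ∧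
    t.2 ∈ maxCompact E c ∧ t.2 ∈ (toFin F E '' (S \ {1}))ᶜ}
  have hWo : IsOpen W :=
    (isOpen_infPos.preimage continuous_fst).inter
      ((Metric.isOpen_ball.preimage (L.continuous_logVec.comp continuous_fst)).inter
        (((isOpen_maxCompact hc).preimage continuous_snd).inter
          (hS.isOpen_compl.preimage continuous_snd)))
  have hW1 : (1 : TAdele F E) ∈ W := by
    refine ⟨one_mem _, ?_, one_mem _, ?_⟩
    · rw [Prod.fst_one, L.logVec_one]; simp
    · rintro ⟨γ, hγ, h⟩
      exact hγ.2 (toFin_injective (h.trans (map_one _).symm))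
  refine exists_isFundamentalDomain (diag F E).range
    ((isCompact_closedBox hE hc r b).image (continuous_param L 1)) (fun t => ?_)
    (hWo.mem_nhds hW1) ?_ _
  · obtain ⟨γ, hγ⟩ := exists_mul_mem_boxSet hr hb t
    exact ⟨⟨diag F E γ, γ, rfl⟩, boxSet_subset_image c r b hγ⟩
  · rintro _ ⟨γ, rfl⟩ ⟨h1, h2, h3, h4⟩
    have hγ : γ ∈ S := ⟨⟨h1, h3⟩, fun i => by
      rw [mem_ball_zero_iff] at h2
      exact (norm_le_pi_norm (L.logVec (toInf F E γ)) i).trans h2.le⟩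
    by_contra hne
    exact h4 ⟨γ, ⟨hγ, fun h => hne (by rw [h, map_one])⟩, rfl⟩

/-- The average of `φ` over `S × 𝓕`, as a function on `ℝ^u ≃ T(F_∞)_0`. -/
def avg (B : Set (TFin F E)) (φ : TAdele F E → ℂ) (x : Fin L.u → ℝ) : ℂ :=
  ∫ s : L.compactPart, ∫ t in B, φ (L.expVec x * s, t) ∂μf ∂μS

/-- Only the identity coset of `T(F_∞)_+` meets the box. -/
theorem haar_restrict_boxSet {c : Ideal (𝓞 F)} (hc : c ≠ ⊥) (r : ClPos E c → TFin F E)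
    (b : Module.Basis (Fin L.u) ℝ (Fin L.u → ℝ)) :
    (haar L μS μf).restrict (boxSet c r b) = (haarPiece L μS μf 1).restrict (boxSet c r b) := by
  have hB := measurableSet_boxSet hc r b
  ext A hA
  rw [Measure.restrict_apply hA, Measure.restrict_apply hA, haar_eq_sum,
    Measure.sum_apply _ (hA.inter hB), tsum_eq_single (1 : TInf F E ⧸ infPos F E)]
  · rw [haarPiece_congr L μS μf (a := 1)]
    rw [inv_one, one_mul, ← QuotientGroup.eq_one_iff]
    exact QuotientGroup.out_eq' _
  · intro z hz
    rw [haarPiece, Measure.map_apply (continuous_param L z.out).measurable (hA.inter hB)]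
    convert measure_empty (μ := volume.prod (μS.prod μf))
    rw [Set.eq_empty_iff_forall_notMem]
    rintro p ⟨-, hp, -⟩
    apply hz
    rw [← QuotientGroup.out_eq' z]
    change z.out * L.expVec p.1 * p.2.1 ∈ infPos F E at hp
    rw [mul_assoc] at hp
    exact (QuotientGroup.eq_one_iff _).2 (((infPos F E).mul_mem_cancel_right (mul_mem
      (L.expVec_mem_infPos _) (L.mem_compactPart.1 p.2.1.2).1)).1 hp)

theorem setIntegral_univ_prod {X Y : Type*} [MeasurableSpace X] [MeasurableSpace Y]
    {μ : Measure X} {ν : Measure Y} [SFinite μ] [SFinite ν] {B : Set Y} {f : X × Y → ℂ}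
    (hf : IntegrableOn f (Set.univ ×ˢ B) (μ.prod ν)) :
    ∫ p in Set.univ ×ˢ B, f p ∂(μ.prod ν) = ∫ x, ∫ y in B, f (x, y) ∂ν ∂μ := by
  rw [setIntegral_prod _ hf, Measure.restrict_univ]

theorem setIntegral_eq_avg (hE : Module.finrank F E = 2) {c : Ideal (𝓞 F)} (hc : c ≠ ⊥)
    (r : ClPos E c → TFin F E) {φ : TAdele F E → ℂ} (hφ : Continuous φ) (x : Fin L.u → ℝ) :
    ∫ p in (Set.univ : Set L.compactPart) ×ˢ finDomain E c r,
      φ (1 * L.expVec x * p.1, p.2) ∂(μS.prod μf) = avg μS μf (finDomain E c r) φ x := by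
  have hcl : IsClosed (finDomain E c r) := (isCompact_finDomain L hE hc r).isClosed
  have hint' : IntegrableOn (fun p : L.compactPart × TFin F E =>
      φ (1 * L.expVec x * p.1, p.2)) ((Set.univ : Set L.compactPart) ×ˢ finDomain E c r)
      (μS.prod μf) := by
    refine ContinuousOn.integrableOn_compact' (isCompact_univ.prod (isCompact_finDomain L hE hc r))
      (isClosed_univ.prod hcl).measurableSet (Continuous.continuousOn ?_)
    have h : Continuous fun p : L.compactPart × TFin F E =>
        ((1 * L.expVec x * p.1, p.2) : TAdele F E) := by fun_prop
    exact hφ.comp h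
  have h := setIntegral_univ_prod (X := L.compactPart) (Y := TFin F E) (μ := μS) (ν := μf)
    (B := finDomain E c r) (f := fun p => φ (1 * L.expVec x * p.1, p.2)) hint'
  rw [h, avg]
  simp only [one_mul]

theorem integral_boxSet (hE : Module.finrank F E = 2) {c : Ideal (𝓞 F)} (hc : c ≠ ⊥)
    (r : ClPos E c → TFin F E) (b : Module.Basis (Fin L.u) ℝ (Fin L.u → ℝ))
    {φ : TAdele F E → ℂ} (hφ : Continuous φ) :
    IntegrableOn φ (boxSet c r b) (haar L μS μf) ∧
      ∫ t in boxSet c r b, φ t ∂(haar L μS μf) =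
        ∫ x in ZSpan.fundamentalDomain b, avg μS μf (finDomain E c r) φ x := by
  have hB := measurableSet_boxSet hc r b
  have hp := continuous_param L (1 : TInf F E)
  have hpre : (fun p : (Fin L.u → ℝ) × L.compactPart × TFin F E =>
      ((1 * L.expVec p.1 * p.2.1, p.2.2) : TAdele F E)) ⁻¹' boxSet c r b =
      ZSpan.fundamentalDomain b ×ˢ (Set.univ : Set L.compactPart) ×ˢ finDomain E c r := by
    ext p
    have h1 : 1 * L.expVec p.1 * p.2.1 ∈ infPos F E := by
      rw [one_mul]
      exact mul_mem (L.expVec_mem_infPos _) (L.mem_compactPart.1 p.2.1.2).1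
    have h2 : L.logVec (1 * L.expVec p.1 * p.2.1) = p.1 := by
      rw [one_mul, L.logVec_mul, L.logVec_expVec, (L.mem_compactPart.1 p.2.1.2).2, add_zero]
    simp only [boxSet, Set.mem_preimage, Set.mem_setOf_eq, h1, h2, Set.mem_prod, Set.mem_univ,
      true_and]
  have hcl : IsClosed (finDomain E c r) := (isCompact_finDomain L hE hc r).isClosed
  have hint : IntegrableOn (fun p : (Fin L.u → ℝ) × L.compactPart × TFin F E =>
      φ (1 * L.expVec p.1 * p.2.1, p.2.2))
      (ZSpan.fundamentalDomain b ×ˢ (Set.univ : Set L.compactPart) ×ˢ finDomain E c r)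
      (volume.prod (μS.prod μf)) := by
    refine IntegrableOn.mono_set ((hφ.comp hp).continuousOn.integrableOn_compact'
      (isCompact_closedBox hE hc r b)
      (isClosed_closure.prod (isClosed_univ.prod hcl)).measurableSet) ?_
    exact Set.prod_mono subset_closure subset_rfl
  have hφm : AEStronglyMeasurable φ ((volume.prod (μS.prod μf)).restrict
      ((fun p : (Fin L.u → ℝ) × L.compactPart × TFin F E =>
        ((1 * L.expVec p.1 * p.2.1, p.2.2) : TAdele F E)) ⁻¹' boxSet c r b) |>.map
      (fun p : (Fin L.u → ℝ) × L.compactPart × TFin F E =>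
        ((1 * L.expVec p.1 * p.2.1, p.2.2) : TAdele F E))) :=
    hφ.aestronglyMeasurable
  rw [IntegrableOn, haar_restrict_boxSet μS μf hc, haarPiece, Measure.restrict_map hp.measurable hB,
    integrable_map_measure hφm hp.measurable.aemeasurable, hpre,
    integral_map hp.measurable.aemeasurable (by rwa [hpre] at hφm)]
  refine ⟨hint, ?_⟩
  rw [setIntegral_prod _ hint]
  refine setIntegral_congr_fun (ZSpan.fundamentalDomain_measurableSet b) fun x _ => ?_
  exact setIntegral_eq_avg μS μf hE hc r hφ x

theorem integral_isFundamentalDomain (hE : Module.finrank F E = 2) {c : Ideal (𝓞 F)}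
    (hc : c ≠ ⊥) {r : ClPos E c → TFin F E}
    (hr : ∀ x, QuotientGroup.mk (r x) = x) {b : Module.Basis (Fin L.u) ℝ (Fin L.u → ℝ)}
    (hb : (Submodule.span ℤ (Set.range b) : Set (Fin L.u → ℝ)) = Set.range (unitLog L c))
    {φ : TAdele F E → ℂ} (hφ : Continuous φ) (hφΓ : ∀ γ t, φ (diag F E γ * t) = φ t)
    {D : Set (TAdele F E)} (hD : IsFundamentalDomain (diag F E).range D (haar L μS μf)) :
    IntegrableOn φ D (haar L μS μf) ∧
      ∫ x in ZSpan.fundamentalDomain b, avg μS μf (finDomain E c r) φ x =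
        torsionCard E c * ∫ t in D, φ t ∂(haar L μS μf) := by
  obtain ⟨h1, h2⟩ := integral_boxSet μS μf hE hc r b hφ
  rw [← h2]
  refine integral_eq_mul_of_isFundamentalDomain hD (measurableSet_boxSet hc r b) ?_
    (encard_mul_mem_boxSet hE hr hb) hφ.measurable ?_ h1
  · rw [torsionCard_eq L hE c]
    exact (Set.ncard_pos (finite_ker_unitLog L hE c)).2
      ⟨1, map_zero (unitLogHom L c)⟩ |>.ne'
  · rintro ⟨_, γ, rfl⟩ t
    exact hφΓ γ t

end Haar


/-! ### The pairing of cochains and chains -/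

section Pairing

variable {F E : Type} [Field F] [NumberField F] [Field E] [NumberField E] [Algebra F E]
variable {L : SplitPlaces F E}

theorem continuous_of_mem_ccFun {b : TAdele F E → ℤ} (hb : b ∈ ccFun L) : Continuous b := by
  rw [Int.isClosedEmbedding_coe_real.isEmbedding.continuous_iff]
  have h : ((↑) : ℤ → ℝ) ∘ b = fun t => Complex.re (b t : ℂ) := by
    funext t; simp
  rw [h]
  exact Complex.continuous_re.comp hb.1.1

/-- A continuous integer-valued function is constant on the connected set `a T(F_∞)_+`. -/
theorem apply_mul_of_mem_ccFun {b : TAdele F E → ℤ} (hb : b ∈ ccFun L) (a : TInf F E)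
    {h : TInf F E} (hh : h ∈ infPos F E) (t : TFin F E) : b (a * h, t) = b (a, t) := by
  have hc : Continuous fun h : TInf F E => b (a * h, t) :=
    (continuous_of_mem_ccFun hb).comp ((continuous_const_mul a).prodMk continuous_const)
  have h1 : IsPreconnected (infPos F E : Set (TInf F E)) := isPreconnected_connectedComponent
  simpa using h1.constant hc.continuousOn hh (one_mem (infPos F E))

theorem apply_mul_expVec {f : TAdele F E → ℂ} (hf : f ∈ smoothFun L (tail L L.u)) (a : TInf F E)
    (x : Fin L.u → ℝ) (t : TFin F E) : f (a * L.expVec x, t) = f (a, t) := by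
  have h : ∀ s : Finset (Fin L.u), ∀ a, f (a * ∏ i ∈ s, L.oneParam i (x i), t) = f (a, t) := by
    intro s
    induction s using Finset.cons_induction with
    | empty => simp
    | cons i s his ih =>
      intro a
      rw [Finset.prod_cons, mul_left_comm, mul_comm, ← ih a]
      -- `tail L L.u` is empty, so invariance holds in every direction.
      exact hf.2.2 i (fun h => absurd i.2 (not_lt.2 h)) _ _ _
  exact h _ a

variable (μS : Measure L.compactPart) (μf : Measure (TFin F E))
  [μS.IsHaarMeasure] [μf.IsHaarMeasure] [CompactSpace L.compactPart]
  [SigmaCompactSpace (TFin F E)]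

/-- The contribution of the coset `a T(F_∞)_+` to the pairing. -/
def piece (a : TInf F E) (f : TAdele F E → ℂ) (b : TAdele F E → ℤ) : ℂ :=
  ∫ p : L.compactPart × TFin F E, f (a * p.1, p.2) * (b (a * p.1, p.2) : ℂ) ∂(μS.prod μf)

theorem integrable_piece (a : TInf F E) {f : TAdele F E → ℂ} (hf : Continuous f)
    {b : TAdele F E → ℤ} (hb : b ∈ ccFun L) :
    Integrable (fun p : L.compactPart × TFin F E =>
      f (a * p.1, p.2) * (b (a * p.1, p.2) : ℂ)) (μS.prod μf) := by
  have hp : Continuous fun p : L.compactPart × TFin F E => ((a * p.1, p.2) : TAdele F E) := by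
    fun_prop
  refine Continuous.integrable_of_hasCompactSupport ((hf.comp hp).mul (hb.1.1.comp hp)) ?_
  refine HasCompactSupport.intro' (K := Set.univ ×ˢ tsupport fun t => b (a, t))
    (isCompact_univ.prod (hb.2 a)) (isClosed_univ.prod (isClosed_tsupport _)) fun p hp' => ?_
  have h1 : p.2 ∉ tsupport fun t => b (a, t) := fun h => hp' ⟨Set.mem_univ _, h⟩
  have h2 : b (a, p.2) = 0 := image_eq_zero_of_notMem_tsupport (f := fun t => b (a, t)) h1
  rw [apply_mul_of_mem_ccFun hb a (L.mem_compactPart.1 p.1.2).1, h2, Int.cast_zero, mul_zero]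

theorem pairing_eq_finsum {f : TAdele F E → ℂ} (hf : Continuous f)
    {b : TAdele F E → ℤ} (hb : b ∈ ccFun L) :
    pairing L μS μf f b = ∑ᶠ z : TInf F E ⧸ infPos F E, piece μS μf z.out f b :=
  finsum_congr fun z => (integral_prod _ (integrable_piece μS μf z.out hf hb)).symm

theorem integral_shift (s : L.compactPart) (t : TFin F E) (f : L.compactPart × TFin F E → ℂ)
    (hf : Continuous f) : ∫ p, f (s * p.1, t * p.2) ∂(μS.prod μf) = ∫ p, f p ∂(μS.prod μf) := by
  have h := (measurePreserving_mul_left μS s).prod (measurePreserving_mul_left μf t)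
  conv_rhs => rw [← h.map_eq]
  rw [integral_map h.measurable.aemeasurable hf.aestronglyMeasurable]
  rfl

/-- Write `h = e^v s`. The function `f` does not see `e^v`, the Haar measure of `S` does not see
`s`, and `b` is constant on the coset. So the pairing does not depend on the chosen representatives,
which underlies its `T(F)`-invariance. -/
theorem piece_mul {f : TAdele F E → ℂ} (hf : f ∈ smoothFun L (tail L L.u))
    {b : TAdele F E → ℤ} (hb : b ∈ ccFun L) (a : TInf F E) {h : TInf F E} (hh : h ∈ infPos F E) :
    piece μS μf (a * h) f b = piece μS μf a f b := by
  have hp : Continuous fun p : L.compactPart × TFin F E => ((a * p.1, p.2) : TAdele F E) := by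
    fun_prop
  have hs := integral_shift μS μf ⟨_, L.expVec_logVec_inv_mul_mem hh⟩ 1
    (fun p => f (a * p.1, p.2) * (b (a * p.1, p.2) : ℂ)) ((hf.1.comp hp).mul (hb.1.1.comp hp))
  rw [piece, piece, ← hs]
  refine integral_congr_ae (Filter.Eventually.of_forall fun p => ?_)
  have hp1 := (L.mem_compactPart.1 p.1.2).1
  have h1 : b (a * h * p.1, p.2) = b (a, p.2) := by
    rw [mul_assoc, apply_mul_of_mem_ccFun hb a (mul_mem hh hp1)]
  have h2 : ∀ s : L.compactPart, b (a * s, p.2) = b (a, p.2) := fun s =>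
    apply_mul_of_mem_ccFun hb a (L.mem_compactPart.1 s.2).1 _
  simp only [one_mul, h1, h2]
  congr 1
  refine Eq.trans ?_ (apply_mul_expVec hf _ (L.logVec h) _)
  congr 2
  change a * h * (p.1 : TInf F E) =
    a * ((L.expVec (L.logVec h))⁻¹ * h * (p.1 : TInf F E)) * L.expVec (L.logVec h)
  generalize L.expVec (L.logVec h) = x
  rw [mul_assoc a _ x, mul_assoc x⁻¹, mul_assoc x⁻¹, mul_comm _ x, inv_mul_cancel_left, mul_assoc]

theorem piece_translate {f : TAdele F E → ℂ} (hf : Continuous f)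
    {b : TAdele F E → ℤ} (hb : b ∈ ccFun L) (γ : TRat F E) (a : TInf F E) :
    piece μS μf a (translate γ f) (translate γ b) =
      piece μS μf ((toInf F E γ)⁻¹ * a) f b := by
  have hp : Continuous fun p : L.compactPart × TFin F E =>
      (((toInf F E γ)⁻¹ * a * p.1, p.2) : TAdele F E) := by fun_prop
  have h := integral_shift μS μf 1 (toFin F E γ)⁻¹
    (fun p => f ((toInf F E γ)⁻¹ * a * p.1, p.2) * (b ((toInf F E γ)⁻¹ * a * p.1, p.2) : ℂ))
    ((hf.comp hp).mul (hb.1.1.comp hp))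
  rw [piece, piece, ← h]
  refine integral_congr_ae (Filter.Eventually.of_forall fun p => ?_)
  have h : (diag F E γ)⁻¹ * ((a * p.1, p.2) : TAdele F E) =
      ((toInf F E γ)⁻¹ * a * p.1, (toFin F E γ)⁻¹ * p.2) := Prod.ext (mul_assoc _ _ _).symm rfl
  simp only [translate, h, one_mul]

variable [Finite (TInf F E ⧸ infPos F E)]

theorem pairing_translate {f : TAdele F E → ℂ} (hf : f ∈ smoothFun L (tail L L.u))
    {b : TAdele F E → ℤ} (hb : b ∈ ccFun L) (γ : TRat F E) :
    pairing L μS μf (translate γ f) (translate γ b) = pairing L μS μf f b := by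
  rw [pairing_eq_finsum μS μf (translate_mem L hf γ).1 (translate_mem_ccFun L γ hb),
    pairing_eq_finsum μS μf hf.1 hb]
  let g : TInf F E ⧸ infPos F E := QuotientGroup.mk (toInf F E γ)⁻¹
  conv_rhs => rw [← finsum_comp_equiv (Equiv.mulLeft g)]
  refine finsum_congr fun z => ?_
  rw [piece_translate μS μf hf.1 hb]
  have h : ((toInf F E γ)⁻¹ * z.out)⁻¹ * (g * z).out ∈ infPos F E := by
    rw [← QuotientGroup.eq]
    refine Eq.trans ?_ (QuotientGroup.out_eq' _).symm
    conv_rhs => rw [← QuotientGroup.out_eq' z]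
    rfl
  rw [← piece_mul μS μf hf hb ((toInf F E γ)⁻¹ * z.out) h, mul_inv_cancel_left]
  rfl

theorem pairing_add_left {f f' : TAdele F E → ℂ} (hf : Continuous f) (hf' : Continuous f')
    {b : TAdele F E → ℤ} (hb : b ∈ ccFun L) :
    pairing L μS μf (f + f') b = pairing L μS μf f b + pairing L μS μf f' b := by
  rw [pairing_eq_finsum μS μf (hf.add hf') hb, pairing_eq_finsum μS μf hf hb,
    pairing_eq_finsum μS μf hf' hb, ← finsum_add_distrib (Set.toFinite _) (Set.toFinite _)]
  refine finsum_congr fun z => ?_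
  rw [piece, piece, piece, ← integral_add (integrable_piece μS μf _ hf hb)
    (integrable_piece μS μf _ hf' hb)]
  simp only [Pi.add_apply, add_mul]

theorem pairing_smul_left (a : ℂ) {f : TAdele F E → ℂ} (hf : Continuous f)
    {b : TAdele F E → ℤ} (hb : b ∈ ccFun L) :
    pairing L μS μf (a • f) b = a * pairing L μS μf f b := by
  rw [pairing_eq_finsum μS μf (hf.const_smul a) hb, pairing_eq_finsum μS μf hf hb,
    mul_finsum' _ _ (Set.toFinite _)]
  refine finsum_congr fun z => ?_
  rw [piece, piece, ← integral_const_mul]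
  simp only [Pi.smul_apply, smul_eq_mul, mul_assoc]

theorem pairing_add_right {f : TAdele F E → ℂ} (hf : Continuous f)
    {b b' : TAdele F E → ℤ} (hb : b ∈ ccFun L) (hb' : b' ∈ ccFun L) :
    pairing L μS μf f (b + b') = pairing L μS μf f b + pairing L μS μf f b' := by
  rw [pairing_eq_finsum μS μf hf (add_mem hb hb'), pairing_eq_finsum μS μf hf hb,
    pairing_eq_finsum μS μf hf hb', ← finsum_add_distrib (Set.toFinite _) (Set.toFinite _)]
  refine finsum_congr fun z => ?_
  rw [piece, piece, piece, ← integral_add (integrable_piece μS μf _ hf hb)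
    (integrable_piece μS μf _ hf hb')]
  simp only [Pi.add_apply, Int.cast_add, mul_add]

/-- The pairing as a linear map to additive functionals. -/
def pairingHom : smoothFun L (tail L L.u) →ₗ[ℂ] (ccFun L →+ ℂ) where
  toFun f := AddMonoidHom.mk' (fun b => pairing L μS μf f.1 b.1)
    fun b b' => pairing_add_right μS μf f.2.1 b.2 b'.2
  map_add' f f' := AddMonoidHom.ext fun b => pairing_add_left μS μf f.2.1 f'.2.1 b.2
  map_smul' a f := AddMonoidHom.ext fun b => pairing_smul_left μS μf a f.2.1 b.2

/-- The pairing of cochains and chains. -/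
def chainPair {n : ℕ} (z : (Fin n → TRat F E) → smoothFun L (tail L L.u)) :
    ((Fin n → TRat F E) →₀ ccFun L) →+ ℂ :=
  Finsupp.liftAddHom fun g => pairingHom μS μf (z g)

theorem chainPair_single {n : ℕ} (z : (Fin n → TRat F E) → smoothFun L (tail L L.u))
    (g : Fin n → TRat F E) (b : ccFun L) :
    chainPair μS μf z (Finsupp.single g b) = pairingHom μS μf (z g) b :=
  Finsupp.liftAddHom_apply_single _ _ _

theorem chainPair_sub {n : ℕ} (z z' : (Fin n → TRat F E) → smoothFun L (tail L L.u))
    (y : (Fin n → TRat F E) →₀ ccFun L) :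
    chainPair μS μf (z - z') y = chainPair μS μf z y - chainPair μS μf z' y := by
  induction y using Finsupp.induction_linear with
  | zero => simp
  | add y y' h h' => rw [map_add, map_add, map_add, h, h']; ring
  | single g b =>
    rw [chainPair_single, chainPair_single, chainPair_single, Pi.sub_apply, map_sub]
    rfl

theorem chainPair_zero {n : ℕ} (y : (Fin n → TRat F E) →₀ ccFun L) :
    chainPair μS μf (0 : (Fin n → TRat F E) → smoothFun L (tail L L.u)) y = 0 := by
  rw [← sub_self (0 : (Fin n → TRat F E) → smoothFun L (tail L L.u)), chainPair_sub, sub_self]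

theorem pairingHom_rho (γ : TRat F E) (f : smoothFun L (tail L L.u)) (b : ccFun L) :
    pairingHom μS μf ((smoothRep L (tail L L.u)).ρ γ f) b =
      pairingHom μS μf f ((ccRep L).ρ γ⁻¹ b) := by
  have h := pairing_translate μS μf f.2 (translate_mem_ccFun L γ⁻¹ b.2) γ
  have h1 : translate γ (translate γ⁻¹ b.1) = b.1 := by
    funext t
    change b.1 ((diag F E γ⁻¹)⁻¹ * ((diag F E γ)⁻¹ * t)) = b.1 t
    rw [map_inv, inv_inv, mul_inv_cancel_left]
  rw [h1] at h
  exact h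

/-- The coboundary and the boundary are adjoint: their inner and last faces are the same, and in the
first face invariance of the pairing moves the action of `g 0` on the cochain to that of `(g 0)⁻¹`
on the chain. -/
theorem chainPair_d {n : ℕ} (z : (Fin n → TRat F E) → smoothFun L (tail L L.u))
    (y : (Fin (n + 1) → TRat F E) →₀ ccFun L) :
    chainPair μS μf ((inhomogeneousCochains.d (smoothRep L (tail L L.u)) n).hom z :
      (Fin (n + 1) → TRat F E) → smoothFun L (tail L L.u)) y =
    chainPair μS μf z ((groupHomology.inhomogeneousChains.d (ccRep L) n).hom y :
      (Fin n → TRat F E) →₀ ccFun L) := by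
  induction y using Finsupp.induction_linear with
  | zero => rw [map_zero]; exact ((congrArg _ (map_zero _)).trans (map_zero _)).symm
  | add y y' h h' =>
    rw [map_add, h, h']
    exact ((congrArg (chainPair μS μf z) (map_add _ _ _)).trans (map_add _ _ _)).symm
  | single g b =>
    have h1 : (groupHomology.inhomogeneousChains.d (ccRep L) n).hom (Finsupp.single g b) =
      (Finsupp.single (fun i => g i.succ) ((ccRep L).ρ (g 0)⁻¹ b) : (Fin n → TRat F E) →₀ ccFun L) +
      ∑ j : Fin (n + 1), (-1 : ℤ) ^ ((j : ℕ) + 1) •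
        (Finsupp.single (Fin.contractNth j (· * ·) g) b : (Fin n → TRat F E) →₀ ccFun L) :=
      groupHomology.inhomogeneousChains.d_single (A := ccRep L) n g b
    have h2 : ((inhomogeneousCochains.d (smoothRep L (tail L L.u)) n).hom z :
      (Fin (n + 1) → TRat F E) → smoothFun L (tail L L.u)) g =
      (smoothRep L (tail L L.u)).ρ (g 0) (z fun i => g i.succ) +
      ∑ j : Fin (n + 1), (-1 : ℂ) ^ ((j : ℕ) + 1) • z (Fin.contractNth j (· * ·) g) := rfl
    rw [chainPair_single, h2, h1, map_add, map_add, AddMonoidHom.add_apply, pairingHom_rho,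
      chainPair_single, map_sum, map_sum, AddMonoidHom.finsetSum_apply]
    congr 1
    refine Finset.sum_congr rfl fun j _ => ?_
    rw [map_smul, map_zsmul, chainPair_single]
    change (-1 : ℂ) ^ ((j : ℕ) + 1) * _ = _
    rw [zsmul_eq_mul]
    push_cast
    rfl

end Pairing

/-! ### Independence of the cap product from the chosen cocycle and cycle. -/

section WellDefined

theorem exists_toCycles_eq {k : Type} [CommRing k] {ι : Type} {c : ComplexShape ι}
    (K : HomologicalComplex (ModuleCat.{0} k) c) {i j : ι} (hij : c.prev j = i)
    {z z' : K.cycles j} (h : K.homologyπ j z = K.homologyπ j z') :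
    ∃ w : K.X i, K.iCycles j z - K.iCycles j z' = K.d i j w := by
  have hex := ShortComplex.exact_of_g_is_cokernel
    (ShortComplex.mk _ _ (K.toCycles_comp_homologyπ i j)) (K.homologyIsCokernel i j hij)
  rw [ShortComplex.moduleCat_exact_iff] at hex
  obtain ⟨w, hw⟩ := hex (z - z') (by
    change K.homologyπ j (z - z') = 0
    rw [map_sub, h, sub_self])
  refine ⟨w, ?_⟩
  have h2 : K.iCycles j (K.toCycles i j w) = K.d i j w := by
    rw [← K.toCycles_i i j]; rfl
  rw [← h2, ← map_sub]
  exact congrArg (K.iCycles j) hw.symm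

theorem d_iCycles_apply {k : Type} [CommRing k] {ι : Type} {c : ComplexShape ι}
    (K : HomologicalComplex (ModuleCat.{0} k) c) (j l : ι) (z : K.cycles j) :
    K.d j l (K.iCycles j z) = 0 := by
  have : (K.iCycles j ≫ K.d j l) z = 0 := by rw [K.iCycles_d]; rfl
  exact this

variable {F E : Type} [Field F] [NumberField F] [Field E] [NumberField E] [Algebra F E]
variable {L : SplitPlaces F E}
variable (μS : Measure L.compactPart) (μf : Measure (TFin F E))
  [μS.IsHaarMeasure] [μf.IsHaarMeasure] [CompactSpace L.compactPart]
  [SigmaCompactSpace (TFin F E)] [Finite (TInf F E ⧸ infPos F E)]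

theorem chainPair_eq_of_cohomologous {n : ℕ}
    {z z' : groupCohomology.cocycles (smoothRep L (tail L L.u)) n}
    (hz : groupCohomology.π _ n z = groupCohomology.π _ n z')
    (y : groupHomology.cycles (ccRep L) n) :
    chainPair μS μf (groupCohomology.iCocycles (smoothRep L (tail L L.u)) n z :
        (Fin n → TRat F E) → smoothFun L (tail L L.u))
      (groupHomology.iCycles (ccRep L) n y : (Fin n → TRat F E) →₀ ccFun L) =
    chainPair μS μf (groupCohomology.iCocycles (smoothRep L (tail L L.u)) n z' :
        (Fin n → TRat F E) → smoothFun L (tail L L.u))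
      (groupHomology.iCycles (ccRep L) n y : (Fin n → TRat F E) →₀ ccFun L) := by
  rw [← sub_eq_zero, ← chainPair_sub]
  cases n with
  | zero =>
    -- There is nothing before degree `0`: the preceding index is a dummy with zero differential, so
    -- the cocycles are equal.
    obtain ⟨w, hw⟩ := exists_toCycles_eq _ rfl hz
    rw [HomologicalComplex.shape _ _ _ (by simp)] at hw
    refine (congrArg (fun f => chainPair μS μf f _) hw).trans ?_
    exact chainPair_zero μS μf _
  | succ n =>
    obtain ⟨w, hw⟩ := exists_toCycles_eq _ (CochainComplex.prev_nat_succ n) hz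
    rw [groupCohomology.inhomogeneousCochains.d_def] at hw
    refine (congrArg (fun f => chainPair μS μf f _) hw).trans ?_
    refine (chainPair_d μS μf w _).trans ?_
    have h := d_iCycles_apply _ (n + 1) n y
    rw [groupHomology.inhomogeneousChains.d_def] at h
    exact (congrArg (chainPair μS μf w) h).trans (map_zero _)

theorem chainPair_eq_of_homologous {n : ℕ}
    (z : groupCohomology.cocycles (smoothRep L (tail L L.u)) n)
    {y y' : groupHomology.cycles (ccRep L) n}
    (hy : groupHomology.π _ n y = groupHomology.π _ n y') :
    chainPair μS μf (groupCohomology.iCocycles (smoothRep L (tail L L.u)) n z :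
        (Fin n → TRat F E) → smoothFun L (tail L L.u))
      (groupHomology.iCycles (ccRep L) n y : (Fin n → TRat F E) →₀ ccFun L) =
    chainPair μS μf (groupCohomology.iCocycles (smoothRep L (tail L L.u)) n z :
        (Fin n → TRat F E) → smoothFun L (tail L L.u))
      (groupHomology.iCycles (ccRep L) n y' : (Fin n → TRat F E) →₀ ccFun L) := by
  rw [← sub_eq_zero, ← map_sub]
  obtain ⟨w, hw⟩ := exists_toCycles_eq _ (ChainComplex.prev ℕ n) hy
  rw [groupHomology.inhomogeneousChains.d_def] at hw
  refine (congrArg (chainPair μS μf _) hw).trans ?_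
  refine (chainPair_d μS μf _ w).symm.trans ?_
  have h := d_iCycles_apply _ n (n + 1) z
  rw [groupCohomology.inhomogeneousCochains.d_def] at h
  refine (congrArg (fun f => chainPair μS μf f w) h).trans ?_
  exact chainPair_zero μS μf w

end WellDefined



/-! ### Explicit cocycles for the iterated connecting homomorphism -/

section Cocycle

variable {F E : Type} [Field F] [NumberField F] [Field E] [NumberField E] [Algebra F E]
variable (L : SplitPlaces F E)

/-- The values of the cocycle that represents the image of `φ` under the first `n` connecting
homomorphisms. -/
def iterCocycle (φ : TAdele F E → ℂ) :
    ∀ n : ℕ, n ≤ L.u → (Fin n → TRat F E) → TAdele F E → ℂ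
  | 0, _, _ => φ
  | n + 1, hn, g =>
    translate (g 0) (primitive L ⟨n, hn⟩
      (iterCocycle φ n (Nat.le_of_succ_le hn) fun i => g i.succ)) -
    primitive L ⟨n, hn⟩ (translate (g 0)
      (iterCocycle φ n (Nat.le_of_succ_le hn) fun i => g i.succ))

theorem primitive_add {f g : TAdele F E → ℂ} (hf : Continuous f) (hg : Continuous g)
    (i : Fin L.u) : primitive L i (f + g) = primitive L i f + primitive L i g := by
  have hc : ∀ {f : TAdele F E → ℂ}, Continuous f → ∀ t : TAdele F E, Continuous fun y : ℝ =>
      ((L.logAbs i t.1).toAdd : ℂ) *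
        f (t.1 * L.oneParam i ((y - 1) * (L.logAbs i t.1).toAdd), t.2) := fun hf t =>
    continuous_const.mul (hf.comp (((continuous_const_mul t.1).comp ((continuous_oneParam L i).comp
      ((continuous_id.sub continuous_const).mul continuous_const))).prodMk continuous_const))
  funext t
  rw [Pi.add_apply, primitive, primitive, primitive, ← intervalIntegral.integral_add
    ((hc hf t).intervalIntegrable _ _) ((hc hg t).intervalIntegrable _ _)]
  simp only [Pi.add_apply, mul_add]

theorem primitive_smul (a : ℂ) (f : TAdele F E → ℂ) (i : Fin L.u) :
    primitive L i (a • f) = a • primitive L i f := by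
  funext t
  rw [Pi.smul_apply, primitive, primitive, smul_eq_mul, ← intervalIntegral.integral_const_mul]
  simp only [Pi.smul_apply, smul_eq_mul]
  congr 1
  funext y
  ring

/-- The primitive as a linear map on `C^Σ`. -/
def primitiveHom {J : Set (Fin L.u)} {i : Fin L.u} (hi : i ∈ J) :
    smoothFun L J →ₗ[ℂ] derivDomain L J i where
  toFun f := ⟨primitive L i f.1, primitive_mem L hi f.2,
    (lieDeriv_primitive L i f.2).symm ▸ f.2⟩
  map_add' f g := Subtype.ext (primitive_add L f.2.1 g.2.1 i)
  map_smul' a f := Subtype.ext (primitive_smul L a f.1 i)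

theorem iCocycles_injective {k G : Type} [CommRing k] [Group G] (A : Rep.{0} k G) (n : ℕ) :
    Function.Injective (groupCohomology.iCocycles A n) :=
  (ModuleCat.mono_iff_injective _).1 inferInstance

/-- Apply the linear map `P` to the cocycle identity for `z`: the faces without action sum to `-P(g₀
z)`. Only the failure of `P` to be equivariant remains. -/
theorem d_primitive_apply {J : Set (Fin L.u)} {i : Fin L.u} (hi : i ∈ J) {n : ℕ}
    {z : (Fin n → TRat F E) → smoothFun L J}
    (hz : inhomogeneousCochains.d (smoothRep L J) n z = 0)
    (g : Fin (n + 1) → TRat F E) :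
    ((inhomogeneousCochains.d (derivRep L J i) n fun g => primitiveHom L hi (z g) :
      (Fin (n + 1) → TRat F E) → derivDomain L J i) g).1 =
    translate (g 0) (primitive L i (z fun i => g i.succ).1) -
      primitive L i (translate (g 0) (z fun i => g i.succ).1) := by
  have h1 : (smoothRep L J).ρ (g 0) (z fun i => g i.succ) +
      ∑ j : Fin (n + 1), (-1 : ℂ) ^ ((j : ℕ) + 1) • z (Fin.contractNth j (· * ·) g) = 0 :=
    congrFun hz g
  have h2 := congrArg (primitiveHom L hi) h1
  rw [map_add, map_sum, map_zero] at h2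
  simp only [map_smul] at h2
  have h3 : (inhomogeneousCochains.d (derivRep L J i) n fun g => primitiveHom L hi (z g) :
      (Fin (n + 1) → TRat F E) → derivDomain L J i) g =
    (derivRep L J i).ρ (g 0) (primitiveHom L hi (z fun i => g i.succ)) +
      ∑ j : Fin (n + 1), (-1 : ℂ) ^ ((j : ℕ) + 1) •
        primitiveHom L hi (z (Fin.contractNth j (· * ·) g)) := rfl
  rw [h3, eq_neg_of_add_eq_zero_right h2]
  exact (sub_eq_add_neg _ _).symm

/-- Both terms are primitives of the same function, as `δ_σ` commutes with translation. -/
theorem translate_primitive_sub_mem {J : Set (Fin L.u)} {i : Fin L.u} (hi : i ∈ J)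
    {f : TAdele F E → ℂ} (hf : f ∈ smoothFun L J) (γ : TRat F E) :
    translate γ (primitive L i f) - primitive L i (translate γ f) ∈ smoothFun L (J \ {i}) := by
  have h1 := translate_mem L (primitive_mem L hi hf) γ
  have h2 := primitive_mem L hi (translate_mem L hf γ)
  refine mem_of_lieDeriv_eq_zero L (sub_mem h1 h2) ?_
  have h3 : lieDeriv L i (translate γ (primitive L i f) - primitive L i (translate γ f)) =
      lieDeriv L i (translate γ (primitive L i f)) -
        lieDeriv L i (primitive L i (translate γ f)) := funext fun t =>
    deriv_sub (differentiable_oneParam L h1 i t) (differentiable_oneParam L h2 i t)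
  rw [h3, lieDeriv_translate, lieDeriv_primitive L i hf,
    lieDeriv_primitive L i (translate_mem L hf γ), sub_self]

/-- The connecting map is computed by lifting the cocycle along `δ_σ` with `primitive` and taking
the coboundary of the lift. -/
theorem exists_cocycle_eq_iterCocycle (φ : (smoothRep L (tail L 0)).ρ.invariants) (n : ℕ)
    (hn : n ≤ L.u) : ∃ z : groupCohomology.cocycles (smoothRep L (tail L n)) n,
      groupCohomology.π (smoothRep L (tail L n)) n z =
        iterConn L n hn ((groupCohomology.H0Iso (smoothRep L (tail L 0))).inv φ) ∧
      ∀ g, ((groupCohomology.iCocycles (smoothRep L (tail L n)) n z :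
        (Fin n → TRat F E) → smoothFun L (tail L n)) g).1 = iterCocycle L φ.1.1 n hn g := by
  induction n with
  | zero =>
    refine ⟨(groupCohomology.cocyclesIso₀ (smoothRep L (tail L 0))).inv φ, ?_, fun g => ?_⟩
    · rfl
    · rw [groupCohomology.cocyclesIso₀_inv_comp_iCocycles_apply]
      rfl
  | succ n ih =>
    obtain ⟨z, hz, hzg⟩ := ih (Nat.le_of_succ_le hn)
    let i : Fin L.u := ⟨n, hn⟩
    have hi : i ∈ tail L n := Nat.le_refl n
    let zf : (Fin n → TRat F E) → smoothFun L (tail L n) :=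
      groupCohomology.iCocycles (smoothRep L (tail L n)) n z
    have hd : inhomogeneousCochains.d (smoothRep L (tail L n)) n zf = 0 := by
      have h := d_iCycles_apply _ n (n + 1) z
      rw [groupCohomology.inhomogeneousCochains.d_def] at h
      exact h
    let y : (Fin n → TRat F E) → derivDomain L (tail L n) i := fun g => primitiveHom L hi (zf g)
    have hdy := d_primitive_apply L hi hd
    let S := seq (tail_succ L i)
    have hS : S.ShortExact := seq_shortExact (tail_succ L i) hi
    have hdx : ∀ g, ((inhomogeneousCochains.d (derivRep L (tail L n) i) n y :
        (Fin (n + 1) → TRat F E) → derivDomain L (tail L n) i) g).1 =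
        iterCocycle L φ.1.1 (n + 1) hn g := fun g => by
      rw [hdy, hzg]
      rfl
    have hmem : ∀ g, iterCocycle L φ.1.1 (n + 1) hn g ∈ smoothFun L (tail L (n + 1)) := fun g => by
      have h1 := translate_primitive_sub_mem L hi (zf fun i => g i.succ).2 (g 0)
      rw [hzg] at h1
      rw [tail_succ L i]
      exact h1
    let x : (Fin (n + 1) → TRat F E) → smoothFun L (tail L (n + 1)) := fun g =>
      ⟨iterCocycle L φ.1.1 (n + 1) hn g, hmem g⟩
    have hx : S.f.hom ∘ x =
        (groupCohomology.inhomogeneousCochains (derivRep L (tail L n) i)).d n (n + 1) y := by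
      rw [groupCohomology.inhomogeneousCochains.d_def]
      exact funext fun g => Subtype.ext (hdx g).symm
    have hz' : (groupCohomology.inhomogeneousCochains (smoothRep L (tail L n))).d n (n + 1) zf = 0 :=
      d_iCycles_apply _ n (n + 1) z
    have hy : (groupCohomology.cochainsMap (A := derivRep L (tail L n) i)
        (B := smoothRep L (tail L n)) (MonoidHom.id (TRat F E)) S.g).f n y = zf := by
      have h5 : ∀ g, (derivHom L (tail L n) i).hom (y g) = zf g := fun g =>
        Subtype.ext (lieDeriv_primitive L i (zf g).2)
      exact funext h5
    have h := groupCohomology.δ_apply hS rfl zf hz' y hy x hx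
    refine ⟨groupCohomology.cocyclesMkOfCompEqD hS hx, ?_, fun g => ?_⟩
    · refine h.symm.trans (Eq.trans ?_ (congrArg (groupCohomology.δ hS n (n + 1) rfl) hz))
      refine congrArg (fun z => groupCohomology.δ hS n (n + 1) rfl
        (groupCohomology.π (smoothRep L (tail L n)) n z)) ?_
      exact iCocycles_injective _ _ (groupCohomology.iCocycles_mk (A := smoothRep L (tail L n)) zf hd)
    · exact congrArg (fun f : (Fin (n + 1) → TRat F E) → smoothFun L (tail L (n + 1)) => (f g).1)
        (groupCohomology.iCocycles_mk (A := smoothRep L (tail L (n + 1))) x _)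

/-! ### Invariance of `∂` under translation of `φ` by `T(F_∞)_0`. -/

theorem shift_mem {J : Set (Fin L.u)} {f : TAdele F E → ℂ} (hf : f ∈ smoothFun L J)
    (v : Fin L.u → ℝ) : (fun t => f (t.1 * L.expVec v, t.2)) ∈ smoothFun L J := by
  refine ⟨hf.1.comp (((continuous_mul_const _).comp continuous_fst).prodMk continuous_snd),
    fun s => ?_, fun i hi x t s => ?_⟩
  · have h := (hf.2.1 s).translate (L.expVec v)
    simp only [mul_comm (L.expVec v)] at h
    exact h
  · have h := hf.2.2 i hi x (t * L.expVec v) s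
    rw [mul_right_comm] at h
    exact h

theorem lieDeriv_shift (i : Fin L.u) (f : TAdele F E → ℂ) (v : Fin L.u → ℝ) :
    lieDeriv L i (fun t => f (t.1 * L.expVec v, t.2)) =
      fun t => lieDeriv L i f (t.1 * L.expVec v, t.2) := by
  funext t
  simp only [lieDeriv, mul_right_comm]

/-- Translation of functions by `e^v ∈ T(F_∞)_0`, as an endomorphism of `C^Σ`. -/
def shiftHom (J : Set (Fin L.u)) (v : Fin L.u → ℝ) : smoothRep L J ⟶ smoothRep L J :=
  Rep.ofHom
    { toFun := fun f => ⟨fun t => f.1 (t.1 * L.expVec v, t.2), shift_mem L f.2 v⟩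
      map_add' := fun _ _ => rfl
      map_smul' := fun _ _ => rfl
      isIntertwining' := fun γ => LinearMap.ext fun f => Subtype.ext (funext fun t =>
        congrArg (fun a => f.1 (a, (toFin F E γ)⁻¹ * t.2))
          (mul_assoc (toInf F E γ)⁻¹ t.1 (L.expVec v)).symm) }

/-- Translation of functions by `e^v ∈ T(F_∞)_0`, as an endomorphism of the domain of `δ_σ`. -/
def shiftDerivHom (J : Set (Fin L.u)) (i : Fin L.u) (v : Fin L.u → ℝ) :
    derivRep L J i ⟶ derivRep L J i :=
  Rep.ofHom
    { toFun := fun f => ⟨fun t => f.1 (t.1 * L.expVec v, t.2), shift_mem L f.2.1 v,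
        (lieDeriv_shift L i f.1 v).symm ▸ shift_mem L f.2.2 v⟩
      map_add' := fun _ _ => rfl
      map_smul' := fun _ _ => rfl
      isIntertwining' := fun γ => LinearMap.ext fun f => Subtype.ext (funext fun t =>
        congrArg (fun a => f.1 (a, (toFin F E γ)⁻¹ * t.2))
          (mul_assoc (toInf F E γ)⁻¹ t.1 (L.expVec v)).symm) }

variable {L} in
/-- Translation by `e^v ∈ T(F_∞)_0` on the exact sequence of `δ_σ`. -/
def seqShift {J J' : Set (Fin L.u)} {i : Fin L.u} (hJ : J' = J \ {i}) (v : Fin L.u → ℝ) :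
    seq hJ ⟶ seq hJ where
  τ₁ := shiftHom L J' v
  τ₂ := shiftDerivHom L J i v
  τ₃ := shiftHom L J v
  comm₁₂ := rfl
  comm₂₃ := Rep.hom_ext (Representation.IntertwiningMap.ext (LinearMap.ext fun f =>
    Subtype.ext (lieDeriv_shift L i f.1 v)))

/-- Translation by `e^v` is an endomorphism of each short exact sequence, and connecting maps are
natural. -/
theorem iterConn_shift (v : Fin L.u → ℝ) (n : ℕ) (hn : n ≤ L.u) :
    iterConn L n hn ≫ groupCohomology.map (MonoidHom.id _) (shiftHom L (tail L n) v) n =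
      groupCohomology.map (MonoidHom.id _) (shiftHom L (tail L 0) v) 0 ≫ iterConn L n hn := by
  induction n with
  | zero => exact (Category.id_comp _).trans (Category.comp_id _).symm
  | succ n ih =>
    have h := groupCohomology.δ_naturality (seq_shortExact (tail_succ L ⟨n, hn⟩) (Nat.le_refl n))
      (seq_shortExact (tail_succ L ⟨n, hn⟩) (Nat.le_refl n)) (seqShift (tail_succ L ⟨n, hn⟩) v)
      n (n + 1) rfl
    refine (Category.assoc _ _ _).trans ?_
    refine (congrArg (iterConn L n _ ≫ ·) h).trans ?_
    refine (Category.assoc _ _ _).symm.trans ?_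
    refine (congrArg (· ≫ _) (ih (Nat.le_of_succ_le hn))).trans ?_
    exact Category.assoc _ _ _

/-- Translation of `T(F)`-invariant functions by `e^v ∈ T(F_∞)_0`. -/
def shiftInv (φ : (smoothRep L (tail L 0)).ρ.invariants) (v : Fin L.u → ℝ) :
    (smoothRep L (tail L 0)).ρ.invariants :=
  ⟨(shiftHom L (tail L 0) v).hom φ.1, fun γ => by
    have h := Rep.hom_comm_apply (shiftHom L (tail L 0) v) γ φ.1
    rw [φ.2 γ] at h
    exact h.symm⟩

theorem shiftHom_eq_id (v : Fin L.u → ℝ) : shiftHom L (tail L L.u) v = 𝟙 _ :=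
  Rep.hom_ext (Representation.IntertwiningMap.ext (LinearMap.ext fun f =>
    Subtype.ext (funext fun t => apply_mul_expVec f.2 t.1 v t.2)))

/-- By naturality the translation may be carried out after `∂`, where it acts on `C^∅` as the
identity. -/
theorem conn_shiftInv (φ : (smoothRep L (tail L 0)).ρ.invariants) (v : Fin L.u → ℝ) :
    conn L (shiftInv L φ v) = conn L φ := by
  have h := iterConn_shift L v L.u le_rfl
  rw [shiftHom_eq_id, groupCohomology.map_id, Category.comp_id] at h
  have h1 : (groupCohomology.H0Iso (smoothRep L (tail L 0))).inv (shiftInv L φ v) =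
      groupCohomology.map (MonoidHom.id _) (shiftHom L (tail L 0) v) 0
        ((groupCohomology.H0Iso (smoothRep L (tail L 0))).inv φ) := by
    have h2 := ConcreteCategory.congr_hom
      (groupCohomology.map_id_comp_H0Iso_hom (shiftHom L (tail L 0) v))
      ((groupCohomology.H0Iso (smoothRep L (tail L 0))).inv φ)
    have h3 := ConcreteCategory.congr_hom
      (groupCohomology.H0Iso (smoothRep L (tail L 0))).inv_hom_id φ
    have h4 := ConcreteCategory.congr_hom (groupCohomology.H0Iso (smoothRep L (tail L 0))).hom_inv_id
      (groupCohomology.map (MonoidHom.id _) (shiftHom L (tail L 0) v) 0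
        ((groupCohomology.H0Iso (smoothRep L (tail L 0))).inv φ))
    refine Eq.trans ?_ h4
    refine congrArg (groupCohomology.H0Iso (smoothRep L (tail L 0))).inv ?_
    refine Eq.trans ?_ h2.symm
    exact (congrArg ((Rep.invariantsFunctor ℂ (TRat F E)).map (shiftHom L (tail L 0) v)) h3).symm
  rw [conn, h1]
  exact (congrArg (fun f => f ((groupCohomology.H0Iso (smoothRep L (tail L 0))).inv φ)) h).symm

end Cocycle



/-! ### The value of the cap product -/

section CapValue

variable {F E : Type} [Field F] [NumberField F] [Field E] [NumberField E] [Algebra F E]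
variable {L : SplitPlaces F E}
variable (μS : Measure L.compactPart) (μf : Measure (TFin F E))
  [μS.IsHaarMeasure] [μf.IsHaarMeasure] [CompactSpace L.compactPart]
  [SigmaCompactSpace (TFin F E)]

/-- All cosets other than `T(F_∞)_+` contribute zero, and on that one the integrand is `f` cut off
by `1_𝓕`. -/
theorem pairing_iotaFun (hE : Module.finrank F E = 2) {c : Ideal (𝓞 F)} (hc : c ≠ ⊥)
    (r : ClPos E c → TFin F E) {f : TAdele F E → ℂ} (hf : f ∈ smoothFun L (tail L L.u)) :
    pairing L μS μf f (iotaFun c r) = avg μS μf (finDomain E c r) f 0 := by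
  have hb := iotaFun_mem_ccFun L hE hc r
  have hB : IsClosed (finDomain E c r) := (isCompact_finDomain L hE hc r).isClosed
  rw [pairing_eq_finsum μS μf hf.1 hb, finsum_eq_single _ (1 : TInf F E ⧸ infPos F E)]
  · have h1 : (Quotient.out (1 : TInf F E ⧸ infPos F E)) ∈ infPos F E :=
      (QuotientGroup.eq_one_iff _).1 (QuotientGroup.out_eq' _)
    have h2 := piece_mul μS μf hf hb 1 h1
    rw [one_mul] at h2
    rw [h2, ← setIntegral_eq_avg μS μf hE hc r hf.1 0,
      ← integral_indicator (isClosed_univ.prod hB).measurableSet, piece]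
    refine integral_congr_ae (Filter.Eventually.of_forall fun p => ?_)
    have hp : (1 : TInf F E) * p.1 ∈ infPos F E :=
      mul_mem (one_mem _) (L.mem_compactPart.1 p.1.2).1
    by_cases h : p.2 ∈ finDomain E c r
    · simp only [iotaFun, hp, h, and_self, if_true, Set.indicator, Set.mem_prod, Set.mem_univ,
        L.expVec_zero, Int.cast_one, mul_one]
    · simp only [iotaFun, h, and_false, if_false, Set.indicator, Set.mem_prod, Int.cast_zero,
        mul_zero]
  · intro z hz
    rw [piece]
    refine integral_eq_zero_of_ae (Filter.Eventually.of_forall fun p => ?_)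
    have hp : ¬ z.out * (p.1 : TInf F E) ∈ infPos F E := fun h => hz (by
      rw [← QuotientGroup.out_eq' z]
      exact (QuotientGroup.eq_one_iff _).2
        (((infPos F E).mul_mem_cancel_right (L.mem_compactPart.1 p.1.2).1).1 h))
    simp only [iotaFun, hp, false_and, if_false, Int.cast_zero, mul_zero, Pi.zero_apply]

variable [Finite (TInf F E ⧸ infPos F E)]

/-- The sum `∑_π sgn(π) ⟨z(ε_{π 0}, …, ε_{π (u-1)}), ι(1_𝓕)⟩` for the cocycle `z` of `∂ φ`. -/
def altSum (c : Ideal (𝓞 F)) (r : ClPos E c → TFin F E) (ε : Fin L.u → unitsPos E c)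
    (φ : TAdele F E → ℂ) : ℂ :=
  ∑ π : Equiv.Perm (Fin L.u), (Equiv.Perm.sign π : ℤ) •
    avg μS μf (finDomain E c r) (iterCocycle L φ L.u le_rfl fun i => (ε (π i)).1) 0

theorem chainsMap_fundChain {c : Ideal (𝓞 F)} {r : ClPos E c → TFin F E}
    (hb : iotaFun c r ∈ ccFun L) (ε : Fin L.u → unitsPos E c) :
    ((groupHomology.chainsMap (unitsPos E c).subtype (iotaHom L c r hb)).f L.u
      (fundChain L c ε) : (Fin L.u → TRat F E) →₀ ccFun L) =
    ((-1) ^ (L.u * (L.u + 1) / 2) *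
      (SignType.sign (Matrix.det (Matrix.of fun i => unitLog L c (ε i))) : ℤ)) •
    ∑ π : Equiv.Perm (Fin L.u), (Finsupp.single (fun i => (ε (π i)).1)
      ((Equiv.Perm.sign π : ℤ) • (⟨iotaFun c r, hb⟩ : ccFun L)) :
        (Fin L.u → TRat F E) →₀ ccFun L) := by
  rw [fundChain]
  refine (map_zsmul ((groupHomology.chainsMap (unitsPos E c).subtype
    (iotaHom L c r hb)).f L.u).hom _ _).trans ?_
  refine congrArg _ ((map_sum ((groupHomology.chainsMap (unitsPos E c).subtype
    (iotaHom L c r hb)).f L.u).hom _ _).trans ?_)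
  refine Finset.sum_congr rfl fun π _ => ?_
  exact groupHomology.chainsMap_f_single (unitsPos E c).subtype (iotaHom L c r hb) L.u _ _

theorem sum_pairing_eq (hE : Module.finrank F E = 2) {c : Ideal (𝓞 F)} (hc : c ≠ ⊥)
    {r : ClPos E c → TFin F E} (hb : iotaFun c r ∈ ccFun L) {ε : Fin L.u → unitsPos E c}
    {y₀ : groupHomology.cycles (Rep.trivial ℤ (unitsPos E c) ℤ) L.u}
    (hy₀ : groupHomology.iCycles (Rep.trivial ℤ (unitsPos E c) ℤ) L.u y₀ = fundChain L c ε)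
    (φ : (smoothRep L (tail L 0)).ρ.invariants)
    {z : groupCohomology.cocycles (smoothRep L (tail L L.u)) L.u}
    (hz : groupCohomology.π (smoothRep L (tail L L.u)) L.u z = conn L φ)
    {y : groupHomology.cycles (ccRep L) L.u}
    (hy : groupHomology.π (ccRep L) L.u y =
      groupHomology.map (unitsPos E c).subtype (iotaHom L c r hb) L.u
        (groupHomology.π (Rep.trivial ℤ (unitsPos E c) ℤ) L.u y₀)) :
    chainPair μS μf (groupCohomology.iCocycles (smoothRep L (tail L L.u)) L.u z :
        (Fin L.u → TRat F E) → smoothFun L (tail L L.u))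
      (groupHomology.iCycles (ccRep L) L.u y : (Fin L.u → TRat F E) →₀ ccFun L) =
    ((-1) ^ (L.u * (L.u + 1) / 2) *
      (SignType.sign (Matrix.det (Matrix.of fun i => unitLog L c (ε i))) : ℤ)) •
      altSum μS μf c r ε φ.1.1 := by
  obtain ⟨z', hz', hzg⟩ := exists_cocycle_eq_iterCocycle L φ L.u le_rfl
  let y' : groupHomology.cycles (ccRep L) L.u :=
    groupHomology.cyclesMap (unitsPos E c).subtype (iotaHom L c r hb) L.u y₀
  have hy' : groupHomology.π (ccRep L) L.u y = groupHomology.π (ccRep L) L.u y' :=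
    hy.trans (groupHomology.π_map_apply (unitsPos E c).subtype (iotaHom L c r hb) L.u y₀)
  have hi : groupHomology.iCycles (ccRep L) L.u y' =
      (groupHomology.chainsMap (unitsPos E c).subtype (iotaHom L c r hb)).f L.u
        (fundChain L c ε) := by
    rw [← hy₀]
    exact ConcreteCategory.congr_hom (HomologicalComplex.cyclesMap_i
      (groupHomology.chainsMap (unitsPos E c).subtype (iotaHom L c r hb)) L.u) y₀
  rw [chainPair_eq_of_cohomologous μS μf (hz.trans hz'.symm),
    chainPair_eq_of_homologous μS μf z' hy']
  refine (congrArg (chainPair μS μf _) (hi.trans (chainsMap_fundChain hb ε))).trans ?_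
  rw [map_zsmul, map_sum, altSum]
  refine congrArg _ (Finset.sum_congr rfl fun π _ => ?_)
  rw [chainPair_single, map_zsmul]
  refine congrArg _ ?_
  rw [← pairing_iotaFun μS μf hE hc r (hzg _ ▸ Subtype.mem _), ← hzg]
  rfl

/-- Both sides are, up to the same sign, the cap product with one homology class of the same
cohomology class `∂φ`. -/
theorem altSum_shift (hE : Module.finrank F E = 2) {c : Ideal (𝓞 F)} (hc : c ≠ ⊥)
    (r : ClPos E c → TFin F E) {ε : Fin L.u → unitsPos E c}
    (hε : LinearIndependent ℝ fun i => unitLog L c (ε i))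
    (φ : (smoothRep L (tail L 0)).ρ.invariants) (v : Fin L.u → ℝ) :
    altSum μS μf c r ε (fun t => φ.1.1 (t.1 * L.expVec v, t.2)) =
      altSum μS μf c r ε φ.1.1 := by
  have hb := iotaFun_mem_ccFun L hE hc r
  obtain ⟨y₀, hy₀⟩ := exists_cycle_eq_fundChain L c ε
  obtain ⟨z, hz, -⟩ := exists_cocycle_eq_iterCocycle L φ L.u le_rfl
  have hy := (groupHomology.π_map_apply (unitsPos E c).subtype (iotaHom L c r hb) L.u y₀).symm
  have h1 := sum_pairing_eq μS μf hE hc hb hy₀ φ hz hy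
  have h2 := sum_pairing_eq μS μf hE hc hb hy₀ (shiftInv L φ v)
    (hz.trans (conn_shiftInv L φ v).symm) hy
  have h3 := h2.symm.trans h1
  have hdet : Matrix.det (Matrix.of fun i => unitLog L c (ε i)) ≠ 0 := by
    exact ((Matrix.isUnit_iff_isUnit_det _).1
      (Matrix.linearIndependent_rows_iff_isUnit.1 hε)).ne_zero
  -- The sign of the fundamental chain is nonzero, as the logarithm vectors are independent, and
  -- cancels.
  refine smul_right_injective ℂ (mul_ne_zero (pow_ne_zero _ (by norm_num)) ?_) h3
  rcases hdet.lt_or_gt with h | h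
  · simp [sign_neg h]
  · simp [sign_pos h]

end CapValue



/-! ### Iterated primitives on `ℝ^u` -/

section RealIter

open Filter Topology

variable {u : ℕ}

/-- The primitive of `f` in the direction of the `i`-th coordinate vanishing where `x i = 0`. -/
def linePrimitive (i : Fin u) (f : (Fin u → ℝ) → ℂ) : (Fin u → ℝ) → ℂ := fun x =>
  ∫ y in (0 : ℝ)..1, (x i : ℂ) * f (x + Pi.single i ((y - 1) * x i))

/-- The analogue on `ℝ^u` of the iterated connecting homomorphism. -/
def lineCocycle (f : (Fin u → ℝ) → ℂ) :
    ∀ n : ℕ, n ≤ u → (Fin n → Fin u → ℝ) → (Fin u → ℝ) → ℂ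
  | 0, _, _ => f
  | n + 1, hn, ℓ => fun x =>
    linePrimitive ⟨n, hn⟩ (lineCocycle f n (Nat.le_of_succ_le hn) fun i => ℓ i.succ) (x - ℓ 0) -
    linePrimitive ⟨n, hn⟩ (fun x =>
      lineCocycle f n (Nat.le_of_succ_le hn) (fun i => ℓ i.succ) (x - ℓ 0)) x

theorem integral_intervalIntegral_swap {X : Type*} [TopologicalSpace X] [MeasurableSpace X]
    [OpensMeasurableSpace X] [OpensMeasurableSpace (X × ℝ)] {μ : Measure X}
    [IsFiniteMeasureOnCompacts μ] [SFinite μ] {A K : Set X} (hA : MeasurableSet A)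
    (hK : IsCompact K) (hK' : IsClosed K) (hAK : A ⊆ K) {f : X → ℝ → ℂ}
    (hf : Continuous fun p : X × ℝ => f p.1 p.2) :
    ∫ x in A, (∫ y in (0 : ℝ)..1, f x y) ∂μ = ∫ y in (0 : ℝ)..1, (∫ x in A, f x y ∂μ) := by
  simp only [intervalIntegral.integral_of_le zero_le_one]
  refine integral_integral_swap ?_
  rw [Measure.prod_restrict]
  have h : IntegrableOn (fun p : X × ℝ => f p.1 p.2) (K ×ˢ Set.Icc 0 1) (μ.prod volume) :=
    hf.continuousOn.integrableOn_compact' (hK.prod isCompact_Icc)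
      (hK'.prod isClosed_Icc).measurableSet
  exact h.mono_set (Set.prod_mono hAK Set.Ioc_subset_Icc_self)

theorem lineCocycle_continuous {P : Type*} [TopologicalSpace P] {f : P → (Fin u → ℝ) → ℂ}
    (hf : Continuous fun p : P × (Fin u → ℝ) => f p.1 p.2) (n : ℕ) (hn : n ≤ u)
    (ℓ : Fin n → Fin u → ℝ) :
    Continuous fun p : P × (Fin u → ℝ) => lineCocycle (f p.1) n hn ℓ p.2 := by
  have hp : ∀ (i : Fin u) (f : P → (Fin u → ℝ) → ℂ)
      (hf : Continuous fun p : P × (Fin u → ℝ) => f p.1 p.2),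
      Continuous fun p : P × (Fin u → ℝ) => linePrimitive i (f p.1) p.2 := by
    intro i f hf
    refine intervalIntegral.continuous_parametric_intervalIntegral_of_continuous' ?_ 0 1
    have h1 : Continuous fun q : (P × (Fin u → ℝ)) × ℝ =>
        (q.1.1, q.1.2 + Pi.single i ((q.2 - 1) * q.1.2 i)) := by
      have h2 : Continuous fun q : (P × (Fin u → ℝ)) × ℝ => (q.2 - 1) * q.1.2 i := by fun_prop
      exact (continuous_fst.comp continuous_fst).prodMk
        ((continuous_snd.comp continuous_fst).add ((continuous_single i).comp h2))
    have h3 : Continuous fun q : (P × (Fin u → ℝ)) × ℝ => (q.1.2 i : ℂ) := by fun_prop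
    exact h3.mul (hf.comp h1)
  induction n with
  | zero => exact hf
  | succ n ih =>
    have h1 := ih (Nat.le_of_succ_le hn) fun i => ℓ i.succ
    have h2 : Continuous fun p : P × (Fin u → ℝ) => (p.1, p.2 - ℓ 0) := by fun_prop
    exact ((hp ⟨n, hn⟩ (fun p => lineCocycle (f p) n _ _) h1).comp h2).sub
      (hp ⟨n, hn⟩ (fun p x => lineCocycle (f p) n _ _ (x - ℓ 0)) (h1.comp h2))

/-- The construction is linear in `f` and consists of translations and integrals over `[0, 1]`,
which commute with the integral over the parameter by Fubini. -/
theorem integral_lineCocycle {X : Type*} [TopologicalSpace X] [MeasurableSpace X]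
    [OpensMeasurableSpace X] [OpensMeasurableSpace (X × ℝ)] {μ : Measure X}
    [IsFiniteMeasureOnCompacts μ] [SFinite μ] {A K : Set X} (hA : MeasurableSet A)
    (hK : IsCompact K) (hK' : IsClosed K) (hAK : A ⊆ K) {f : X → (Fin u → ℝ) → ℂ}
    (hf : Continuous fun p : X × (Fin u → ℝ) => f p.1 p.2) (n : ℕ) (hn : n ≤ u)
    (ℓ : Fin n → Fin u → ℝ) (x : Fin u → ℝ) :
    ∫ v in A, lineCocycle (f v) n hn ℓ x ∂μ =
      lineCocycle (fun x => ∫ v in A, f v x ∂μ) n hn ℓ x := by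
  have hp : ∀ (i : Fin u) (f : X → (Fin u → ℝ) → ℂ)
      (hf : Continuous fun p : X × (Fin u → ℝ) => f p.1 p.2) (x : Fin u → ℝ),
      IntegrableOn (fun v => linePrimitive i (f v) x) A μ ∧
      ∫ v in A, linePrimitive i (f v) x ∂μ = linePrimitive i (fun x => ∫ v in A, f v x ∂μ) x := by
    intro i f hf x
    have hc : Continuous fun q : X × ℝ =>
        (x i : ℂ) * f q.1 (x + Pi.single i ((q.2 - 1) * x i)) := by
      have h1 : Continuous fun q : X × ℝ => (q.1, x + Pi.single i ((q.2 - 1) * x i)) := by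
        have h2 : Continuous fun q : X × ℝ => (q.2 - 1) * x i := by fun_prop
        exact continuous_fst.prodMk (continuous_const.add ((continuous_single i).comp h2))
      exact continuous_const.mul (hf.comp h1)
    constructor
    · have h := intervalIntegral.continuous_parametric_intervalIntegral_of_continuous'
        (μ := volume)
        (f := fun (v : X) (y : ℝ) => (x i : ℂ) * f v
          (x + (Pi.single i ((y - 1) * x i) : Fin u → ℝ))) hc 0 1
      exact (h.continuousOn.integrableOn_compact' hK hK'.measurableSet).mono_set hAK
    · simp only [linePrimitive]
      rw [integral_intervalIntegral_swap hA hK hK' hAK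
        (f := fun (v : X) (y : ℝ) => (x i : ℂ) * f v
          (x + (Pi.single i ((y - 1) * x i) : Fin u → ℝ))) hc]
      simp only [integral_const_mul]
  induction n generalizing x with
  | zero => rfl
  | succ n ih =>
    have h1 := lineCocycle_continuous hf n (Nat.le_of_succ_le hn) fun i => ℓ i.succ
    have h2 : Continuous fun p : X × (Fin u → ℝ) => (p.1, p.2 - ℓ 0) := by fun_prop
    have h3 := hp ⟨n, hn⟩ (fun v => lineCocycle (f v) n _ _) h1 (x - ℓ 0)
    have h4 := hp ⟨n, hn⟩ (fun v x => lineCocycle (f v) n (Nat.le_of_succ_le hn)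
      (fun i => ℓ i.succ) (x - ℓ 0)) (h1.comp h2) x
    simp only [lineCocycle]
    rw [integral_sub h3.1 h4.1, h3.2, h4.2]
    simp only [ih]

/-- The primitive of a constant `C` in direction `i` is `C x_i`, and its change under `x ↦ x - ℓ 0`
is `-C (ℓ 0)_i`. Later steps use earlier arguments of the cochain, so coordinate `k` meets the
argument of index `k.rev`. -/
theorem lineCocycle_const (m : ℂ) (n : ℕ) (hn : n ≤ u) (ℓ : Fin n → Fin u → ℝ) (x : Fin u → ℝ) :
    lineCocycle (fun _ => m) n hn ℓ x =
      (-1) ^ n * m * ∏ k : Fin n, (ℓ k.rev (Fin.castLE hn k) : ℂ) := by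
  induction n generalizing x with
  | zero => simp [lineCocycle]
  | succ n ih =>
    simp only [lineCocycle, linePrimitive, ih]
    rw [intervalIntegral.integral_const, intervalIntegral.integral_const, Fin.prod_univ_castSucc]
    have h : ∀ k : Fin n, (Fin.castSucc k).rev = k.rev.succ := fun k => by
      rw [Fin.rev_castSucc]
    simp only [h, Fin.rev_last, sub_zero, one_smul, Pi.sub_apply, Complex.ofReal_sub]
    have h5 : (Fin.castLE hn (Fin.last n)) = ⟨n, hn⟩ := rfl
    rw [h5, pow_succ]
    have h6 : ∀ k : Fin n, Fin.castLE hn k.castSucc = Fin.castLE (Nat.le_of_succ_le hn) k :=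
      fun _ => rfl
    simp only [h6]
    ring

theorem sign_revPerm (n : ℕ) : Equiv.Perm.sign (Fin.revPerm : Equiv.Perm (Fin n)) =
    (-1) ^ (n * (n - 1) / 2) := by
  induction n with
  | zero => rfl
  | succ n ih =>
    -- Reversal followed by rotation fixes `0` and reverses the remaining letters.
    have h : finRotate (n + 1) * (Fin.revPerm : Equiv.Perm (Fin (n + 1))) =
        Equiv.Perm.decomposeFin.symm (0, Fin.revPerm) := by
      ext i
      refine Fin.cases ?_ (fun i => ?_) i
      · simp
      · simp [Fin.rev_succ]
    have h1 := congrArg Equiv.Perm.sign h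
    rw [map_mul, sign_finRotate, Equiv.Perm.decomposeFin.symm_sign, if_pos rfl, one_mul, ih,
      Nat.add_sub_cancel] at h1
    rw [Nat.triangle_succ, pow_add, ← h1, mul_comm, ← mul_assoc, ← mul_pow]
    simp

/-- Substituting the product of `π` with the reversal gives the Leibniz formula, at the cost of the
sign of the reversal. -/
theorem sum_sign_prod_rev (M : Matrix (Fin u) (Fin u) ℝ) :
    ∑ π : Equiv.Perm (Fin u), (Equiv.Perm.sign π : ℤ) • ∏ k, (M (π k.rev) k : ℂ) =
      (-1) ^ (u * (u - 1) / 2) * (M.det : ℂ) := by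
  have h1 : ∑ π : Equiv.Perm (Fin u), (Equiv.Perm.sign π : ℤ) • ∏ k, (M (π k.rev) k : ℂ) =
      ∑ π : Equiv.Perm (Fin u), (Equiv.Perm.sign (π * Fin.revPerm) : ℤ) • ∏ k, (M (π k) k : ℂ) := by
    rw [← Equiv.sum_comp (Equiv.mulRight (Fin.revPerm : Equiv.Perm (Fin u)))]
    refine Finset.sum_congr rfl fun π _ => ?_
    simp [mul_assoc]
  rw [h1, Matrix.det_apply', ]
  push_cast
  rw [Finset.mul_sum]
  refine Finset.sum_congr rfl fun π _ => ?_
  rw [map_mul, sign_revPerm, zsmul_eq_mul]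
  push_cast
  ring

end RealIter



/-! ### Comparison with `ℝ^u` -/

section Compare

open scoped Pointwise

variable {F E : Type} [Field F] [NumberField F] [Field E] [NumberField E] [Algebra F E]
variable {L : SplitPlaces F E}

theorem expVec_single (L : SplitPlaces F E) (i : Fin L.u) (a : ℝ) :
    L.expVec (Pi.single i a) = L.oneParam i a := by
  rw [SplitPlaces.expVec, Finset.prod_eq_single i]
  · rw [Pi.single_eq_same]
  · intro j _ hj
    rw [Pi.single_eq_of_ne hj, oneParam_zero]
  · exact fun h => absurd (Finset.mem_univ _) h

theorem logAbs_expVec_mul (x : Fin L.u → ℝ) (s : L.compactPart) (i : Fin L.u) :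
    (L.logAbs i (L.expVec x * s)).toAdd = x i := by
  have h := L.logVec_mul (L.expVec x) s
  rw [L.logVec_expVec, (L.mem_compactPart.1 s.2).2, add_zero] at h
  exact congrFun h i

variable (μS : Measure L.compactPart) (μf : Measure (TFin F E))
  [μS.IsHaarMeasure] [μf.IsHaarMeasure] [CompactSpace L.compactPart]
  [SigmaCompactSpace (TFin F E)]

theorem avg_shift (B : Set (TFin F E)) (f : TAdele F E → ℂ) (v x : Fin L.u → ℝ) :
    avg μS μf B (fun t => f (t.1 * L.expVec v, t.2)) x = avg μS μf B f (x + v) := by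
  simp only [avg, L.expVec_add, mul_right_comm]

/-- The finite component of `γ` lies in `U` and preserves `𝓕` and its measure. The archimedean
component is `e^ℓ s₀` with `s₀ ∈ S`, and averaging over `S` removes `s₀`. -/
theorem avg_translate {c : Ideal (𝓞 F)} (hc : c ≠ ⊥) {r : ClPos E c → TFin F E}
    (γ : unitsPos E c) (f : TAdele F E → ℂ) (x : Fin L.u → ℝ) :
    avg μS μf (finDomain E c r) (translate γ.1 f) x =
      avg μS μf (finDomain E c r) f (x - unitLog L c γ) := by
  set a := toInf F E γ.1 with ha
  set g := toFin F E γ.1 with hg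
  have hB : MeasurableSet (finDomain E c r) := (isOpen_finDomain hc r).measurableSet
  have hmem : ∀ t, g⁻¹ * t ∈ finDomain E c r ↔ t ∈ finDomain E c r := by
    have h : ∀ y ∈ maxCompact E c, ∀ t ∈ finDomain E c r, y * t ∈ finDomain E c r := by
      rintro y hy _ ⟨i, z, hz, rfl⟩
      exact ⟨i, y * z, mul_mem hy hz, mul_left_comm _ _ _⟩
    refine fun t => ⟨fun ht => ?_, h _ (inv_mem γ.2.2) t⟩
    have h1 := h g γ.2.2 _ ht
    rwa [mul_inv_cancel_left] at h1
  have h1 : ∀ F : TFin F E → ℂ, ∫ t in finDomain E c r, F (g⁻¹ * t) ∂μf =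
      ∫ t in finDomain E c r, F t ∂μf := fun F => by
    rw [← integral_indicator hB, ← integral_indicator hB,
      ← integral_mul_left_eq_self ((finDomain E c r).indicator F) g⁻¹]
    congr 1
    funext t
    by_cases ht : t ∈ finDomain E c r
    · rw [Set.indicator_of_mem ht, Set.indicator_of_mem ((hmem t).2 ht)]
    · rw [Set.indicator_of_notMem ht, Set.indicator_of_notMem fun h => ht ((hmem t).1 h)]
  let s₀ : L.compactPart := ⟨_, L.expVec_logVec_inv_mul_mem γ.2.1⟩
  have h2 : ∀ s : L.compactPart, a⁻¹ * (L.expVec x * s) =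
      L.expVec (x - unitLog L c γ) * (s₀⁻¹ * s : L.compactPart) := fun s => by
    change _ = _ * (((L.expVec (unitLog L c γ))⁻¹ * a)⁻¹ * (s : TInf F E))
    rw [sub_eq_add_neg, L.expVec_add, L.expVec_neg, mul_inv_rev, inv_inv]
    generalize L.expVec (unitLog L c γ) = y
    rw [mul_assoc, mul_assoc a⁻¹ y, mul_left_comm y⁻¹, inv_mul_cancel_left, mul_left_comm]
  have h3 := integral_mul_left_eq_self (μ := μS) (fun s => ∫ t in finDomain E c r,
    f (L.expVec (x - unitLog L c γ) * s, t) ∂μf) s₀⁻¹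
  rw [avg, avg, ← h3]
  refine integral_congr_ae (Filter.Eventually.of_forall fun s => ?_)
  change ∫ t in finDomain E c r, f (a⁻¹ * (L.expVec x * s), g⁻¹ * t) ∂μf =
    ∫ t in finDomain E c r,
      f (L.expVec (x - unitLog L c γ) * (s₀⁻¹ * s : L.compactPart), t) ∂μf
  rw [← h2]
  exact h1 fun t => f (a⁻¹ * (L.expVec x * s), t)

theorem avg_sub (hE : Module.finrank F E = 2) {c : Ideal (𝓞 F)} (hc : c ≠ ⊥)
    (r : ClPos E c → TFin F E) {f g : TAdele F E → ℂ} (hf : Continuous f) (hg : Continuous g)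
    (x : Fin L.u → ℝ) :
    avg μS μf (finDomain E c r) (f - g) x =
      avg μS μf (finDomain E c r) f x - avg μS μf (finDomain E c r) g x := by
  have hcl : IsClosed (finDomain E c r) := (isCompact_finDomain L hE hc r).isClosed
  have h : Continuous fun p : L.compactPart × TFin F E =>
      ((1 * L.expVec x * p.1, p.2) : TAdele F E) := by fun_prop
  have hint : ∀ φ : TAdele F E → ℂ, Continuous φ → IntegrableOn
      (fun p : L.compactPart × TFin F E => φ (1 * L.expVec x * p.1, p.2))
      ((Set.univ : Set L.compactPart) ×ˢ finDomain E c r) (μS.prod μf) := fun φ hφ =>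
    ContinuousOn.integrableOn_compact' (isCompact_univ.prod (isCompact_finDomain L hE hc r))
      (isClosed_univ.prod hcl).measurableSet (hφ.comp h).continuousOn
  rw [← setIntegral_eq_avg μS μf hE hc r (hf.sub hg), ← setIntegral_eq_avg μS μf hE hc r hf,
    ← setIntegral_eq_avg μS μf hE hc r hg, ← integral_sub (hint f hf) (hint g hg)]
  rfl

/-- On `e^x s` the logarithm used by `primitive` is the coordinate `x i`, independent of `s`; Fubini
then exchanges the average and the line integral. -/
theorem avg_primitive (hE : Module.finrank F E = 2) {c : Ideal (𝓞 F)} (hc : c ≠ ⊥)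
    (r : ClPos E c → TFin F E) (i : Fin L.u) {f : TAdele F E → ℂ} (hf : Continuous f)
    (hp : Continuous (primitive L i f)) (x : Fin L.u → ℝ) :
    avg μS μf (finDomain E c r) (primitive L i f) x =
      linePrimitive i (avg μS μf (finDomain E c r) f) x := by
  have hK := isCompact_finDomain L hE hc r
  have h1 : ∀ p : L.compactPart × TFin F E,
      primitive L i f (1 * L.expVec x * p.1, p.2) = ∫ y in (0 : ℝ)..1,
        (x i : ℂ) * f (1 * L.expVec (x + (Pi.single i ((y - 1) * x i) : Fin L.u → ℝ)) * p.1,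
          p.2) := fun p => by
    simp only [primitive, one_mul, logAbs_expVec_mul, L.expVec_add, expVec_single, mul_right_comm]
  have hc' : Continuous fun q : (L.compactPart × TFin F E) × ℝ => (x i : ℂ) *
      f (1 * L.expVec (x + (Pi.single i ((q.2 - 1) * x i) : Fin L.u → ℝ)) * q.1.1, q.1.2) := by
    have h2 : Continuous fun q : (L.compactPart × TFin F E) × ℝ => (q.2 - 1) * x i := by fun_prop
    have h3 := L.continuous_expVec.comp
      ((continuous_const (y := x)).add ((continuous_single (A := fun _ : Fin L.u => ℝ) i).comp h2))
    have h4 : Continuous fun q : (L.compactPart × TFin F E) × ℝ => (q.1.1 : TInf F E) := by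
      fun_prop
    have h5 : Continuous fun q : (L.compactPart × TFin F E) × ℝ => q.1.2 := by fun_prop
    exact continuous_const.mul (hf.comp ((((continuous_const_mul 1).comp h3).mul h4).prodMk h5))
  rw [← setIntegral_eq_avg μS μf hE hc r hp]
  simp only [h1]
  rw [integral_intervalIntegral_swap (isClosed_univ.prod hK.isClosed).measurableSet
    (isCompact_univ.prod hK) (isClosed_univ.prod hK.isClosed) subset_rfl
    (f := fun (q : L.compactPart × TFin F E) (y : ℝ) => (x i : ℂ) *
      f (1 * L.expVec (x + (Pi.single i ((y - 1) * x i) : Fin L.u → ℝ)) * q.1, q.2)) hc']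
  refine intervalIntegral.integral_congr fun y _ => ?_
  simp only [integral_const_mul]
  rw [setIntegral_eq_avg μS μf hE hc r hf]

theorem iterCocycle_mem (φ : (smoothRep L (tail L 0)).ρ.invariants) (n : ℕ) (hn : n ≤ L.u)
    (g : Fin n → TRat F E) : iterCocycle L φ.1.1 n hn g ∈ smoothFun L (tail L n) := by
  obtain ⟨z, -, hz⟩ := exists_cocycle_eq_iterCocycle L φ n hn
  rw [← hz]
  exact Subtype.mem _

/-- Averaging intertwines each ingredient of the adelic recursion with its counterpart on `ℝ^u`:
differences, translations by `T(𝒪_F)_+` and primitives. -/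
theorem avg_iterCocycle (hE : Module.finrank F E = 2) {c : Ideal (𝓞 F)} (hc : c ≠ ⊥)
    (r : ClPos E c → TFin F E) (φ : (smoothRep L (tail L 0)).ρ.invariants) (n : ℕ) (hn : n ≤ L.u)
    (γ : Fin n → unitsPos E c) (x : Fin L.u → ℝ) :
    avg μS μf (finDomain E c r) (iterCocycle L φ.1.1 n hn fun i => (γ i).1) x =
      lineCocycle (avg μS μf (finDomain E c r) φ.1.1) n hn (fun i => unitLog L c (γ i)) x := by
  induction n generalizing x with
  | zero => rfl
  | succ n ih =>
    have hi : (⟨n, hn⟩ : Fin L.u) ∈ tail L n := Nat.le_refl n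
    have h := iterCocycle_mem φ n (Nat.le_of_succ_le hn) fun i => (γ i.succ).1
    have h1 := translate_mem L h (γ 0).1
    have h2 := primitive_mem L hi h
    have h3 := primitive_mem L hi h1
    rw [iterCocycle, avg_sub μS μf hE hc r (translate_mem L h2 _).1 h3.1, avg_translate μS μf hc,
      avg_primitive μS μf hE hc r _ h.1 h2.1, avg_primitive μS μf hE hc r _ h1.1 h3.1]
    rw [lineCocycle]
    congr 2
    · funext x
      exact ih _ _ x
    · funext x
      rw [avg_translate μS μf hc]
      exact ih _ _ _

theorem continuous_avg (hE : Module.finrank F E = 2) {c : Ideal (𝓞 F)} (hc : c ≠ ⊥)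
    (r : ClPos E c → TFin F E) {f : TAdele F E → ℂ} (hf : Continuous f) :
    Continuous (avg μS μf (finDomain E c r) f) := by
  have hK := isCompact_finDomain L hE hc r
  have h1 : avg μS μf (finDomain E c r) f = fun x =>
      ∫ p in (Set.univ : Set L.compactPart) ×ˢ finDomain E c r,
        f (1 * L.expVec x * p.1, p.2) ∂(μS.prod μf) :=
    funext fun x => (setIntegral_eq_avg μS μf hE hc r hf x).symm
  have hK' : IsCompact ((Set.univ : Set L.compactPart) ×ˢ finDomain E c r) := isCompact_univ.prod hK
  haveI : IsFiniteMeasure ((μS.prod μf).restrict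
      ((Set.univ : Set L.compactPart) ×ˢ finDomain E c r)) :=
    ⟨by rw [Measure.restrict_apply_univ]; exact hK'.measure_lt_top⟩
  have h := continuous_parametric_integral_of_continuous
    (f := fun (x : Fin L.u → ℝ) (p : L.compactPart × TFin F E) => f (1 * L.expVec x * p.1, p.2)) (hf.comp (continuous_param L 1))
    hK' (μ := (μS.prod μf).restrict ((Set.univ : Set L.compactPart) ×ˢ finDomain E c r))
  rw [Measure.restrict_restrict_of_subset subset_rfl] at h
  rw [h1]
  exact h

theorem apply_diag_mul (φ : (smoothRep L (tail L 0)).ρ.invariants) (γ : TRat F E)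
    (t : TAdele F E) : φ.1.1 (diag F E γ * t) = φ.1.1 t := by
  have h := congrArg (fun f : smoothFun L (tail L 0) => f.1 t) (φ.2 γ⁻¹)
  refine Eq.trans ?_ h
  change φ.1.1 (diag F E γ * t) = φ.1.1 ((diag F E γ⁻¹)⁻¹ * t)
  rw [map_inv, inv_inv]

/-- Invariance of `φ` makes its average `Λ`-periodic, and a periodic function has the same integral
over any two fundamental parallelotopes. -/
theorem integral_avg_add {c : Ideal (𝓞 F)} (hc : c ≠ ⊥) (r : ClPos E c → TFin F E)
    (φ : (smoothRep L (tail L 0)).ρ.invariants) {b : Module.Basis (Fin L.u) ℝ (Fin L.u → ℝ)}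
    (hb : (Submodule.span ℤ (Set.range b) : Set (Fin L.u → ℝ)) = Set.range (unitLog L c))
    (x : Fin L.u → ℝ) :
    ∫ v in ZSpan.fundamentalDomain b, avg μS μf (finDomain E c r) φ.1.1 (x + v) =
      ∫ v in ZSpan.fundamentalDomain b, avg μS μf (finDomain E c r) φ.1.1 v := by
  set A := avg μS μf (finDomain E c r) φ.1.1 with hA
  have hper : ∀ γ : unitsPos E c, ∀ v, A (unitLog L c γ + v) = A v := fun γ v => by
    have h := avg_translate μS μf hc (r := r) γ φ.1.1 (unitLog L c γ + v)
    rw [add_sub_cancel_left] at h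
    rw [hA, ← h]
    congr 1
    funext t
    rw [translate, ← map_inv, apply_diag_mul]
  have hD := ZSpan.isAddFundamentalDomain' b (volume : Measure (Fin L.u → ℝ))
  have hD' := hD.vadd_of_comm x
  have h1 : ∫ v in ZSpan.fundamentalDomain b, A (x + v) =
      ∫ v in x +ᵥ ZSpan.fundamentalDomain b, A v := by
    have h2 := (measurePreserving_add_left (volume : Measure (Fin L.u → ℝ)) x).setIntegral_image_emb
      (Homeomorph.addLeft x).measurableEmbedding A (ZSpan.fundamentalDomain b)
    exact h2.symm
  rw [h1]
  haveI : Countable (Submodule.span ℤ (Set.range b)).toAddSubgroup :=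
    (hb ▸ Set.countable_range (unitLog L c) :
      (Submodule.span ℤ (Set.range b) : Set (Fin L.u → ℝ)).Countable).to_subtype
  refine hD'.setIntegral_eq hD fun g v => ?_
  have hg : (g : Fin L.u → ℝ) ∈ Set.range (unitLog L c) := hb ▸ g.2
  obtain ⟨γ, hγ⟩ := hg
  change A ((g : Fin L.u → ℝ) + v) = A v
  rw [← hγ, hper]

end Compare



/-! ### Averaging over the period parallelotope and evaluation of the alternating sum. -/

section Final

variable {F E : Type} [Field F] [NumberField F] [Field E] [NumberField E] [Algebra F E]
variable {L : SplitPlaces F E}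
variable (μS : Measure L.compactPart) (μf : Measure (TFin F E))
  [μS.IsHaarMeasure] [μf.IsHaarMeasure] [CompactSpace L.compactPart]
  [SigmaCompactSpace (TFin F E)] [Finite (TInf F E ⧸ infPos F E)]

/-- Since `altSum` is unchanged when `φ` is translated by `e^v`, it may be integrated over `v` in
the parallelotope. Inside the recipe this replaces the average of `φ` by a constant, for which the
value is known. -/
theorem volume_mul_altSum (hE : Module.finrank F E = 2) {c : Ideal (𝓞 F)} (hc : c ≠ ⊥)
    (r : ClPos E c → TFin F E) {ε : Fin L.u → unitsPos E c}
    (hε : LinearIndependent ℝ fun i => unitLog L c (ε i))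
    {b : Module.Basis (Fin L.u) ℝ (Fin L.u → ℝ)}
    (hb : (Submodule.span ℤ (Set.range b) : Set (Fin L.u → ℝ)) = Set.range (unitLog L c))
    (φ : (smoothRep L (tail L 0)).ρ.invariants) :
    (volume.real (ZSpan.fundamentalDomain b) : ℂ) * altSum μS μf c r ε φ.1.1 =
      (-1) ^ (L.u * (L.u + 1) / 2) *
        ((Matrix.det (Matrix.of fun i => unitLog L c (ε i)) : ℝ) : ℂ) *
        ∫ v in ZSpan.fundamentalDomain b, avg μS μf (finDomain E c r) φ.1.1 v := by
  set A := avg μS μf (finDomain E c r) φ.1.1 with hA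
  set m := ∫ v in ZSpan.fundamentalDomain b, A v with hm
  have hAc : Continuous A := continuous_avg μS μf hE hc r φ.1.2.1
  have hc' : Continuous fun p : (Fin L.u → ℝ) × (Fin L.u → ℝ) => A (p.2 + p.1) :=
    hAc.comp (continuous_snd.add continuous_fst)
  have hK : IsCompact (closure (ZSpan.fundamentalDomain b)) :=
    (ZSpan.fundamentalDomain_isBounded b).isCompact_closure
  have hmeas := ZSpan.fundamentalDomain_measurableSet b
  have h1 : ∀ v, altSum μS μf c r ε φ.1.1 = ∑ π : Equiv.Perm (Fin L.u),
      (Equiv.Perm.sign π : ℤ) • lineCocycle (fun x => A (x + v)) L.u le_rfl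
        (fun i => unitLog L c (ε (π i))) 0 := fun v => by
    rw [← altSum_shift μS μf hE hc r hε φ v, altSum]
    refine Finset.sum_congr rfl fun π _ => ?_
    have h2 := avg_iterCocycle μS μf hE hc r (shiftInv L φ v) L.u le_rfl (fun i => ε (π i)) 0
    have h3 : avg μS μf (finDomain E c r) (shiftInv L φ v).1.1 = fun x => A (x + v) :=
      funext fun x => avg_shift μS μf _ φ.1.1 v x
    rw [h3] at h2
    exact congrArg _ h2
  have h2 : ∀ π : Equiv.Perm (Fin L.u), ∫ v in ZSpan.fundamentalDomain b,
      lineCocycle (fun x => A (x + v)) L.u le_rfl (fun i => unitLog L c (ε (π i))) 0 =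
      (-1) ^ L.u * m * ∏ k, (unitLog L c (ε (π k.rev)) k : ℂ) := fun π => by
    rw [integral_lineCocycle hmeas hK isClosed_closure subset_closure
      (f := fun v x => A (x + v)) hc']
    have h3 : (fun x => ∫ v in ZSpan.fundamentalDomain b, A (x + v)) = fun _ => m :=
      funext fun x => integral_avg_add μS μf hc r φ hb x
    rw [h3, lineCocycle_const]
    rfl
  have h4 : (volume.real (ZSpan.fundamentalDomain b) : ℂ) * altSum μS μf c r ε φ.1.1 =
      ∫ v in ZSpan.fundamentalDomain b, altSum μS μf c r ε φ.1.1 := by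
    rw [setIntegral_const, Complex.real_smul]
  rw [h4, integral_congr_ae (Filter.Eventually.of_forall h1), integral_finsetSum]
  · have h5 : ∀ π : Equiv.Perm (Fin L.u), ∫ v in ZSpan.fundamentalDomain b,
        (Equiv.Perm.sign π : ℤ) • lineCocycle (fun x => A (x + v)) L.u le_rfl
          (fun i => unitLog L c (ε (π i))) 0 =
        (-1) ^ L.u * m * ((Equiv.Perm.sign π : ℤ) • ∏ k, (unitLog L c (ε (π k.rev)) k : ℂ)) :=
      fun π => by
        simp only [zsmul_eq_mul]
        rw [integral_const_mul, h2]
        ring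
    rw [Finset.sum_congr rfl fun π _ => h5 π, ← Finset.mul_sum]
    have h6 := sum_sign_prod_rev (Matrix.of fun i => unitLog L c (ε i))
    simp only [Matrix.of_apply] at h6
    -- The sign of the reversal and the `u` factors `-1` of the primitives combine to the exponent
    -- `u (u + 1) / 2`.
    have h7 : L.u * (L.u + 1) / 2 = L.u * (L.u - 1) / 2 + L.u := by
      have h := Nat.triangle_succ L.u
      rw [Nat.add_sub_cancel, mul_comm] at h
      exact h
    rw [h6, h7, pow_add]
    ring
  · intro π _
    have h8 := lineCocycle_continuous (f := fun v x => A (x + v)) hc' L.u le_rfl fun i => unitLog L c (ε (π i))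
    have h9 : Continuous fun v => (Equiv.Perm.sign π : ℤ) • lineCocycle (fun x => A (x + v)) L.u
        le_rfl (fun i => unitLog L c (ε (π i))) 0 :=
      (h8.comp (continuous_id.prodMk continuous_const)).const_smul _
    exact (h9.continuousOn.integrableOn_compact hK).mono_set subset_closure

/-- The parallelotope has volume `|det|`, so dividing by it leaves `(-1)^(u(u+1)/2)` times the sign
of the determinant, which the normalisation of the fundamental class cancels. -/
theorem smul_altSum (hE : Module.finrank F E = 2) {c : Ideal (𝓞 F)} (hc : c ≠ ⊥)
    (r : ClPos E c → TFin F E) {ε : Fin L.u → unitsPos E c}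
    {b : Module.Basis (Fin L.u) ℝ (Fin L.u → ℝ)} (hbε : ⇑b = fun i => unitLog L c (ε i))
    (hb : (Submodule.span ℤ (Set.range b) : Set (Fin L.u → ℝ)) = Set.range (unitLog L c))
    (φ : (smoothRep L (tail L 0)).ρ.invariants) :
    ((-1) ^ (L.u * (L.u + 1) / 2) *
      (SignType.sign (Matrix.det (Matrix.of fun i => unitLog L c (ε i))) : ℤ)) •
      altSum μS μf c r ε φ.1.1 =
        ∫ v in ZSpan.fundamentalDomain b, avg μS μf (finDomain E c r) φ.1.1 v := by
  have hε : LinearIndependent ℝ fun i => unitLog L c (ε i) := hbε ▸ b.linearIndependent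
  have h := volume_mul_altSum μS μf hE hc r hε hb φ
  rw [ZSpan.volume_real_fundamentalDomain, hbε] at h
  have hdet : Matrix.det (Matrix.of fun i => unitLog L c (ε i)) ≠ 0 :=
    ((Matrix.isUnit_iff_isUnit_det _).1
      (Matrix.linearIndependent_rows_iff_isUnit.1 hε)).ne_zero
  set d := Matrix.det (Matrix.of fun i => unitLog L c (ε i))
  have hd : ((|d| : ℝ) : ℂ) ≠ 0 := Complex.ofReal_ne_zero.2 (abs_ne_zero.2 hdet)
  refine mul_left_cancel₀ hd ?_
  rw [zsmul_eq_mul, mul_left_comm, h]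
  have hs : ((SignType.sign d : ℤ) : ℂ) * d = ((|d| : ℝ) : ℂ) := by
    rcases hdet.lt_or_gt with h | h
    · simp [sign_neg h, abs_of_neg h]
    · simp [sign_pos h, abs_of_pos h]
  have hone : ((-1 : ℂ) ^ (L.u * (L.u + 1) / 2)) * (-1) ^ (L.u * (L.u + 1) / 2) = 1 := by
    rw [← mul_pow]; simp
  generalize (SignType.sign d : ℤ) = s at hs ⊢
  push_cast
  linear_combination (∫ v in ZSpan.fundamentalDomain b, avg μS μf (finDomain E c r) φ.1.1 v) *
    (s * d * hone + hs)

end Final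

end RelTorus

end

theorem proposition2p2 (F E : Type) [Field F] [NumberField F] [Field E] [NumberField E]
    [Algebra F E] (hE : Module.finrank F E = 2)
    (c : Ideal (NumberField.RingOfIntegers F)) (hc : c ≠ ⊥)
    (L : RelTorus.SplitPlaces F E)
    (r : RelTorus.ClPos E c → RelTorus.TFin F E) (hr : ∀ x, QuotientGroup.mk (r x) = x)
    (μS : MeasureTheory.Measure L.compactPart) [μS.IsHaarMeasure]
    (μf : MeasureTheory.Measure (RelTorus.TFin F E)) [μf.IsHaarMeasure] :
    (∃ η, RelTorus.IsEta L c r η) ∧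
    (∃ D, MeasureTheory.IsFundamentalDomain (RelTorus.diag F E).range D
      (RelTorus.haar L μS μf)) ∧
    ∀ φ : (RelTorus.smoothRep L (RelTorus.tail L 0)).ρ.invariants,
    ∀ η, RelTorus.IsEta L c r η →
    ∀ D, MeasureTheory.IsFundamentalDomain (RelTorus.diag F E).range D
        (RelTorus.haar L μS μf) →
      MeasureTheory.IntegrableOn φ.1.1 D (RelTorus.haar L μS μf) ∧
      RelTorus.IsCap L μS μf (RelTorus.conn L φ) η
        ((RelTorus.torsionCard E c : ℂ) * ∫ t in D, φ.1.1 t ∂(RelTorus.haar L μS μf)) := by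
  haveI := RelTorus.compactSpace_compactPart L hE
  haveI := RelTorus.sigmaCompactSpace_TFin L hE
  haveI := RelTorus.SplitPlaces.finite_quotient_infPos L hE
  have hbasis : ∀ ε : Fin L.u → RelTorus.unitsPos E c,
      LinearIndependent ℝ (fun i => RelTorus.unitLog L c (ε i)) →
      ∃ b : Module.Basis (Fin L.u) ℝ (Fin L.u → ℝ), ⇑b = fun i => RelTorus.unitLog L c (ε i) :=
    fun ε hε => by
      classical
      exact ⟨basisOfPiSpaceOfLinearIndependent hε, coe_basisOfPiSpaceOfLinearIndependent hε⟩
  refine ⟨RelTorus.exists_isEta L hE hc r, ?_, ?_⟩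
  · obtain ⟨ε, hε, hspan⟩ := RelTorus.exists_unitLog_basis L hE hc
    obtain ⟨b, hb⟩ := hbasis ε hε
    exact RelTorus.exists_isFundamentalDomain_haar μS μf hE hc hr (hb ▸ hspan)
  · rintro φ η ⟨hι, ξ, ⟨ε, hε, hspan, y₀, hy₀, rfl⟩, rfl⟩ D hD
    obtain ⟨b, hb⟩ := hbasis ε hε
    have hbspan : (Submodule.span ℤ (Set.range b) : Set (Fin L.u → ℝ)) =
        Set.range (RelTorus.unitLog L c) := hb ▸ hspan
    obtain ⟨hint, hval⟩ := RelTorus.integral_isFundamentalDomain μS μf hE hc hr hbspan φ.1.2.1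
      (RelTorus.apply_diag_mul φ) hD
    refine ⟨hint, fun z y hz hy => ?_⟩
    rw [← hval, ← RelTorus.smul_altSum μS μf hE hc r hb hbspan φ]
    exact RelTorus.sum_pairing_eq μS μf hE hc hι hy₀ φ hz hy
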